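/- Consider $N$ control loops, each closed over the same number $L$ of hops, on the horizon $\{0,\dots,T\}$. Loop $i$ has the dynamics $x_{k+1}^i=A_ix_k^i+B_iu_k^i+w_k^i$, $y_k^i=C_ix_k^i+v_k^i$, where the vectors $x_0^i\sim\mathcal N(0,\Omega_0^i)$, $w_k^i\sim\mathcal N(0,W_i)$, $v_k^i\sim\mathcal N(0,V_i)$ ($k\ge 0$) are mutually independent, $\Omega_0^i,W_i\succeq0$, $V_i\succ0$. The first of the decision makers $1,\dots,L+1$ runs the Kalman filter $\hat x^i_{k|k}[1]=\hat x^i_{k|k-1}[1]+\zeta_k^i$ with $\hat x^i_{0|-1}[1]=0$ and $\zeta^i_k=K^i_k(y^i_k-C_i\hat x^i_{k|k-1}[1])$, $K^i_k$ the Kalman gain. Hop delays are one step: with $\hat x_{k+1|k}^i[j]=A_i\hat x_{k|k}^i[j]+B_iu_k^i$, decision maker $j+1$ ($1\le j\le L$) uses $\hat x_{k+1|k+1}^i[j+1]=\hat x_{k+1|k}^i[j]$ if $\delta_k^i[j]=1$ and $\hat x_{k+1|k}^i[j+1]$ if $\delta_k^i[j]=0$, starting from $\hat x_{0|0}^i[j+1]=0$.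 The controller is decision maker $L+1$ and applies $u_k^i=-L_k^i\hat x_{k|k}^i[L+1]$ with $L_k^i=(R_i+B_i^\top S_{k+1}^iB_i)^{-1}B_i^\top S_{k+1}^iA_i$, where $S_k^i$ is given by the Riccati recursion $S_k^i=Q_i+A_i^\top\bigl(S^i_{k+1}-S^i_{k+1}B_i(R_i+B_i^\top S^i_{k+1}B_i)^{-1}B_i^\top S^i_{k+1}\bigr)A_i$, $S_T^i=\Lambda_i$, with $Q_i,\Lambda_i\succeq0$, $R_i\succ0$. Put $\Gamma_k^i=(L_k^i)^\top(R_i+B_i^\top S_{k+1}^iB_i)L_k^i$ for $k<T$ and $\Gamma_k^i=0$ for $k\ge T$, let $\tilde x_k^i[j]=\hat x_{k|k}^i[j]-\hat x_{k|k}^i[j+1]$ be the mismatch error and $e_k^i=x_k^i-\hat x_{k|k}^i[1]$. Let $\lambda[1],\dots,\lambda[L]\ge0$; in particular these may be optimal Lagrange multipliers for the constraints $\sum_i r^i[j]\le R[j]$ on the request rates $r^i[j]=\mathbb E\sum_{k<T}\delta_k^i[j]$. Put $$\mathrm{dVoI}_k^i[j]=\lambda[j]-\tilde x_k^i[j]^\top(A_i^{L+1-j})^\top\Gamma^i_{k+L+1-j}A_i^{L+1-j}\,\tilde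 x_k^i[j].$$ Choose any set of schedulers $(i,j)$ (for example a single one, or all of them), and let them use the policy $\delta_k^i[j]=1$ if $k\le T-(L+1-j)$ and $\mathrm{dVoI}_k^i[j]<0$, and $\delta_k^i[j]=0$ otherwise, while all remaining schedulers use the periodic policy $\delta\equiv1$. Then the following hold. 1. The policies are admissible: $\delta_k^i[j]$ is a measurable function of $\zeta_t^i$ for $t\le k-(j-1)$, of $\delta_t^i[l]$ for $l<j$, $t\le k-(j-l)$, and of $\delta_t^i[j]$ for $t<k$. They are independent across loops and hops in the sense that the decision of $(i,j)$ is the above threshold rule in its own mismatch error, whatever the chosen set is. 2. Let $\mathcal J_k^i[j]$ be the information of scheduler $(i,j)$ at time $k$: past controls $u^i_{0:k-1}$ and own decisions $\delta^i_{0:k-1}[j]$, together with $\hat x^i_{t|t}[1]$, $t\le k$, if $j=1$, and with the decisions $\delta_{0:k-1}^i[j-1]$ and the sets $\mathcal J_t^i[j-1]$ for those $t<k$ with $\delta_t^i[j-1]=1$ if $j>1$. For $k\le T-(L+1-j)$, $\tilde x_k^i[j]$ and $\delta_k^i[j]$ are $\mathcal J_k^i[j]$-measurable, and $\mathrm{dVoI}_k^i[j]$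 is almost surely the gain in the cost when a measurement is sent as opposed to when it is blocked, computed by a rollout with the periodic policy as base policy: $$\mathrm{dVoI}_k^i[j]=\mathbb E\bigl[H\mid\mathcal J_k^i[j],\ \delta_k^i[j]=1\bigr]-\mathbb E\bigl[H\mid\mathcal J_k^i[j],\ \delta_k^i[j]=0\bigr],\qquad H=\sum_{\substack{j\le l\le L\\ k+l-j<T}}\mathbb G^i_{k+l-j}[l],$$ $$\mathbb G^i_k[j]=\sum_{l=j}^{L}\bigl(-2(e^i_{k+1})^\top\Gamma^i_{k+1}\tilde x^i_{k+1}[l]+\tilde x^i_{k+1}[l]^\top\Gamma^i_{k+1}\tilde x^i_{k+1}[l]\bigr)+\lambda[j]\delta^i_k[j].$$ Here the decisions before time $k$, and those at time $k$ of the schedulers $l<j$, are those of the chosen policies; $\delta_k^i[j]$ is set to $1$, respectively $0$; and the decisions of the schedulers $l>j$ at time $k$ and all decisions after time $k$ are $1$. The random variables $H$ are integrable. 3. The periodic policy is outperformed: in each loop $i$ the Lagrangian cost $$\mathbb E\Bigl[(x_T^i)^\top\Lambda_ix_T^i+\sum_{k<T}\bigl((x_k^i)^\top Q_ix_k^i+(u_k^i)^\top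 R_iu_k^i\bigr)\Bigr]+\sum_{j=1}^L\lambda[j]r^i[j]$$ is finite and at most its value when all schedulers transmit at all times, and so is its sum over $i$. -/

import Mathlib

open MeasureTheory ProbabilityTheory Matrix

noncomputable section

namespace VoI

/-- The data of one control loop: dynamics `x⁺ = A x + B u + w`, `y = C x + v`, the weights of the
LQG cost, and the covariances of process noise, measurement noise and initial state. -/
structure Plant (n p m : ℕ) where
  A : Matrix (Fin n) (Fin n) ℝ
  B : Matrix (Fin n) (Fin p) ℝ
  C : Matrix (Fin m) (Fin n) ℝ
  Q : Matrix (Fin n) (Fin n) ℝ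
  R : Matrix (Fin p) (Fin p) ℝ
  Lam : Matrix (Fin n) (Fin n) ℝ
  W : Matrix (Fin n) (Fin n) ℝ
  V : Matrix (Fin m) (Fin m) ℝ
  Om : Matrix (Fin n) (Fin n) ℝ
  posSemidef_Q : Q.PosSemidef
  posDef_R : R.PosDef
  posSemidef_Lam : Lam.PosSemidef
  posSemidef_W : W.PosSemidef
  posDef_V : V.PosDef
  posSemidef_Om : Om.PosSemidef

/-! ### Primitive random variables -/

/-- A realization of the initial state, the process noise and the measurement noise of one loop. -/
structure Noise (n m : ℕ) where
  x0 : Fin n → ℝ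
  w : ℕ → Fin n → ℝ
  v : ℕ → Fin m → ℝ

/-- Labels of the primitive random vectors of one loop: `x₀`, `w_k`, `v_k`. -/
inductive Src where
  | init : Src
  | proc (k : ℕ) : Src
  | meas (k : ℕ) : Src

/-- Dimension of a primitive random vector. -/
def Src.dim (n m : ℕ) : Src → ℕ
  | .init => n
  | .proc _ => n
  | .meas _ => m

/-- The primitive vector with a given label. -/
def Noise.get {n m : ℕ} (z : Noise n m) : (s : Src) → Fin (s.dim n m) → ℝ
  | .init => z.x0
  | .proc k => z.w k
  | .meas k => z.v k

/-- `X` is a random vector with law `N(0, S)`. -/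
def IsCenteredGaussian {Ω : Type*} [MeasurableSpace Ω] (μ : Measure Ω) {d : ℕ}
    (X : Ω → Fin d → ℝ) (S : Matrix (Fin d) (Fin d) ℝ) : Prop :=
  Measurable X ∧ μ.map (fun ω => WithLp.toLp 2 (X ω)) = multivariateGaussian 0 S

/-- The primitive random vectors of the loop are mutually independent, with `x₀ ∼ N(0, Ω₀)`,
`w_k ∼ N(0, W)`, `v_k ∼ N(0, V)`. -/
structure IsNoise {Ω : Type*} [MeasurableSpace Ω] (μ : Measure Ω) {n p m : ℕ}
    (P : Plant n p m) (ξ : Ω → Noise n m) : Prop where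
  init : IsCenteredGaussian μ (fun ω => (ξ ω).x0) P.Om
  proc : ∀ k, IsCenteredGaussian μ (fun ω => (ξ ω).w k) P.W
  meas : ∀ k, IsCenteredGaussian μ (fun ω => (ξ ω).v k) P.V
  indep : iIndepFun (fun (s : Src) (ω : Ω) => (ξ ω).get s) μ

variable {n p m L : ℕ}

/-! ### Kalman filter and linear-quadratic gains -/

/-- Kalman gain for the prediction covariance `S`: `S Cᵀ (C S Cᵀ + V)⁻¹`. -/
def gainOf (P : Plant n p m) (S : Matrix (Fin n) (Fin n) ℝ) : Matrix (Fin n) (Fin m) ℝ :=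
  S * P.Cᵀ * (P.C * S * P.Cᵀ + P.V)⁻¹

/-- Prediction error covariance `Σ_{k|k-1}`. -/
def predCov (P : Plant n p m) : ℕ → Matrix (Fin n) (Fin n) ℝ
  | 0 => P.Om
  | k + 1 => P.A * (predCov P k - gainOf P (predCov P k) * P.C * predCov P k) * P.Aᵀ + P.W

/-- Kalman gain `K_k`. -/
def kalmanGain (P : Plant n p m) (k : ℕ) : Matrix (Fin n) (Fin m) ℝ :=
  gainOf P (predCov P k)

/-- The Riccati matrix with `s` steps to go. -/
def riccatiToGo (P : Plant n p m) : ℕ → Matrix (Fin n) (Fin n) ℝ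
  | 0 => P.Lam
  | s + 1 => P.Q + P.Aᵀ * (riccatiToGo P s - riccatiToGo P s * P.B *
      (P.R + P.Bᵀ * riccatiToGo P s * P.B)⁻¹ * P.Bᵀ * riccatiToGo P s) * P.A

/-- The Riccati matrix `S_k` for horizon `T`: `S_T = Λ`, and `S_k = 0` beyond the horizon. -/
def riccati (P : Plant n p m) (T k : ℕ) : Matrix (Fin n) (Fin n) ℝ :=
  if k ≤ T then riccatiToGo P (T - k) else 0

/-- The feedback gain `L_k = (R + Bᵀ S_{k+1} B)⁻¹ Bᵀ S_{k+1} A`. -/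
def lqrGain (P : Plant n p m) (T k : ℕ) : Matrix (Fin p) (Fin n) ℝ :=
  (P.R + P.Bᵀ * riccati P T (k + 1) * P.B)⁻¹ * P.Bᵀ * riccati P T (k + 1) * P.A

/-- `Γ_k = L_kᵀ (R + Bᵀ S_{k+1} B) L_k`; it vanishes for `k ≥ T`, where there is no control. -/
def Gam (P : Plant n p m) (T k : ℕ) : Matrix (Fin n) (Fin n) ℝ :=
  (lqrGain P T k)ᵀ * (P.R + P.Bᵀ * riccati P T (k + 1) * P.B) * lqrGain P T k

/-! ### The closed loop

Scheduler `j : Fin L` transmits from decision maker `j.castSucc` to decision maker `j.succ`.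
Decision maker `0` sits at the sensor, decision maker `Fin.last L` is the controller. Indices start
from `0`, so that the number of hops from scheduler `j` to the controller is `L - j`. -/

/-- State of the closed loop at time `k`: the plant state `x_k` and the estimates
`x̂_{k|k}` of all decision makers. -/
structure LoopState (n L : ℕ) where
  x : Fin n → ℝ
  est : Fin (L + 1) → Fin n → ℝ

/-- A rule which produces the decisions of all schedulers of a loop at each time. The information
that the rules considered below really use is described by `Admissible` and `infoSet`. -/
abbrev Law (n L : ℕ) := ℕ → LoopState n L → Fin L → Bool

/-- The periodic policy: transmit at all times at all hops. -/
def periodic : Law n L := fun _ _ _ => true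

/-- The certainty equivalence control `u_k = - L_k x̂_{k|k}` at the controller. -/
def control (P : Plant n p m) (T k : ℕ) (s : LoopState n L) : Fin p → ℝ :=
  -(lqrGain P T k *ᵥ s.est (Fin.last L))

/-- The prediction `x̂_{k+1|k}` of decision maker `d`. -/
def predict (P : Plant n p m) (T k : ℕ) (s : LoopState n L) (d : Fin (L + 1)) : Fin n → ℝ :=
  P.A *ᵥ s.est d + P.B *ᵥ control P T k s

/-- The plant state `x_{k+1}`. -/
def nextX (P : Plant n p m) (T : ℕ) (z : Noise n m) (k : ℕ) (s : LoopState n L) : Fin n → ℝ :=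
  P.A *ᵥ s.x + P.B *ᵥ control P T k s + z.w k

/-- The innovation `ζ_0 = K_0 (y_0 - C x̂_{0|-1})` with `x̂_{0|-1} = 0`. -/
def innovInit (P : Plant n p m) (z : Noise n m) : Fin n → ℝ :=
  kalmanGain P 0 *ᵥ (P.C *ᵥ z.x0 + z.v 0)

/-- The innovation `ζ_{k+1} = K_{k+1} (y_{k+1} - C x̂_{k+1|k})` at the first scheduler. -/
def innovNext (P : Plant n p m) (T : ℕ) (z : Noise n m) (k : ℕ) (s : LoopState n L) :
    Fin n → ℝ :=
  kalmanGain P (k + 1) *ᵥ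
    ((P.C *ᵥ nextX P T z k s + z.v (k + 1)) - P.C *ᵥ predict P T k s 0)

/-- The closed loop under the noise realization `z` and the decision rule `π`: the first decision
maker runs the Kalman filter, and decision maker `j + 1` receives with a delay of one step the
estimate of decision maker `j` if that one transmits, and otherwise predicts. -/
def state (P : Plant n p m) (T : ℕ) (π : Law n L) (z : Noise n m) : ℕ → LoopState n L
  | 0 =>
    { x := z.x0
      est := Fin.cons (α := fun _ => Fin n → ℝ) (innovInit P z) (fun _ => 0) }
  | k + 1 =>
    let s := state P T π z k
    { x := nextX P T z k s
      est := Fin.cons (α := fun _ => Fin n → ℝ) (predict P T k s 0 + innovNext P T z k s)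
        (fun j => if π k s j then predict P T k s j.castSucc else predict P T k s j.succ) }

/-- The innovation process `ζ_k` of the closed loop. -/
def innov (P : Plant n p m) (T : ℕ) (π : Law n L) (z : Noise n m) : ℕ → Fin n → ℝ
  | 0 => innovInit P z
  | k + 1 => innovNext P T z k (state P T π z k)

/-- The decision `δ_k[j]` in the closed loop. -/
def decision (P : Plant n p m) (T : ℕ) (π : Law n L) (z : Noise n m) (k : ℕ) (j : Fin L) : Bool :=
  π k (state P T π z k) j

/-- The mismatch error `x̃_{k|k}[j] = x̂_{k|k}[j] - x̂_{k|k}[j+1]`. -/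
def mismatch (s : LoopState n L) (j : Fin L) : Fin n → ℝ :=
  s.est j.castSucc - s.est j.succ

/-- `1` for a transmission and `0` otherwise. -/
def ind (b : Bool) : ℝ := if b then 1 else 0

/-! ### Admissible scheduling policies and information sets -/

/-- The decisions under `π` come from scheduling policies that are measurable functions of the
innovations and of preceding scheduling variables. With unit delays the total delay at scheduler
`j` (counted from `0`) is `j`; that scheduler uses `ζ_t` for `t ≤ k - j`, the decisions `δ_t[l]` of
a preceding scheduler `l < j` for `t ≤ k - (j - l)`, and its own past decisions. The constant
`x̂_{0|-1} = 0` is omitted. -/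
def Admissible (P : Plant n p m) (T : ℕ) (π : Law n L) : Prop :=
  ∃ ρ : ℕ → Fin L → (ℕ → Fin n → ℝ) × (ℕ → Fin L → Bool) → Bool,
    (∀ k j, Measurable (ρ k j)) ∧
    (∀ (k : ℕ) (j : Fin L) (ζ ζ' : ℕ → Fin n → ℝ) (d d' : ℕ → Fin L → Bool),
      (∀ t, t + (j : ℕ) ≤ k → ζ t = ζ' t) →
      (∀ (l : Fin L) (t : ℕ), l < j → t + ((j : ℕ) - (l : ℕ)) ≤ k → d t l = d' t l) →
      (∀ t, t < k → d t j = d' t j) →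
      ρ k j (ζ, d) = ρ k j (ζ', d')) ∧
    ∀ (z : Noise n m) (k : ℕ) (j : Fin L),
      decision P T π z k j = ρ k j (innov P T π z, decision P T π z)

/-- The information of scheduler `j` at time `k`, as a σ-algebra. Every scheduler knows the past
controls and its own past decisions. The first scheduler knows moreover the Kalman estimates up to
time `k`. Scheduler `j + 1` knows moreover at which times `t < k` scheduler `j` transmitted, and
the information that scheduler `j` had at these times. -/
def infoSet {Ω : Type*} (P : Plant n p m) (T : ℕ) (π : Law n L) (ξ : Ω → Noise n m) :
    (j : ℕ) → j < L → ℕ → MeasurableSpace Ω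
  | 0, h, k =>
    (⨆ (t : ℕ) (_ : t ≤ k),
      MeasurableSpace.comap (fun ω => (state P T π (ξ ω) t).est 0) inferInstance) ⊔
    (⨆ (t : ℕ) (_ : t < k),
      MeasurableSpace.comap (fun ω => control P T t (state P T π (ξ ω) t)) inferInstance) ⊔
    (⨆ (t : ℕ) (_ : t < k),
      MeasurableSpace.comap (fun ω => decision P T π (ξ ω) t ⟨0, h⟩) inferInstance)
  | j + 1, h, k =>
    MeasurableSpace.generateFrom
      {F : Set Ω | ∃ t < k, ∃ E : Set Ω,
        MeasurableSet[infoSet P T π ξ j (Nat.lt_of_succ_lt h) t] E ∧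
        F = {ω | ω ∈ E ∧ decision P T π (ξ ω) t ⟨j, Nat.lt_of_succ_lt h⟩ = true}} ⊔
    (⨆ (t : ℕ) (_ : t < k),
      MeasurableSpace.comap (fun ω => control P T t (state P T π (ξ ω) t)) inferInstance) ⊔
    (⨆ (t : ℕ) (_ : t < k),
      MeasurableSpace.comap (fun ω => decision P T π (ξ ω) t ⟨j + 1, h⟩) inferInstance)

/-! ### Costs -/

/-- The LQG cost of one realization,
`x_Tᵀ Λ x_T + ∑_{k<T} (x_kᵀ Q x_k + u_kᵀ R u_k)`. -/
def pathCost (P : Plant n p m) (T : ℕ) (π : Law n L) (z : Noise n m) : ℝ :=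
  (state P T π z T).x ⬝ᵥ (P.Lam *ᵥ (state P T π z T).x) +
    ∑ k ∈ Finset.range T,
      ((state P T π z k).x ⬝ᵥ (P.Q *ᵥ (state P T π z k).x) +
        control P T k (state P T π z k) ⬝ᵥ (P.R *ᵥ control P T k (state P T π z k)))

/-- The control cost `J` of one loop under the certainty equivalence controller. -/
def controlCost {Ω : Type*} [MeasurableSpace Ω] (μ : Measure Ω) (P : Plant n p m) (T : ℕ)
    (π : Law n L) (ξ : Ω → Noise n m) : ℝ :=
  ∫ ω, pathCost P T π (ξ ω) ∂μ

/-- The request rate `r[j] = E ∑_{k<T} δ_k[j]` of one loop at scheduler `j`. -/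
def requestRate {Ω : Type*} [MeasurableSpace Ω] (μ : Measure Ω) (P : Plant n p m) (T : ℕ)
    (π : Law n L) (ξ : Ω → Noise n m) (j : Fin L) : ℝ :=
  ∫ ω, ∑ k ∈ Finset.range T, ind (decision P T π (ξ ω) k j) ∂μ

/-- The Lagrangian cost `J + ∑_j λ[j] r[j]` of one loop. -/
def lagrangian {Ω : Type*} [MeasurableSpace Ω] (μ : Measure Ω) (P : Plant n p m) (T : ℕ)
    (lam : Fin L → ℝ) (π : Law n L) (ξ : Ω → Noise n m) : ℝ :=
  controlCost μ P T π ξ + ∑ j, lam j * requestRate μ P T π ξ j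

/-! ### Value of information -/

/-- The closed form
`λ[j] - x̃ᵀ (A^h)ᵀ Γ_{k+h} A^h x̃`, where `h` is the number of hops from scheduler `j` to the
controller. -/
def dVoI (P : Plant n p m) (T : ℕ) (lam : Fin L → ℝ) (k : ℕ) (j : Fin L) (e : Fin n → ℝ) : ℝ :=
  lam j - e ⬝ᵥ (((P.A ^ (L - (j : ℕ)))ᵀ * Gam P T (k + (L - (j : ℕ))) * P.A ^ (L - (j : ℕ))) *ᵥ e)

open Classical in
/-- The schedulers in `D` use the value of information: scheduler `j` transmits at time `k` iff
`k` is at most `T` minus the number of hops to the controller and its value of information is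
negative. All other schedulers of the loop transmit periodically. -/
def voiLaw (P : Plant n p m) (T : ℕ) (lam : Fin L → ℝ) (D : Set (Fin L)) : Law n L :=
  fun k s j =>
    if j ∈ D then decide (k + (L - (j : ℕ)) ≤ T ∧ dVoI P T lam k j (mismatch s j) < 0) else true

/-- The rollout of `π` at scheduler `j` and time `k` with the periodic policy as base policy:
follow `π` before time `k` (and at time `k` at the schedulers before `j`), let scheduler `j` take
the decision `a` at time `k`, and let all later decisions, and those of the subsequent schedulers
at time `k`, be transmissions. -/
def rollout (π : Law n L) (k : ℕ) (j : Fin L) (a : Bool) : Law n L :=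
  fun t s l =>
    if t < k then π t s l
    else if t = k then (if l < j then π k s l else if l = j then a else true)
    else true

/-- The estimation error `x_k - x̂_{k|k}` of the first decision maker. -/
def errFirst (s : LoopState n L) : Fin n → ℝ := s.x - s.est 0

/-- The hop cost of scheduler `j` at time `k`,
`∑_{l ≥ j} (-2 e_{k+1}ᵀ Γ_{k+1} x̃_{k+1}[l] + x̃_{k+1}[l]ᵀ Γ_{k+1} x̃_{k+1}[l]) + λ[j] δ_k[j]`,
where `e` is the estimation error of the first decision maker. -/
def hopCost (P : Plant n p m) (T : ℕ) (lam : Fin L → ℝ) (π : Law n L) (z : Noise n m)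
    (k : ℕ) (j : Fin L) : ℝ :=
  (∑ l ∈ Finset.univ.filter (fun l : Fin L => j ≤ l),
    (-2 * (errFirst (state P T π z (k + 1)) ⬝ᵥ
        (Gam P T (k + 1) *ᵥ mismatch (state P T π z (k + 1)) l)) +
      mismatch (state P T π z (k + 1)) l ⬝ᵥ
        (Gam P T (k + 1) *ᵥ mismatch (state P T π z (k + 1)) l))) +
  lam j * ind (decision P T π z k j)

/-- The cost-to-go of scheduler `j` at time `k`: the recursion
`H_k[j] = G_k[j] + H_{k+1}[j+1]` with `H_T = 0` and `H[L] = 0` (hops counted from `0`), unrolled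
to the sum of the hop costs `G_{k+(l-j)}[l]` over the hops `l ≥ j` with `k + (l - j) < T`. -/
def costToGo (P : Plant n p m) (T : ℕ) (lam : Fin L → ℝ) (π : Law n L) (z : Noise n m)
    (k : ℕ) (j : Fin L) : ℝ :=
  ∑ l ∈ Finset.univ.filter (fun l : Fin L => j ≤ l ∧ k + ((l : ℕ) - (j : ℕ)) < T),
    hopCost P T lam π z (k + ((l : ℕ) - (j : ℕ))) l

end VoI

end

noncomputable section

namespace VoI

/-! ### Quadratic forms -/

/-! The control enters the plant and every prediction alike. It therefore cancels from the Kalman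
innovations and the filter error, which are functions of the noise alone (`innov_eq`,
`errFirst_state`), and from all mismatch errors (`mismatch_eq`). Without its control part, an
estimate is the open-loop sum of the first `fresh` innovations (`ctrlFree_eq_openLoop`), so a
mismatch error is a block of consecutive innovations propagated by `A`. This already gives
admissibility: the estimates can be recomputed from delayed innovations and decisions.

The probabilistic core is a symmetry. The innovations up to time `M` and the filter error at time
`M` have a characteristic function without cross terms, so their joint law is invariant under
independent changes of sign (`IsNoise.map_sign_innovErr`). Threshold rules are even in the mismatch.
Reverse the signs of exactly those innovations that a given decision maker lacks at time `k`. The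
boundary of its information never lies strictly inside an earlier or simultaneous mismatch block
(`fresh_not_between`), so each such mismatch is either kept or negated as a whole, and no decision
up to time `k` changes (`modelDec_flipUnknown`). Hence this reversal, although its starting index is
random, preserves the law (`IsNoise.map_flipUnknown`), and functionals that are odd under it have
mean zero (`IsNoise.integral_eq_zero_of_odd`). All orthogonality relations come from this one fact.

For the rollout formula, the decision of scheduler `j` at time `k` travels as a single perturbed
estimate, one hop per step, and alters only two neighbouring mismatches at a time. Up to cross terms
the changes of the quadratic costs cancel at every hop except the last, which leaves `dVoI` plus
`rolloutCross` pathwise (`costToGo_rollout_sub`). The remainder is odd under the reversal attached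
to the sender, while the events in the scheduler's information are invariant (`infoSet_le_comap`);
so it vanishes under conditioning.

For the performance bound, completion of squares reduces the control cost to a penalty on the
information missing at the controller. A Pythagorean identity at each hop
(`IsNoise.knownGain_castSucc`) telescopes this into a policy-independent constant plus one
`blockCost` for each time and scheduler (`IsNoise.exists_controlCost_eq`). The periodic policy pays
`lam j` for each pair. The threshold policy pays either `lam j` or a quadratic form that is at most
`lam j`, so the comparison holds term by term. -/

lemma mulVec_dot {a b : ℕ} (A : Matrix (Fin a) (Fin b) ℝ) (x : Fin b → ℝ) (y : Fin a → ℝ) :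
    (A *ᵥ x) ⬝ᵥ y = x ⬝ᵥ (Aᵀ *ᵥ y) := by
  rw [dotProduct_comm, dotProduct_mulVec, ← mulVec_transpose, dotProduct_comm]

lemma dot_mulVec_comm {a : ℕ} {S : Matrix (Fin a) (Fin a) ℝ} (hS : Sᵀ = S) (x y : Fin a → ℝ) :
    x ⬝ᵥ (S *ᵥ y) = y ⬝ᵥ (S *ᵥ x) := by
  rw [dotProduct_comm, mulVec_dot, hS]

lemma transpose_eq_of_posSemidef {a : ℕ} {S : Matrix (Fin a) (Fin a) ℝ} (hS : S.PosSemidef) :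
    Sᵀ = S := by
  have := hS.isHermitian
  rwa [Matrix.IsHermitian, conjTranspose_eq_transpose_of_trivial] at this

lemma quad_nonneg {a : ℕ} {S : Matrix (Fin a) (Fin a) ℝ} (hS : S.PosSemidef) (x : Fin a → ℝ) :
    0 ≤ x ⬝ᵥ (S *ᵥ x) := by
  simpa using hS.dotProduct_mulVec_nonneg x

lemma posSemidef_of_quad {a : ℕ} {S : Matrix (Fin a) (Fin a) ℝ} (hS : Sᵀ = S)
    (h : ∀ x, 0 ≤ x ⬝ᵥ (S *ᵥ x)) : S.PosSemidef :=
  .of_dotProduct_mulVec_nonneg (by rw [Matrix.IsHermitian, conjTranspose_eq_transpose_of_trivial, hS])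
    (fun x => by simpa using h x)

lemma posSemidef_congr {a b : ℕ} {S : Matrix (Fin a) (Fin a) ℝ} (hS : S.PosSemidef)
    (A : Matrix (Fin b) (Fin a) ℝ) : (A * S * Aᵀ).PosSemidef := by
  have := hS.mul_mul_conjTranspose_same A
  rwa [conjTranspose_eq_transpose_of_trivial] at this

variable {n p m L : ℕ}

/-! ### The Kalman filter -/

/-- Covariance `C S Cᵀ + V` of the measurement prediction error. -/
def measCov (P : Plant n p m) (S : Matrix (Fin n) (Fin n) ℝ) : Matrix (Fin m) (Fin m) ℝ :=
  P.C * S * P.Cᵀ + P.V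

/-- Covariance of the innovation. -/
def innovCov (P : Plant n p m) (S : Matrix (Fin n) (Fin n) ℝ) : Matrix (Fin n) (Fin n) ℝ :=
  gainOf P S * measCov P S * (gainOf P S)ᵀ

lemma measCov_posDef (P : Plant n p m) {S : Matrix (Fin n) (Fin n) ℝ} (hS : S.PosSemidef) :
    (measCov P S).PosDef :=
  PosDef.posSemidef_add (posSemidef_congr hS P.C) P.posDef_V

lemma gainOf_mul_measCov (P : Plant n p m) {S : Matrix (Fin n) (Fin n) ℝ} (hS : S.PosSemidef) :
    gainOf P S * measCov P S = S * P.Cᵀ := by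
  have h := (measCov_posDef P hS).isUnit
  rw [isUnit_iff_isUnit_det] at h
  rw [gainOf, ← measCov, Matrix.mul_assoc, nonsing_inv_mul _ h, Matrix.mul_one]

lemma gainOf_mul_eq_innovCov (P : Plant n p m) {S : Matrix (Fin n) (Fin n) ℝ}
    (hS : S.PosSemidef) : gainOf P S * P.C * S = innovCov P S := by
  have h := congrArg transpose (gainOf_mul_measCov P hS)
  rw [transpose_mul, transpose_mul, transpose_transpose, transpose_eq_of_posSemidef hS,
    transpose_eq_of_posSemidef (measCov_posDef P hS).posSemidef] at h
  rw [innovCov, Matrix.mul_assoc, ← h, ← Matrix.mul_assoc]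

/-- Joint covariance of innovation and estimation error in terms of prediction error and
measurement noise: the cross covariance vanishes. -/
lemma kalman_quad (P : Plant n p m) {S : Matrix (Fin n) (Fin n) ℝ} (hS : S.PosSemidef)
    (a b : Fin n → ℝ) :
    ((gainOf P S)ᵀ *ᵥ (a - b)) ⬝ᵥ (P.V *ᵥ ((gainOf P S)ᵀ *ᵥ (a - b))) +
      (P.Cᵀ *ᵥ ((gainOf P S)ᵀ *ᵥ (a - b)) + b) ⬝ᵥ
        (S *ᵥ (P.Cᵀ *ᵥ ((gainOf P S)ᵀ *ᵥ (a - b)) + b)) =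
    a ⬝ᵥ (innovCov P S *ᵥ a) + b ⬝ᵥ ((S - gainOf P S * P.C * S) *ᵥ b) := by
  set K := gainOf P S with hK
  set Z := innovCov P S with hZ
  have hSt := transpose_eq_of_posSemidef hS
  have hMt := transpose_eq_of_posSemidef (measCov_posDef P hS).posSemidef
  have hZt : Zᵀ = Z := by
    rw [hZ, innovCov, transpose_mul, transpose_mul, hMt, transpose_transpose, Matrix.mul_assoc]
  have hKCS : K * P.C * S = Z := gainOf_mul_eq_innovCov P hS
  set u := a - b with hu
  set c := Kᵀ *ᵥ u with hc
  have h1 : (P.Cᵀ *ᵥ c + b) ⬝ᵥ (S *ᵥ (P.Cᵀ *ᵥ c + b)) =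
      c ⬝ᵥ ((P.C * S * P.Cᵀ) *ᵥ c) + 2 * ((P.Cᵀ *ᵥ c) ⬝ᵥ (S *ᵥ b)) + b ⬝ᵥ (S *ᵥ b) := by
    rw [mulVec_add, add_dotProduct, dotProduct_add, dotProduct_add,
      dot_mulVec_comm hSt b (P.Cᵀ *ᵥ c), mulVec_dot, mulVec_mulVec, mulVec_mulVec,
      transpose_transpose]
    ring
  have h2 : (P.Cᵀ *ᵥ c) ⬝ᵥ (S *ᵥ b) = u ⬝ᵥ (Z *ᵥ b) := by
    rw [mulVec_dot, hc, mulVec_dot, transpose_transpose, transpose_transpose, mulVec_mulVec,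
      mulVec_mulVec, hKCS]
  have h3 : c ⬝ᵥ (P.V *ᵥ c) + c ⬝ᵥ ((P.C * S * P.Cᵀ) *ᵥ c) = u ⬝ᵥ (Z *ᵥ u) := by
    rw [add_comm, ← dotProduct_add, ← add_mulVec, ← measCov, hc, mulVec_dot, transpose_transpose,
      mulVec_mulVec, mulVec_mulVec, hZ, innovCov]
  rw [h1, h2, hKCS, sub_mulVec]
  have h4 : c ⬝ᵥ (P.V *ᵥ c) + (c ⬝ᵥ ((P.C * S * P.Cᵀ) *ᵥ c) + 2 * (u ⬝ᵥ (Z *ᵥ b)) + b ⬝ᵥ (S *ᵥ b))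
      = u ⬝ᵥ (Z *ᵥ u) + 2 * (u ⬝ᵥ (Z *ᵥ b)) + b ⬝ᵥ (S *ᵥ b) := by rw [← h3]; ring
  rw [h4, hu]
  simp only [mulVec_sub, sub_dotProduct, dotProduct_sub]
  rw [dot_mulVec_comm hZt b a]
  ring

/-- The case `a = 0` of `kalman_quad` is the Joseph form, which writes the filtered covariance as a
sum of nonnegative quadratic forms. -/
lemma posSemidef_filterCov (P : Plant n p m) {S : Matrix (Fin n) (Fin n) ℝ} (hS : S.PosSemidef) :
    (S - gainOf P S * P.C * S).PosSemidef := by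
  have hSt := transpose_eq_of_posSemidef hS
  have hMt := transpose_eq_of_posSemidef (measCov_posDef P hS).posSemidef
  refine posSemidef_of_quad ?_ fun x => ?_
  · rw [gainOf_mul_eq_innovCov P hS, innovCov, transpose_sub, hSt, transpose_mul, transpose_mul,
      hMt, transpose_transpose, Matrix.mul_assoc]
  · have h := kalman_quad P hS 0 x
    simp only [zero_dotProduct, zero_add] at h
    rw [← h]
    exact add_nonneg (quad_nonneg P.posDef_V.posSemidef _) (quad_nonneg hS _)

lemma posSemidef_predCov (P : Plant n p m) : ∀ k, (predCov P k).PosSemidef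
  | 0 => P.posSemidef_Om
  | k + 1 => (posSemidef_congr (posSemidef_filterCov P (posSemidef_predCov P k)) P.A).add
      P.posSemidef_W

/-- The prediction error `x_k - x̂_{k|k-1}` of the Kalman filter. -/
def priorErr (P : Plant n p m) (z : Noise n m) : ℕ → Fin n → ℝ
  | 0 => z.x0
  | k + 1 => P.A *ᵥ (priorErr P z k - kalmanGain P k *ᵥ (P.C *ᵥ priorErr P z k + z.v k)) + z.w k

/-- The innovation as a function of the noise alone. -/
def noiseInnov (P : Plant n p m) (z : Noise n m) (k : ℕ) : Fin n → ℝ :=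
  kalmanGain P k *ᵥ (P.C *ᵥ priorErr P z k + z.v k)

/-- The estimation error of the Kalman filter as a function of the noise alone. -/
def noiseErr (P : Plant n p m) (z : Noise n m) (k : ℕ) : Fin n → ℝ :=
  priorErr P z k - noiseInnov P z k

lemma priorErr_succ (P : Plant n p m) (z : Noise n m) (k : ℕ) :
    priorErr P z (k + 1) = P.A *ᵥ noiseErr P z k + z.w k := rfl

/-- A linear functional of innovation and estimation error in terms of prediction error and
measurement noise. -/
lemma dot_innov_add_dot_err (P : Plant n p m) (z : Noise n m) (k : ℕ) (a b : Fin n → ℝ) :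
    a ⬝ᵥ noiseInnov P z k + b ⬝ᵥ noiseErr P z k =
      (P.Cᵀ *ᵥ ((kalmanGain P k)ᵀ *ᵥ (a - b)) + b) ⬝ᵥ priorErr P z k +
        ((kalmanGain P k)ᵀ *ᵥ (a - b)) ⬝ᵥ z.v k := by
  have h : a ⬝ᵥ noiseInnov P z k + b ⬝ᵥ noiseErr P z k =
      (a - b) ⬝ᵥ noiseInnov P z k + b ⬝ᵥ priorErr P z k := by
    simp only [noiseErr, dotProduct_sub, sub_dotProduct]; ring
  rw [h, noiseInnov, add_dotProduct, mulVec_dot, transpose_transpose, mulVec_dot,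
    transpose_transpose, mulVec_dot, transpose_transpose, mulVec_add, dotProduct_add]
  ring

/-! ### Measurability and independence of the primitive random vectors -/

lemma measurable_mulVec_const {α : Type*} [MeasurableSpace α] {a b : ℕ}
    (A : Matrix (Fin a) (Fin b) ℝ) {f : α → Fin b → ℝ} (hf : Measurable f) :
    Measurable fun x => A *ᵥ f x :=
  (A.mulVecLin.continuous_of_finiteDimensional.measurable).comp hf

lemma measurable_dot {α : Type*} [MeasurableSpace α] {b : ℕ} {f g : α → Fin b → ℝ}
    (hf : Measurable f) (hg : Measurable g) : Measurable fun x => f x ⬝ᵥ g x :=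
  Finset.measurable_sum _ fun i _ =>
    ((measurable_pi_apply i).comp hf).mul ((measurable_pi_apply i).comp hg)

/-- The order in which the primitive random vectors enter the Kalman filter. -/
def srcRank : Src → ℕ
  | .init => 0
  | .meas k => 2 * k + 1
  | .proc k => 2 * k + 2

/-- The σ-algebra of the primitive random vectors of rank less than `r`. -/
abbrev past {Ω : Type*} (ξ : Ω → Noise n m) (r : ℕ) : MeasurableSpace Ω :=
  ⨆ s ∈ {s | srcRank s < r}, MeasurableSpace.comap (fun ω => (ξ ω).get s) inferInstance

lemma past_mono {Ω : Type*} (ξ : Ω → Noise n m) {r r' : ℕ} (h : r ≤ r') : past ξ r ≤ past ξ r' :=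
  biSup_mono fun _ hs => lt_of_lt_of_le hs h

lemma measurable_get_past {Ω : Type*} (ξ : Ω → Noise n m) {s : Src} {r : ℕ} (h : srcRank s < r) :
    Measurable[past ξ r] fun ω => (ξ ω).get s :=
  (comap_measurable _).mono
    (le_biSup (fun s => MeasurableSpace.comap (fun ω => (ξ ω).get s) inferInstance)
      (show s ∈ {s | srcRank s < r} from h)) le_rfl

section Noise

variable {Ω : Type*} [mΩ : MeasurableSpace Ω] {μ : Measure Ω} {P : Plant n p m}
  {ξ : Ω → Noise n m}

lemma IsNoise.measurable_get (hξ : IsNoise μ P ξ) : ∀ s, Measurable fun ω => (ξ ω).get s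
  | .init => hξ.init.1
  | .proc k => (hξ.proc k).1
  | .meas k => (hξ.meas k).1

lemma IsNoise.past_le (hξ : IsNoise μ P ξ) (r : ℕ) : past ξ r ≤ mΩ :=
  iSup₂_le fun s _ => (hξ.measurable_get s).comap_le

/-- Disjoint subfamilies of an independent family generate independent σ-algebras, and the sources
of rank below `srcRank s` do not include `s`. -/
lemma IsNoise.indepFun_dot (hξ : IsNoise μ P ξ) (s : Src) (c : Fin (s.dim n m) → ℝ)
    {X : Ω → ℝ} (hX : Measurable[past ξ (srcRank s)] X) :
    IndepFun X (fun ω => c ⬝ᵥ (ξ ω).get s) μ := by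
  have h := indep_iSup_of_disjoint (fun s => (hξ.measurable_get s).comap_le) hξ.indep.iIndep
    (S := {s' | srcRank s' < srcRank s}) (T := {s})
    (by simp [Set.disjoint_singleton_right])
  rw [IndepFun_iff_Indep]
  refine indep_of_indep_of_le_left (indep_of_indep_of_le_right h ?_) hX.comap_le
  rw [iSup_singleton]
  refine Measurable.comap_le ?_
  exact @measurable_dot Ω (_) _ _ _ (@measurable_const _ _ _ (_) _) (comap_measurable _)

/-- Only `x₀` and the noises before time `k` enter. The bound `2 * k + 1` is the rank of `.meas k`,
and the bound `2 * k + 2` for innovation and filter error is the rank of `.proc k`; these are the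
forms in which `IsNoise.indepFun_dot` splits off the next noise. -/
lemma measurable_priorErr_past {Ω : Type*} (P : Plant n p m) (ξ : Ω → Noise n m) (k : ℕ) :
    Measurable[past ξ (2 * k + 1)] fun ω => priorErr P (ξ ω) k := by
  induction k with
  | zero => exact measurable_get_past ξ (s := .init) (by simp [srcRank])
  | succ k ih =>
    have h0 : Measurable[past ξ (2 * (k + 1) + 1)] fun ω => priorErr P (ξ ω) k :=
      ih.mono (past_mono ξ (by omega)) le_rfl
    have hv : Measurable[past ξ (2 * (k + 1) + 1)] fun ω => (ξ ω).v k :=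
      measurable_get_past ξ (s := .meas k) (by simp only [srcRank]; omega)
    have hw : Measurable[past ξ (2 * (k + 1) + 1)] fun ω => (ξ ω).w k :=
      measurable_get_past ξ (s := .proc k) (by simp only [srcRank]; omega)
    let _ : MeasurableSpace Ω := past ξ (2 * (k + 1) + 1)
    exact (measurable_mulVec_const _ (h0.sub (measurable_mulVec_const _
      ((measurable_mulVec_const _ h0).add hv)))).add hw

lemma measurable_noiseInnov_past {Ω : Type*} (P : Plant n p m) (ξ : Ω → Noise n m) (k : ℕ) :
    Measurable[past ξ (2 * k + 2)] fun ω => noiseInnov P (ξ ω) k := by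
  have h0 : Measurable[past ξ (2 * k + 2)] fun ω => priorErr P (ξ ω) k :=
    (measurable_priorErr_past P ξ k).mono (past_mono ξ (by omega)) le_rfl
  have hv : Measurable[past ξ (2 * k + 2)] fun ω => (ξ ω).v k :=
    measurable_get_past ξ (s := .meas k) (by simp only [srcRank]; omega)
  let _ : MeasurableSpace Ω := past ξ (2 * k + 2)
  exact measurable_mulVec_const _ ((measurable_mulVec_const _ h0).add hv)

lemma measurable_noiseErr_past {Ω : Type*} (P : Plant n p m) (ξ : Ω → Noise n m) (k : ℕ) :
    Measurable[past ξ (2 * k + 2)] fun ω => noiseErr P (ξ ω) k := by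
  have h0 : Measurable[past ξ (2 * k + 2)] fun ω => priorErr P (ξ ω) k :=
    (measurable_priorErr_past P ξ k).mono (past_mono ξ (by omega)) le_rfl
  have h1 := measurable_noiseInnov_past P ξ k
  let _ : MeasurableSpace Ω := past ξ (2 * k + 2)
  exact h0.sub h1

lemma IsNoise.measurable_noiseInnov (hξ : IsNoise μ P ξ) (k : ℕ) :
    Measurable fun ω => noiseInnov P (ξ ω) k :=
  (measurable_noiseInnov_past P ξ k).mono (hξ.past_le _) le_rfl

lemma IsNoise.measurable_noiseErr (hξ : IsNoise μ P ξ) (k : ℕ) :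
    Measurable fun ω => noiseErr P (ξ ω) k :=
  (measurable_noiseErr_past P ξ k).mono (hξ.past_le _) le_rfl

/-! ### Square integrability -/

lemma memLp_mulVec {a b : ℕ} (A : Matrix (Fin a) (Fin b) ℝ) {f : Ω → Fin b → ℝ}
    {q : ENNReal} (hf : MemLp f q μ) : MemLp (fun ω => A *ᵥ f ω) q μ :=
  (LinearMap.toContinuousLinearMap A.mulVecLin).comp_memLp' hf

lemma integrable_dot {b : ℕ} {f g : Ω → Fin b → ℝ} (hf : MemLp f 2 μ) (hg : MemLp g 2 μ) :
    Integrable (fun ω => f ω ⬝ᵥ g ω) μ :=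
  integrable_finsetSum _ fun i _ => (memLp_pi_iff.1 hf i).integrable_mul (memLp_pi_iff.1 hg i)

lemma IsCenteredGaussian.memLp {d : ℕ} {X : Ω → Fin d → ℝ} {S : Matrix (Fin d) (Fin d) ℝ}
    (h : IsCenteredGaussian μ X S) : MemLp X 2 μ := by
  have h1 : MemLp id 2 (multivariateGaussian (0 : EuclideanSpace ℝ (Fin d)) S) :=
    IsGaussian.memLp_id _ 2 (by simp)
  have hm : Measurable fun ω => WithLp.toLp 2 (X ω) := (WithLp.measurable_toLp 2 _).comp h.1
  rw [← h.2, memLp_map_measure_iff aestronglyMeasurable_id hm.aemeasurable] at h1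
  exact (PiLp.continuousLinearEquiv 2 ℝ (fun _ : Fin d => ℝ)).toContinuousLinearMap.comp_memLp' h1

lemma IsNoise.memLp_priorErr (hξ : IsNoise μ P ξ) (k : ℕ) :
    MemLp (fun ω => priorErr P (ξ ω) k) 2 μ := by
  induction k with
  | zero => exact hξ.init.memLp
  | succ k ih =>
    exact (memLp_mulVec _ (ih.sub (memLp_mulVec _ ((memLp_mulVec _ ih).add
      (hξ.meas k).memLp)))).add (hξ.proc k).memLp

lemma IsNoise.memLp_noiseInnov (hξ : IsNoise μ P ξ) (k : ℕ) :
    MemLp (fun ω => noiseInnov P (ξ ω) k) 2 μ :=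
  memLp_mulVec _ ((memLp_mulVec _ (hξ.memLp_priorErr k)).add (hξ.meas k).memLp)

lemma IsNoise.memLp_noiseErr (hξ : IsNoise μ P ξ) (k : ℕ) :
    MemLp (fun ω => noiseErr P (ξ ω) k) 2 μ :=
  (hξ.memLp_priorErr k).sub (hξ.memLp_noiseInnov k)

/-! ### Joint law of the innovations and the estimation error -/

lemma IsCenteredGaussian.integral_cexp {d : ℕ} {X : Ω → Fin d → ℝ}
    {S : Matrix (Fin d) (Fin d) ℝ} (h : IsCenteredGaussian μ X S) (hS : S.PosSemidef)
    (c : Fin d → ℝ) :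
    ∫ ω, Complex.exp (((c ⬝ᵥ X ω : ℝ) : ℂ) * Complex.I) ∂μ =
      Complex.exp (((-(c ⬝ᵥ (S *ᵥ c)) / 2 : ℝ) : ℂ)) := by
  have hm : Measurable fun ω => WithLp.toLp 2 (X ω) := (WithLp.measurable_toLp 2 _).comp h.1
  have h1 := charFun_multivariateGaussian (μ := 0) hS (WithLp.toLp 2 c)
  rw [← h.2, charFun_apply, integral_map hm.aemeasurable
    (by fun_prop)] at h1
  simp only [EuclideanSpace.inner_eq_star_dotProduct, star_trivial] at h1
  rw [h1]
  simp [neg_div]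

lemma integral_cexp_add [IsFiniteMeasure μ] {X Y : Ω → ℝ} (hX : Measurable X) (hY : Measurable Y)
    (h : IndepFun X Y μ) :
    ∫ ω, Complex.exp (((X ω + Y ω : ℝ) : ℂ) * Complex.I) ∂μ =
      (∫ ω, Complex.exp ((X ω : ℂ) * Complex.I) ∂μ) *
        ∫ ω, Complex.exp ((Y ω : ℂ) * Complex.I) ∂μ := by
  rw [← h.integral_fun_comp_mul_comp (f := fun x : ℝ => Complex.exp ((x : ℂ) * Complex.I))
    (g := fun x : ℝ => Complex.exp ((x : ℂ) * Complex.I)) hX.aemeasurable hY.aemeasurable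
    (by fun_prop) (by fun_prop)]
  refine integral_congr_ae (.of_forall fun ω => ?_)
  simp only
  rw [← Complex.exp_add]
  push_cast
  ring_nf

lemma measurable_sum_innov_past {Ω : Type*} (P : Plant n p m) (ξ : Ω → Noise n m) (k : ℕ)
    (a : ℕ → Fin n → ℝ) {r : ℕ} (hr : 2 * k ≤ r) :
    Measurable[past ξ r] fun ω => ∑ t ∈ Finset.range k, a t ⬝ᵥ noiseInnov P (ξ ω) t := by
  refine Finset.measurable_sum _ fun t ht => ?_
  have := (measurable_noiseInnov_past P ξ t).mono
    (past_mono ξ (show 2 * t + 2 ≤ r by have := Finset.mem_range.1 ht; omega)) le_rfl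
  exact @measurable_dot Ω (_) _ _ _ (@measurable_const _ _ _ (_) _) this

/-- This is the measurement update in the induction of `IsNoise.integral_cexp_prior`. The functional
is regrouped into a part from the past and one in the fresh noise `v_k`, and `kalman_quad` removes
the cross term between innovation and filter error. -/
lemma IsNoise.integral_cexp_err_of_prior [IsFiniteMeasure μ] (hξ : IsNoise μ P ξ) (k : ℕ)
    (h : ∀ (a : ℕ → Fin n → ℝ) (b : Fin n → ℝ),
      ∫ ω, Complex.exp (((∑ t ∈ Finset.range k, a t ⬝ᵥ noiseInnov P (ξ ω) t +
          b ⬝ᵥ priorErr P (ξ ω) k : ℝ) : ℂ) * Complex.I) ∂μ =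
        Complex.exp (((-(∑ t ∈ Finset.range k, a t ⬝ᵥ (innovCov P (predCov P t) *ᵥ a t) +
          b ⬝ᵥ (predCov P k *ᵥ b)) / 2 : ℝ) : ℂ)))
    (a : ℕ → Fin n → ℝ) (b : Fin n → ℝ) :
    ∫ ω, Complex.exp (((∑ t ∈ Finset.range (k + 1), a t ⬝ᵥ noiseInnov P (ξ ω) t +
        b ⬝ᵥ noiseErr P (ξ ω) k : ℝ) : ℂ) * Complex.I) ∂μ =
      Complex.exp (((-(∑ t ∈ Finset.range (k + 1), a t ⬝ᵥ (innovCov P (predCov P t) *ᵥ a t) +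
        b ⬝ᵥ ((predCov P k - gainOf P (predCov P k) * P.C * predCov P k) *ᵥ b)) / 2 : ℝ) : ℂ)) := by
  -- `c` is the coefficient of `v_k` and `d` that of the prediction error once both are substituted.
  set c := (kalmanGain P k)ᵀ *ᵥ (a k - b) with hc
  set d := P.Cᵀ *ᵥ c + b with hd
  have h1 : ∀ ω, ∑ t ∈ Finset.range (k + 1), a t ⬝ᵥ noiseInnov P (ξ ω) t +
        b ⬝ᵥ noiseErr P (ξ ω) k =
      (∑ t ∈ Finset.range k, a t ⬝ᵥ noiseInnov P (ξ ω) t + d ⬝ᵥ priorErr P (ξ ω) k) +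
        c ⬝ᵥ (ξ ω).v k := fun ω => by
    rw [Finset.sum_range_succ, add_assoc, dot_innov_add_dot_err, add_assoc]
  have hX : Measurable[past ξ (2 * k + 1)] fun ω =>
      ∑ t ∈ Finset.range k, a t ⬝ᵥ noiseInnov P (ξ ω) t + d ⬝ᵥ priorErr P (ξ ω) k :=
    Measurable.add (measurable_sum_innov_past P ξ k a (by omega))
      (@measurable_dot Ω (_) _ _ _ (@measurable_const _ _ _ (_) _) (measurable_priorErr_past P ξ k))
  simp_rw [h1]
  rw [integral_cexp_add (hX.mono (hξ.past_le _) le_rfl)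
    (measurable_dot measurable_const (hξ.meas k).1)
    (hξ.indepFun_dot (.meas k) c hX), h, (hξ.meas k).integral_cexp P.posDef_V.posSemidef,
    ← Complex.exp_add, ← Complex.ofReal_add, Finset.sum_range_succ]
  have hq := kalman_quad P (posSemidef_predCov P k) (a k) b
  rw [← kalmanGain, ← hc, ← hd] at hq
  congr 2
  rw [← kalmanGain]
  linarith

/-- The exponent is a sum of separate quadratic forms: past innovations and prediction error are
independent centered Gaussians. The induction alternates the measurement update with a time update,
where `w_k` is independent of the past. -/
lemma IsNoise.integral_cexp_prior [IsFiniteMeasure μ] (hξ : IsNoise μ P ξ) (k : ℕ) :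
    ∀ (a : ℕ → Fin n → ℝ) (b : Fin n → ℝ),
      ∫ ω, Complex.exp (((∑ t ∈ Finset.range k, a t ⬝ᵥ noiseInnov P (ξ ω) t +
          b ⬝ᵥ priorErr P (ξ ω) k : ℝ) : ℂ) * Complex.I) ∂μ =
        Complex.exp (((-(∑ t ∈ Finset.range k, a t ⬝ᵥ (innovCov P (predCov P t) *ᵥ a t) +
          b ⬝ᵥ (predCov P k *ᵥ b)) / 2 : ℝ) : ℂ)) := by
  induction k with
  | zero =>
    intro a b
    simpa [priorErr, predCov] using hξ.init.integral_cexp P.posSemidef_Om b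
  | succ k ih =>
    intro a b
    have h1 : ∀ ω, ∑ t ∈ Finset.range (k + 1), a t ⬝ᵥ noiseInnov P (ξ ω) t +
          b ⬝ᵥ priorErr P (ξ ω) (k + 1) =
        (∑ t ∈ Finset.range (k + 1), a t ⬝ᵥ noiseInnov P (ξ ω) t +
          (P.Aᵀ *ᵥ b) ⬝ᵥ noiseErr P (ξ ω) k) + b ⬝ᵥ (ξ ω).w k := fun ω => by
      rw [priorErr_succ, dotProduct_add, mulVec_dot, transpose_transpose, add_assoc]
    have hX : Measurable[past ξ (2 * k + 2)] fun ω =>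
        ∑ t ∈ Finset.range (k + 1), a t ⬝ᵥ noiseInnov P (ξ ω) t +
          (P.Aᵀ *ᵥ b) ⬝ᵥ noiseErr P (ξ ω) k :=
      Measurable.add (measurable_sum_innov_past P ξ (k + 1) a (by omega))
        (@measurable_dot Ω (_) _ _ _ (@measurable_const _ _ _ (_) _)
          (measurable_noiseErr_past P ξ k))
    simp_rw [h1]
    rw [integral_cexp_add (hX.mono (hξ.past_le _) le_rfl)
      (measurable_dot measurable_const (hξ.proc k).1)
      (hξ.indepFun_dot (.proc k) b hX), hξ.integral_cexp_err_of_prior k ih,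
      (hξ.proc k).integral_cexp P.posSemidef_W, ← Complex.exp_add, ← Complex.ofReal_add]
    congr 2
    have : b ⬝ᵥ (predCov P (k + 1) *ᵥ b) = (P.Aᵀ *ᵥ b) ⬝ᵥ
        ((predCov P k - gainOf P (predCov P k) * P.C * predCov P k) *ᵥ (P.Aᵀ *ᵥ b)) +
          b ⬝ᵥ (P.W *ᵥ b) := by
      rw [predCov, add_mulVec, dotProduct_add, mulVec_dot, transpose_transpose, mulVec_mulVec,
        mulVec_mulVec]
    rw [this]
    ring

/-- The innovations up to time `M`, followed by the estimation error at time `M`. -/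
def innovErr (P : Plant n p m) (M : ℕ) (z : Noise n m) (t : ℕ) : Fin n → ℝ :=
  if t ≤ M then noiseInnov P z t else if t = M + 1 then noiseErr P z M else 0

lemma IsNoise.measurable_innovErr (hξ : IsNoise μ P ξ) (M : ℕ) :
    Measurable fun ω => innovErr P M (ξ ω) := by
  refine measurable_pi_lambda _ fun t => ?_
  unfold innovErr
  split_ifs
  exacts [hξ.measurable_noiseInnov _, hξ.measurable_noiseErr _, measurable_const]

lemma IsNoise.integral_cexp_innovErr [IsFiniteMeasure μ] (hξ : IsNoise μ P ξ) (M : ℕ)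
    (a : ℕ → Fin n → ℝ) :
    ∫ ω, Complex.exp (((∑ t ∈ Finset.range (M + 2), a t ⬝ᵥ innovErr P M (ξ ω) t : ℝ) : ℂ) *
        Complex.I) ∂μ =
      Complex.exp (((-(∑ t ∈ Finset.range (M + 1), a t ⬝ᵥ (innovCov P (predCov P t) *ᵥ a t) +
        a (M + 1) ⬝ᵥ ((predCov P M - gainOf P (predCov P M) * P.C * predCov P M) *ᵥ a (M + 1))) / 2
          : ℝ) : ℂ)) := by
  rw [← hξ.integral_cexp_err_of_prior M (hξ.integral_cexp_prior M)]
  congr! 5 with ω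
  rw [Finset.sum_range_succ]
  congr 1
  · refine Finset.sum_congr rfl fun t ht => ?_
    rw [innovErr, if_pos (Nat.lt_succ_iff.1 (Finset.mem_range.1 ht))]
  · simp [innovErr]

/-- The law of innovations and estimation error is invariant under changes of sign. -/
theorem IsNoise.map_sign_innovErr [IsFiniteMeasure μ] (hξ : IsNoise μ P ξ) (M : ℕ) (ε : ℕ → ℝ)
    (hε : ∀ t, ε t * ε t = 1) :
    μ.map (fun ω t => ε t • innovErr P M (ξ ω) t) = μ.map (fun ω => innovErr P M (ξ ω)) := by
  -- Only the first `M + 2` coordinates can be nonzero, so the comparison of laws takes place in a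
  -- finite-dimensional space and is carried back by `g`.
  let g : (Fin (M + 2) → Fin n → ℝ) → ℕ → Fin n → ℝ :=
    fun v t => if h : t < M + 2 then v ⟨t, h⟩ else 0
  have hg : Measurable g := by
    refine measurable_pi_lambda _ fun t => ?_
    by_cases h : t < M + 2
    · simpa [g, h] using measurable_pi_apply _
    · simp [g, h]
  let Y : (ℕ → ℝ) → Ω → Fin (M + 2) → Fin n → ℝ := fun η ω t => η t • innovErr P M (ξ ω) t
  have hY : ∀ η, Measurable (Y η) := fun η => measurable_pi_lambda _ fun t =>
    ((measurable_pi_apply (t : ℕ)).comp (hξ.measurable_innovErr M)).const_smul (η t)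
  have hgY : ∀ η : ℕ → ℝ, (fun ω t => η t • innovErr P M (ξ ω) t) = g ∘ Y η := by
    intro η
    funext ω t
    by_cases h : t < M + 2
    · simp [g, Y, h]
    · have h1 : ¬ t ≤ M := by omega
      have h2 : t ≠ M + 1 := by omega
      simp [g, h, innovErr, h1, h2]
  have key : μ.map (Y ε) = μ.map (Y 1) := by
    refine Measure.ext_of_charFunDual (funext fun ℓ => ?_)
    let a : ℕ → Fin n → ℝ := fun t i =>
      if h : t < M + 2 then ℓ (Pi.single ⟨t, h⟩ (Pi.single i 1)) else 0
    have hℓ : ∀ η ω, ℓ (Y η ω) =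
        ∑ t ∈ Finset.range (M + 2), (η t • a t) ⬝ᵥ innovErr P M (ξ ω) t := by
      intro η ω
      rw [Finset.sum_range, ← Finset.univ_sum_single (Y η ω), map_sum]
      refine Finset.sum_congr rfl fun t _ => ?_
      have : Pi.single t (Y η ω t) = ∑ i, (Y η ω t i) •
          (Pi.single t (Pi.single i 1) : Fin (M + 2) → Fin n → ℝ) := by
        have h1 : Y η ω t = ∑ i, (Y η ω t i) • (Pi.single i 1 : Fin n → ℝ) := by
          rw [← Finset.univ_sum_single (Y η ω t)]
          congr! with i
          simp [← Pi.single_smul]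
        conv_lhs => rw [h1]
        simp_rw [← Pi.single_smul]
        exact map_sum (LinearMap.single ℝ (fun _ : Fin (M + 2) => Fin n → ℝ) t) _ _
      rw [this, map_sum, dotProduct]
      refine Finset.sum_congr rfl fun i _ => ?_
      simp [a, Y]
      ring
    -- The signs enter the characteristic function only through their squares.
    have hcf : ∀ η : ℕ → ℝ, (∀ t, η t * η t = 1) → charFunDual (μ.map (Y η)) ℓ =
        Complex.exp (((-(∑ t ∈ Finset.range (M + 1), a t ⬝ᵥ (innovCov P (predCov P t) *ᵥ a t) +
          a (M + 1) ⬝ᵥ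
            ((predCov P M - gainOf P (predCov P M) * P.C * predCov P M) *ᵥ a (M + 1))) / 2
          : ℝ) : ℂ)) := by
      intro η hη
      rw [charFunDual_apply, integral_map (hY η).aemeasurable (by fun_prop)]
      simp_rw [hℓ]
      rw [hξ.integral_cexp_innovErr M]
      simp only [mulVec_smul, smul_dotProduct, dotProduct_smul, smul_eq_mul, ← mul_assoc, hη,
        one_mul]
    rw [hcf ε hε, hcf 1 (by simp)]
  have h1 := hgY 1
  simp only [Pi.one_apply, one_smul] at h1
  rw [hgY ε, h1, ← Measure.map_map hg (hY ε), key, Measure.map_map hg (hY 1)]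

end Noise

/-! ### Freshness of the information of the decision makers -/

/-- The number of innovations which the estimate of each decision maker incorporates. -/
def fresh (d : ℕ → Fin L → Bool) : ℕ → Fin (L + 1) → ℕ
  | 0 => Fin.cons (α := fun _ => ℕ) 1 (fun _ => 0)
  | k + 1 => Fin.cons (α := fun _ => ℕ) (k + 2)
      (fun j => if d k j then fresh d k j.castSucc else fresh d k j.succ)

section fresh

variable (d : ℕ → Fin L → Bool)

@[simp] lemma fresh_zero_right (k : ℕ) : fresh d k 0 = k + 1 := by cases k <;> rfl

@[simp] lemma fresh_zero_succ (j : Fin L) : fresh d 0 j.succ = 0 := rfl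

lemma fresh_succ_succ (k : ℕ) (j : Fin L) :
    fresh d (k + 1) j.succ = if d k j then fresh d k j.castSucc else fresh d k j.succ := rfl

/-- A receiver gets at most what its predecessor had one step earlier, and the predecessor has not
lost information in the meantime. -/
lemma fresh_antitone (k : ℕ) : Antitone (fresh d k) := by
  rw [Fin.antitone_iff_succ_le]
  induction k with
  | zero =>
    intro j
    simp
  | succ k ih =>
    intro j
    have h1 : fresh d (k + 1) j.succ ≤ fresh d k j.castSucc := by
      rw [fresh_succ_succ]; split_ifs; exacts [le_rfl, ih j]
    refine h1.trans ?_
    obtain h | ⟨i, h⟩ := Fin.eq_zero_or_eq_succ j.castSucc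
    · simp [h]
    · rw [h, fresh_succ_succ]
      split_ifs
      exacts [ih i, le_rfl]

lemma fresh_le_succ (k : ℕ) (j : Fin (L + 1)) : fresh d k j ≤ fresh d (k + 1) j := by
  induction j using Fin.cases with
  | zero => simp
  | succ i =>
    rw [fresh_succ_succ]
    split_ifs
    exacts [fresh_antitone d k (by simp [Fin.le_def]), le_rfl]

lemma fresh_mono {k k' : ℕ} (h : k ≤ k') (j : Fin (L + 1)) : fresh d k j ≤ fresh d k' j :=
  monotone_nat_of_le_succ (f := fun k => fresh d k j) (fun k => fresh_le_succ d k j) h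

lemma fresh_le (k : ℕ) (j : Fin (L + 1)) : fresh d k j ≤ k + 1 :=
  (fresh_antitone d k (Fin.zero_le j)).trans (fresh_zero_right d k).le

lemma fresh_congr {d d' : ℕ → Fin L → Bool} {k : ℕ} (h : ∀ t < k, d t = d' t) :
    fresh d k = fresh d' k := by
  induction k with
  | zero => rfl
  | succ k ih =>
    rw [fresh, fresh, ih (fun t ht => h t (by omega)), h k (by omega)]

/-- The information of a decision maker never ends strictly inside a block of innovations by which
neighbouring decision makers differ at an earlier time. -/
lemma fresh_not_between {τ k : ℕ} (hτ : τ ≤ k) (l : Fin L) (j : Fin (L + 1)) :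
    fresh d τ l.castSucc ≤ fresh d k j ∨ fresh d k j ≤ fresh d τ l.succ := by
  -- At equal times this is monotonicity along the hops.
  have same : ∀ (k : ℕ) (j : Fin (L + 1)),
      fresh d k l.castSucc ≤ fresh d k j ∨ fresh d k j ≤ fresh d k l.succ := by
    intro k j
    rcases le_or_gt j l.castSucc with h | h
    · exact .inl (fresh_antitone d k h)
    · exact .inr (fresh_antitone d k (Fin.castSucc_lt_iff_succ_le.1 h))
  induction k generalizing j with
  | zero =>
    obtain rfl : τ = 0 := by omega
    exact same 0 j
  | succ k ih =>
    rcases Nat.lt_or_ge k τ with h | h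
    · obtain rfl : τ = k + 1 := by omega
      exact same _ j
    -- Freshness at time `k + 1` is copied from some decision maker at time `k`, except at the
    -- sensor, whose freshness exceeds every earlier one.
    · induction j using Fin.cases with
      | zero => exact .inl ((fresh_le d τ _).trans (by simp; omega))
      | succ i =>
        rw [fresh_succ_succ]
        split_ifs
        exacts [ih h _, ih h _]

end fresh

/-! ### Estimates without the effect of the control -/

/-- The contributions of the innovations to the estimates of all decision makers. -/
def ctrlFree (A : Matrix (Fin n) (Fin n) ℝ) (y : ℕ → Fin n → ℝ) (d : ℕ → Fin L → Bool) :
    ℕ → Fin (L + 1) → Fin n → ℝ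
  | 0 => Fin.cons (α := fun _ => Fin n → ℝ) (y 0) (fun _ => 0)
  | k + 1 => Fin.cons (α := fun _ => Fin n → ℝ) (A *ᵥ ctrlFree A y d k 0 + y (k + 1))
      (fun j => A *ᵥ (if d k j then ctrlFree A y d k j.castSucc else ctrlFree A y d k j.succ))

section ctrlFree

variable (A : Matrix (Fin n) (Fin n) ℝ) (y : ℕ → Fin n → ℝ) (d : ℕ → Fin L → Bool)

@[simp] lemma ctrlFree_zero_zero : ctrlFree A y d 0 0 = y 0 := rfl

@[simp] lemma ctrlFree_zero_succ (j : Fin L) : ctrlFree A y d 0 j.succ = 0 := rfl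

lemma ctrlFree_succ_zero (k : ℕ) :
    ctrlFree A y d (k + 1) 0 = A *ᵥ ctrlFree A y d k 0 + y (k + 1) := rfl

lemma ctrlFree_succ_succ (k : ℕ) (j : Fin L) : ctrlFree A y d (k + 1) j.succ =
    A *ᵥ (if d k j then ctrlFree A y d k j.castSucc else ctrlFree A y d k j.succ) := rfl

lemma ctrlFree_congr {y y' : ℕ → Fin n → ℝ} {d d' : ℕ → Fin L → Bool} {k : ℕ}
    (hy : ∀ t ≤ k, y t = y' t) (hd : ∀ t < k, d t = d' t) :
    ctrlFree A y d k = ctrlFree A y' d' k := by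
  induction k with
  | zero => rw [ctrlFree, ctrlFree, hy 0 le_rfl]
  | succ k ih =>
    rw [ctrlFree, ctrlFree, ih (fun t ht => hy t (by omega)) (fun t ht => hd t (by omega)),
      hd k (by omega), hy (k + 1) le_rfl]

/-- The contribution at time `k` of the first `r` innovations. -/
def openLoop (k r : ℕ) : Fin n → ℝ := ∑ t ∈ Finset.range r, A ^ (k - t) *ᵥ y t

lemma mulVec_openLoop {k r : ℕ} (h : r ≤ k + 1) :
    A *ᵥ openLoop A y k r = openLoop A y (k + 1) r := by
  rw [openLoop, openLoop, mulVec_sum]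
  refine Finset.sum_congr rfl fun t ht => ?_
  have := Finset.mem_range.1 ht
  rw [mulVec_mulVec, ← pow_succ', Nat.sub_add_comm (by omega)]

/-- Every estimate is multiplied by `A` once per step, whether it is forwarded or predicted locally.
The coefficient of an innovation therefore depends only on its age, not on its route. -/
lemma ctrlFree_eq_openLoop (k : ℕ) (j : Fin (L + 1)) :
    ctrlFree A y d k j = openLoop A y k (fresh d k j) := by
  induction k generalizing j with
  | zero =>
    induction j using Fin.cases with
    | zero => simp [openLoop]
    | succ i => simp [openLoop]
  | succ k ih =>
    induction j using Fin.cases with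
    | zero =>
      rw [ctrlFree_succ_zero, ih, fresh_zero_right, fresh_zero_right, mulVec_openLoop A y le_rfl,
        openLoop, openLoop, Finset.sum_range_succ _ (k + 1)]
      simp
    | succ i =>
      rw [ctrlFree_succ_succ, fresh_succ_succ]
      split_ifs
      · rw [ih, mulVec_openLoop A y (fresh_le d k _)]
      · rw [ih, mulVec_openLoop A y (fresh_le d k _)]

end ctrlFree

/-! ### Innovations and estimation error do not depend on the policy -/

/-- Plant and filter prediction receive the same control, which cancels in their difference: the
control has no dual effect. -/
lemma errFirst_state (P : Plant n p m) (T : ℕ) (π : Law n L) (z : Noise n m) (k : ℕ) :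
    errFirst (state P T π z k) = noiseErr P z k := by
  induction k with
  | zero => rfl
  | succ k ih =>
    have h : nextX P T z k (state P T π z k) - predict P T k (state P T π z k) 0 =
        priorErr P z (k + 1) := by
      rw [priorErr_succ, ← ih, errFirst, nextX, predict, mulVec_sub]
      abel
    have h2 : innovNext P T z k (state P T π z k) = noiseInnov P z (k + 1) := by
      rw [innovNext, noiseInnov, ← h, mulVec_sub P.C, add_sub_right_comm]
    change nextX P T z k (state P T π z k) - (predict P T k (state P T π z k) 0 +
      innovNext P T z k (state P T π z k)) = _
    rw [h2, ← sub_sub, h, noiseErr]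

lemma innov_eq (P : Plant n p m) (T : ℕ) (π : Law n L) (z : Noise n m) (k : ℕ) :
    innov P T π z k = noiseInnov P z k := by
  cases k with
  | zero => rfl
  | succ k =>
    have h : nextX P T z k (state P T π z k) - predict P T k (state P T π z k) 0 =
        priorErr P z (k + 1) := by
      rw [priorErr_succ, ← errFirst_state P T π, errFirst, nextX, predict, mulVec_sub]
      abel
    rw [innov, innovNext, noiseInnov, ← h, mulVec_sub P.C, add_sub_right_comm]

/-- The effect of the control on the estimates, which all decision makers have in common, in terms
of the contributions `E` of the innovations. -/
def ctrlPart (P : Plant n p m) (T : ℕ) (E : ℕ → Fin (L + 1) → Fin n → ℝ) : ℕ → Fin n → ℝ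
  | 0 => 0
  | k + 1 => P.A *ᵥ ctrlPart P T E k +
      P.B *ᵥ (-(lqrGain P T k *ᵥ (E k (Fin.last L) + ctrlPart P T E k)))

lemma ctrlPart_congr (P : Plant n p m) (T : ℕ) {E E' : ℕ → Fin (L + 1) → Fin n → ℝ} {k : ℕ}
    (h : ∀ t < k, E t = E' t) : ctrlPart P T E k = ctrlPart P T E' k := by
  induction k with
  | zero => rfl
  | succ k ih =>
    rw [ctrlPart, ctrlPart, ih (fun t ht => h t (by omega)), h k (by omega)]

/-- All decision makers predict with the control that is actually applied, so its effect is a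
summand common to all estimates. -/
lemma est_eq (P : Plant n p m) (T : ℕ) (π : Law n L) (z : Noise n m) (k : ℕ) (j : Fin (L + 1)) :
    (state P T π z k).est j =
      ctrlFree P.A (noiseInnov P z) (decision P T π z) k j +
        ctrlPart P T (ctrlFree P.A (noiseInnov P z) (decision P T π z)) k := by
  induction k generalizing j with
  | zero =>
    rw [ctrlPart, add_zero]
    rfl
  | succ k ih =>
    have hp : ∀ i, predict P T k (state P T π z k) i =
        P.A *ᵥ ctrlFree P.A (noiseInnov P z) (decision P T π z) k i +
          ctrlPart P T (ctrlFree P.A (noiseInnov P z) (decision P T π z)) (k + 1) := by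
      intro i
      rw [predict, control, ih, ih, ctrlPart, mulVec_add]
      abel
    induction j using Fin.cases with
    | zero =>
      change predict P T k (state P T π z k) 0 + innov P T π z (k + 1) = _
      rw [hp, innov_eq, ctrlFree_succ_zero]
      abel
    | succ i =>
      change (if decision P T π z k i then predict P T k (state P T π z k) i.castSucc
        else predict P T k (state P T π z k) i.succ) = _
      rw [ctrlFree_succ_succ]
      split_ifs <;> rw [hp]

lemma mismatch_eq (P : Plant n p m) (T : ℕ) (π : Law n L) (z : Noise n m) (k : ℕ) (j : Fin L) :
    mismatch (state P T π z k) j =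
      ctrlFree P.A (noiseInnov P z) (decision P T π z) k j.castSucc -
        ctrlFree P.A (noiseInnov P z) (decision P T π z) k j.succ := by
  rw [mismatch, est_eq, est_eq]
  abel

/-! ### Threshold rules -/

/-- A rule by which each scheduler decides on the basis of its own mismatch error. -/
abbrev Rule (n L : ℕ) := ℕ → Fin L → (Fin n → ℝ) → Bool

/-- The law given by a rule. -/
def ruleLaw (θ : Rule n L) : Law n L := fun k s j => θ k j (mismatch s j)

/-- The contributions of the innovations `y` to the estimates under the rule `θ`. -/
def model (A : Matrix (Fin n) (Fin n) ℝ) (θ : Rule n L) (y : ℕ → Fin n → ℝ) :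
    ℕ → Fin (L + 1) → Fin n → ℝ
  | 0 => Fin.cons (α := fun _ => Fin n → ℝ) (y 0) (fun _ => 0)
  | k + 1 => Fin.cons (α := fun _ => Fin n → ℝ) (A *ᵥ model A θ y k 0 + y (k + 1))
      (fun j => A *ᵥ (if θ k j (model A θ y k j.castSucc - model A θ y k j.succ) then
        model A θ y k j.castSucc else model A θ y k j.succ))

/-- The decisions under the rule `θ` if the innovations are `y`. -/
def modelDec (A : Matrix (Fin n) (Fin n) ℝ) (θ : Rule n L) (y : ℕ → Fin n → ℝ) (k : ℕ)
    (j : Fin L) : Bool :=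
  θ k j (model A θ y k j.castSucc - model A θ y k j.succ)

section model

variable (A : Matrix (Fin n) (Fin n) ℝ) (θ : Rule n L) (y : ℕ → Fin n → ℝ)

lemma model_eq_ctrlFree (k : ℕ) : model A θ y k = ctrlFree A y (modelDec A θ y) k := by
  induction k with
  | zero => rfl
  | succ k ih =>
    rw [ctrlFree, model, ← ih]
    rfl

lemma model_succ_zero (k : ℕ) : model A θ y (k + 1) 0 = A *ᵥ model A θ y k 0 + y (k + 1) := rfl

lemma model_succ_succ (k : ℕ) (j : Fin L) : model A θ y (k + 1) j.succ =
    A *ᵥ (if modelDec A θ y k j then model A θ y k j.castSucc else model A θ y k j.succ) := rfl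

lemma model_congr {y y' : ℕ → Fin n → ℝ} {k : ℕ} (h : ∀ t ≤ k, y t = y' t) :
    model A θ y k = model A θ y' k := by
  induction k with
  | zero => rw [model, model, h 0 le_rfl]
  | succ k ih => rw [model, model, ih (fun t ht => h t (by omega)), h (k + 1) le_rfl]

lemma modelDec_congr {y y' : ℕ → Fin n → ℝ} {k : ℕ} (h : ∀ t ≤ k, y t = y' t) :
    modelDec A θ y k = modelDec A θ y' k := by
  funext j
  rw [modelDec, modelDec, model_congr A θ h]

lemma model_eq_openLoop (k : ℕ) (j : Fin (L + 1)) :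
    model A θ y k j = openLoop A y k (fresh (modelDec A θ y) k j) := by
  rw [model_eq_ctrlFree, ctrlFree_eq_openLoop]

end model

/-- Strong induction closes the feedback: the mismatch at time `k` depends only on decisions before
`k`. From here on the decisions are functions of the innovation sequence alone. -/
lemma decision_ruleLaw (P : Plant n p m) (T : ℕ) (θ : Rule n L) (z : Noise n m) (k : ℕ) :
    decision P T (ruleLaw θ) z k = modelDec P.A θ (noiseInnov P z) k := by
  induction k using Nat.strong_induction_on with
  | _ k ih =>
    funext j
    rw [modelDec, model_eq_ctrlFree, decision, ruleLaw, mismatch_eq,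
      ctrlFree_congr P.A (fun _ _ => rfl) ih]

lemma ctrlFree_decision (P : Plant n p m) (T : ℕ) (θ : Rule n L) (z : Noise n m) (k : ℕ) :
    ctrlFree P.A (noiseInnov P z) (decision P T (ruleLaw θ) z) k =
      model P.A θ (noiseInnov P z) k := by
  rw [model_eq_ctrlFree]
  exact ctrlFree_congr P.A (fun _ _ => rfl) (fun t _ => decision_ruleLaw P T θ z t)

lemma mismatch_ruleLaw (P : Plant n p m) (T : ℕ) (θ : Rule n L) (z : Noise n m) (k : ℕ)
    (j : Fin L) : mismatch (state P T (ruleLaw θ) z k) j =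
      model P.A θ (noiseInnov P z) k j.castSucc - model P.A θ (noiseInnov P z) k j.succ := by
  rw [mismatch_eq, ctrlFree_decision]

lemma est_ruleLaw (P : Plant n p m) (T : ℕ) (θ : Rule n L) (z : Noise n m) (k : ℕ)
    (j : Fin (L + 1)) : (state P T (ruleLaw θ) z k).est j =
      model P.A θ (noiseInnov P z) k j + ctrlPart P T (model P.A θ (noiseInnov P z)) k := by
  rw [est_eq, ctrlFree_decision, ctrlPart_congr P T (fun t _ => ctrlFree_decision P T θ z t)]

/-! ### Reversing the signs of the innovations which a decision maker does not have -/

/-- Change the signs of all but the first `r` vectors. -/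
def flipFrom (r : ℕ) (y : ℕ → Fin n → ℝ) (t : ℕ) : Fin n → ℝ := if t < r then y t else -y t

lemma flipFrom_flipFrom (r : ℕ) (y : ℕ → Fin n → ℝ) : flipFrom r (flipFrom r y) = y := by
  funext t
  by_cases h : t < r <;> simp [flipFrom, h]

lemma openLoop_flipFrom_of_le (A : Matrix (Fin n) (Fin n) ℝ) (y : ℕ → Fin n → ℝ) (k : ℕ)
    {r q : ℕ} (h : q ≤ r) : openLoop A (flipFrom r y) k q = openLoop A y k q := by
  refine Finset.sum_congr rfl fun t ht => ?_
  rw [flipFrom, if_pos ((Finset.mem_range.1 ht).trans_le h)]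

/-- The sum is reflected about its first `r` terms: the head is kept and the tail is negated. -/
lemma openLoop_flipFrom_of_ge (A : Matrix (Fin n) (Fin n) ℝ) (y : ℕ → Fin n → ℝ) (k : ℕ)
    {r q : ℕ} (h : r ≤ q) : openLoop A (flipFrom r y) k q =
      2 • openLoop A y k r - openLoop A y k q := by
  induction q, h using Nat.le_induction with
  | base => rw [openLoop_flipFrom_of_le A y k le_rfl]; abel
  | succ q hq ih =>
    rw [openLoop, Finset.sum_range_succ, ← openLoop, ih, openLoop, openLoop, openLoop,
      Finset.sum_range_succ _ q, flipFrom, if_neg (by omega), mulVec_neg]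
    abel

/-- Change the signs of the innovations which the estimate of decision maker `j` at time `k` does
not incorporate. -/
def flipUnknown (A : Matrix (Fin n) (Fin n) ℝ) (θ : Rule n L) (k : ℕ) (j : Fin (L + 1))
    (y : ℕ → Fin n → ℝ) : ℕ → Fin n → ℝ :=
  flipFrom (fresh (modelDec A θ y) k j) y

section flip

/-- The decisions depend on the mismatch errors only up to sign. -/
def Rule.IsEven (θ : Rule n L) : Prop := ∀ k j e, θ k j (-e) = θ k j e

variable {A : Matrix (Fin n) (Fin n) ℝ} {θ : Rule n L} {k : ℕ} {j : Fin (L + 1)}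

/-- By induction the earlier decisions, hence the blocks of innovations, are unchanged at time `τ`.
Each block then lies entirely on one side of the index at which the reversal starts, so its mismatch
changes at most by a global sign, which an even rule ignores. -/
lemma modelDec_flipUnknown (hθ : θ.IsEven) (y : ℕ → Fin n → ℝ)
    {τ : ℕ} (hτ : τ ≤ k) :
    modelDec A θ (flipUnknown A θ k j y) τ = modelDec A θ y τ := by
  induction τ using Nat.strong_induction_on with
  | _ τ ih =>
    funext l
    have hf : fresh (modelDec A θ (flipUnknown A θ k j y)) τ = fresh (modelDec A θ y) τ :=
      fresh_congr fun t ht => ih t ht (by omega)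
    rw [modelDec, modelDec, model_eq_openLoop, model_eq_openLoop, hf, model_eq_openLoop,
      model_eq_openLoop]
    have hanti := fresh_antitone (modelDec A θ y) τ (Fin.castSucc_lt_succ (i := l)).le
    -- Either the whole block is known to `j` and stays, or all of it is unknown and is negated.
    rcases fresh_not_between (modelDec A θ y) hτ l j with h | h
    · rw [flipUnknown, openLoop_flipFrom_of_le A y τ h,
        openLoop_flipFrom_of_le A y τ (hanti.trans h)]
    · rw [flipUnknown, openLoop_flipFrom_of_ge A y τ h,
        openLoop_flipFrom_of_ge A y τ (h.trans hanti), ← hθ]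
      congr 1
      abel

/-- The range extends to `k + 1` because freshness at time `τ` involves only decisions before `τ`.
-/
lemma fresh_flipUnknown (hθ : θ.IsEven) (y : ℕ → Fin n → ℝ)
    {τ : ℕ} (hτ : τ ≤ k + 1) :
    fresh (modelDec A θ (flipUnknown A θ k j y)) τ = fresh (modelDec A θ y) τ :=
  fresh_congr fun _ ht => modelDec_flipUnknown hθ y (by omega)

lemma model_flipUnknown_of_le (hθ : θ.IsEven) (y : ℕ → Fin n → ℝ)
    {τ : ℕ} (hτ : τ ≤ k + 1) {i : Fin (L + 1)}
    (h : fresh (modelDec A θ y) τ i ≤ fresh (modelDec A θ y) k j) :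
    model A θ (flipUnknown A θ k j y) τ i = model A θ y τ i := by
  rw [model_eq_openLoop, model_eq_openLoop, fresh_flipUnknown hθ y hτ, flipUnknown,
    openLoop_flipFrom_of_le A y τ h]

lemma model_flipUnknown_of_ge_index (hθ : θ.IsEven) (y : ℕ → Fin n → ℝ)
    {i : Fin (L + 1)} (h : j ≤ i) :
    model A θ (flipUnknown A θ k j y) k i = model A θ y k i :=
  model_flipUnknown_of_le hθ y (by omega) (fresh_antitone _ k h)

lemma model_sub_flipUnknown (hθ : θ.IsEven) (y : ℕ → Fin n → ℝ)
    {i : Fin (L + 1)} (h : i ≤ j) :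
    model A θ (flipUnknown A θ k j y) k i - model A θ (flipUnknown A θ k j y) k j =
      -(model A θ y k i - model A θ y k j) := by
  rw [model_flipUnknown_of_ge_index hθ y le_rfl, model_eq_openLoop, model_eq_openLoop,
    fresh_flipUnknown hθ y (by omega), flipUnknown,
    openLoop_flipFrom_of_ge A y k (fresh_antitone _ k h), model_eq_openLoop]
  abel

lemma flipUnknown_of_gt (y : ℕ → Fin n → ℝ) {t : ℕ} (ht : k < t) : flipUnknown A θ k j y t = -y t := by
  rw [flipUnknown, flipFrom, if_neg]
  have := fresh_le (modelDec A θ y) k j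
  omega

/-- What decision maker `j` learns between the times `k` and `k + 1` changes its sign. -/
lemma model_succ_sub_flipUnknown (hθ : θ.IsEven) (y : ℕ → Fin n → ℝ) :
   
    model A θ (flipUnknown A θ k j y) (k + 1) j - A *ᵥ model A θ (flipUnknown A θ k j y) k j =
      -(model A θ y (k + 1) j - A *ᵥ model A θ y k j) := by
  induction j using Fin.cases with
  | zero =>
    rw [model_succ_zero, model_succ_zero, flipUnknown_of_gt y (by omega)]
    abel
  | succ i =>
    rw [model_succ_succ, model_succ_succ, modelDec_flipUnknown hθ y le_rfl]
    split_ifs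
    · rw [← mulVec_sub, model_sub_flipUnknown hθ y (Fin.castSucc_lt_succ (i := i)).le, mulVec_neg,
        mulVec_sub]
    · simp

end flip

/-- All decision rules are measurable. -/
def Rule.IsMeasurable (θ : Rule n L) : Prop := ∀ k j, Measurable (θ k j)

/-! ### Measurability of estimates, decisions and sign reversals -/

section Measurability

variable {A : Matrix (Fin n) (Fin n) ℝ} {θ : Rule n L}

lemma measurable_model (hθ : θ.IsMeasurable) (k : ℕ) (i : Fin (L + 1)) :
    Measurable fun y => model A θ y k i := by
  induction k generalizing i with
  | zero =>
    induction i using Fin.cases with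
    | zero => exact measurable_pi_apply 0
    | succ j => exact measurable_const
  | succ k ih =>
    induction i using Fin.cases with
    | zero => exact (measurable_mulVec_const _ (ih 0)).add (measurable_pi_apply (k + 1))
    | succ j =>
      refine measurable_mulVec_const A (Measurable.ite ?_ (ih _) (ih _))
      exact ((hθ k j).comp ((ih _).sub (ih _))) (measurableSet_singleton true)

lemma measurable_modelDec (hθ : θ.IsMeasurable) (k : ℕ) (j : Fin L) :
    Measurable fun y => modelDec A θ y k j :=
  (hθ k j).comp ((measurable_model hθ k _).sub (measurable_model hθ k _))

lemma measurable_fresh_modelDec (hθ : θ.IsMeasurable) (k : ℕ) (i : Fin (L + 1)) :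
    Measurable fun y => fresh (modelDec A θ y) k i := by
  induction k generalizing i with
  | zero =>
    induction i using Fin.cases with
    | zero => exact measurable_const
    | succ j => exact measurable_const
  | succ k ih =>
    induction i using Fin.cases with
    | zero => exact measurable_const
    | succ j =>
      exact Measurable.ite (measurable_modelDec hθ k j (measurableSet_singleton true)) (ih _) (ih _)

lemma measurable_flipFrom (r : ℕ) : Measurable (flipFrom r : (ℕ → Fin n → ℝ) → _) := by
  refine measurable_pi_lambda _ fun t => ?_
  unfold flipFrom
  split_ifs
  exacts [measurable_pi_apply t, (measurable_pi_apply t).neg]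

lemma measurable_flipUnknown (hθ : θ.IsMeasurable) (k : ℕ) (j : Fin (L + 1)) :
    Measurable (flipUnknown A θ k j) := by
  refine measurable_pi_lambda _ fun t => ?_
  unfold flipUnknown flipFrom
  exact Measurable.ite (measurable_fresh_modelDec hθ k j (measurableSet_Ioi (a := t)))
    (measurable_pi_apply t) (measurable_pi_apply t).neg

lemma measurable_ctrlPart (P : Plant n p m) (T : ℕ) (hθ : θ.IsMeasurable) (k : ℕ) :
    Measurable fun y => ctrlPart P T (model A θ y) k := by
  induction k with
  | zero => exact measurable_const
  | succ k ih =>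
    exact (measurable_mulVec_const _ ih).add (measurable_mulVec_const _
      (measurable_mulVec_const _ ((measurable_model hθ k _).add ih)).neg)

end Measurability

/-! ### Invariance of the law under sign reversal, and integrability of the closed loop -/

section Law

variable {Ω : Type*} [mΩ : MeasurableSpace Ω] {μ : Measure Ω} {P : Plant n p m}
  {ξ : Ω → Noise n m} {A : Matrix (Fin n) (Fin n) ℝ} {θ : Rule n L}

lemma IsNoise.map_flipFrom [IsFiniteMeasure μ] (hξ : IsNoise μ P ξ) (M r : ℕ) :
    (μ.map fun ω => innovErr P M (ξ ω)).map (flipFrom r) = μ.map fun ω => innovErr P M (ξ ω) := by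
  rw [Measure.map_map (measurable_flipFrom r) (hξ.measurable_innovErr M),
    ← hξ.map_sign_innovErr M (fun t => if t < r then 1 else -1)
      (fun t => by by_cases h : t < r <;> simp [h])]
  congr 1
  funext ω t
  by_cases h : t < r <;> simp [flipFrom, h]

/-- Reversing the signs of the innovations unknown to a decision maker preserves the law. -/
theorem IsNoise.map_flipUnknown [IsFiniteMeasure μ] (hξ : IsNoise μ P ξ)
    (hθ : θ.IsMeasurable) (he : θ.IsEven) (M k : ℕ) (j : Fin (L + 1)) :
    (μ.map fun ω => innovErr P M (ξ ω)).map (flipUnknown A θ k j) =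
      μ.map fun ω => innovErr P M (ξ ω) := by
  set ν := μ.map fun ω => innovErr P M (ξ ω) with hν
  have hF := measurable_flipUnknown (A := A) hθ k j
  have hR := measurable_fresh_modelDec (A := A) hθ k j
  ext B hB
  rw [Measure.map_apply hF hB]
  -- The sequence space is split according to the freshness `r`, on each level of which the reversal
  -- starts at a fixed index.
  have hsum : ∀ C : Set (ℕ → Fin n → ℝ), MeasurableSet C → ν C =
      ∑' r : ℕ, ν (C ∩ {y | fresh (modelDec A θ y) k j = r}) := by
    intro C hC
    rw [← measure_iUnion]
    · congr 1
      ext y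
      simp
    · intro r r' hrr
      refine Set.disjoint_left.2 fun y hy hy' => hrr ?_
      exact hy.2.symm.trans hy'.2
    · exact fun r => hC.inter (hR (measurableSet_singleton r))
  rw [hsum _ (hF hB), hsum B hB]
  refine tsum_congr fun r => ?_
  -- The reversal does not change the freshness, so it maps a level to itself and agrees there with
  -- `flipFrom r`. The inclusion from right to left uses that `flipFrom r` is an involution.
  have h1 : flipUnknown A θ k j ⁻¹' B ∩ {y | fresh (modelDec A θ y) k j = r} =
      flipFrom r ⁻¹' (B ∩ {y | fresh (modelDec A θ y) k j = r}) := by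
    ext y
    simp only [Set.mem_inter_iff, Set.mem_preimage, Set.mem_ofPred_eq]
    constructor
    · rintro ⟨h1, h2⟩
      have h3 : flipFrom r y = flipUnknown A θ k j y := by rw [flipUnknown, h2]
      rw [h3, fresh_flipUnknown he y (by omega)]
      exact ⟨h1, h2⟩
    · rintro ⟨h1, h2⟩
      have h3 : flipUnknown A θ k j (flipFrom r y) = y := by
        rw [flipUnknown, h2, flipFrom_flipFrom]
      have h4 : fresh (modelDec A θ y) k j = r := by
        rw [← h2]
        conv_lhs => rw [← h3]
        rw [fresh_flipUnknown he _ (by omega)]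
      refine ⟨?_, h4⟩
      rwa [flipUnknown, h4]
  have h2 : MeasurableSet (B ∩ {y | fresh (modelDec A θ y) k j = r}) :=
    hB.inter (hR (measurableSet_singleton r))
  rw [h1, ← Measure.map_apply (measurable_flipFrom r) h2, hν, hξ.map_flipFrom M r]

/-- Functionals which change their sign with the unknown innovations have mean zero. -/
theorem IsNoise.integral_eq_zero_of_odd [IsFiniteMeasure μ] (hξ : IsNoise μ P ξ)
    (hθ : θ.IsMeasurable) (he : θ.IsEven) (M k : ℕ) (j : Fin (L + 1))
    {g : (ℕ → Fin n → ℝ) → ℝ} (hg : Measurable g)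
    (hodd : ∀ y, g (flipUnknown A θ k j y) = -g y) :
    ∫ ω, g (innovErr P M (ξ ω)) ∂μ = 0 := by
  have hF := measurable_flipUnknown (A := A) hθ k j
  rw [← integral_map (hξ.measurable_innovErr M).aemeasurable hg.aestronglyMeasurable]
  set ν := μ.map fun ω => innovErr P M (ξ ω) with hν
  -- The identity does not rely on integrability of `g`, since a nonintegrable function has integral
  -- zero by convention.
  have h : ∫ y, g y ∂ν = -∫ y, g y ∂ν := by
    conv_lhs => rw [hν, ← hξ.map_flipUnknown (A := A) hθ he M k j,
      integral_map hF.aemeasurable hg.aestronglyMeasurable]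
    simp_rw [hodd, integral_neg]
    rfl
  linarith

/-! ### Square integrability of the closed loop -/

lemma memLp_ite {E : Type*} [NormedAddCommGroup E] {f g : Ω → E} {q : ENNReal} {b : Ω → Bool}
    (hb : Measurable b) (hf : MemLp f q μ) (hg : MemLp g q μ) :
    MemLp (fun ω => if b ω then f ω else g ω) q μ := by
  have hS : MeasurableSet {ω | b ω = true} := hb (measurableSet_singleton true)
  convert (hf.indicator hS).add (hg.indicator hS.compl) using 1
  funext ω
  by_cases h : b ω = true <;> simp [h]

lemma IsNoise.measurable_noiseInnov_pi (hξ : IsNoise μ P ξ) :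
    Measurable fun ω => noiseInnov P (ξ ω) :=
  measurable_pi_lambda _ hξ.measurable_noiseInnov

lemma IsNoise.memLp_model (hξ : IsNoise μ P ξ) (hθ : θ.IsMeasurable) (k : ℕ) (i : Fin (L + 1)) :
    MemLp (fun ω => model A θ (noiseInnov P (ξ ω)) k i) 2 μ := by
  induction k generalizing i with
  | zero =>
    induction i using Fin.cases with
    | zero => exact hξ.memLp_noiseInnov 0
    | succ j => exact MemLp.zero'
  | succ k ih =>
    induction i using Fin.cases with
    | zero => exact (memLp_mulVec A (ih 0)).add (hξ.memLp_noiseInnov (k + 1))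
    | succ j =>
      exact memLp_mulVec A (memLp_ite ((measurable_modelDec (A := A) hθ k j).comp
        hξ.measurable_noiseInnov_pi) (ih _) (ih _))

lemma IsNoise.memLp_ctrlPart (hξ : IsNoise μ P ξ) (hθ : θ.IsMeasurable) (T k : ℕ) :
    MemLp (fun ω => ctrlPart P T (model A θ (noiseInnov P (ξ ω))) k) 2 μ := by
  induction k with
  | zero => exact MemLp.zero'
  | succ k ih =>
    exact (memLp_mulVec P.A ih).add (memLp_mulVec P.B
      (memLp_mulVec _ ((hξ.memLp_model hθ k _).add ih)).neg)

lemma IsNoise.memLp_est (hξ : IsNoise μ P ξ) (hθ : θ.IsMeasurable) (T k : ℕ) (i : Fin (L + 1)) :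
    MemLp (fun ω => (state P T (ruleLaw θ) (ξ ω) k).est i) 2 μ := by
  simp_rw [est_ruleLaw]
  exact (hξ.memLp_model hθ k i).add (hξ.memLp_ctrlPart hθ T k)

lemma IsNoise.memLp_mismatch (hξ : IsNoise μ P ξ) (hθ : θ.IsMeasurable) (T k : ℕ) (j : Fin L) :
    MemLp (fun ω => mismatch (state P T (ruleLaw θ) (ξ ω) k) j) 2 μ :=
  (hξ.memLp_est hθ T k _).sub (hξ.memLp_est hθ T k _)

lemma IsNoise.memLp_control (hξ : IsNoise μ P ξ) (hθ : θ.IsMeasurable) (T k : ℕ) :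
    MemLp (fun ω => control P T k (state P T (ruleLaw θ) (ξ ω) k)) 2 μ :=
  (memLp_mulVec _ (hξ.memLp_est hθ T k _)).neg

lemma x_eq (P : Plant n p m) (T : ℕ) (π : Law n L) (z : Noise n m) (k : ℕ) :
    (state P T π z k).x = (state P T π z k).est 0 + noiseErr P z k := by
  rw [← errFirst_state P T π, errFirst]
  abel

lemma IsNoise.memLp_x (hξ : IsNoise μ P ξ) (hθ : θ.IsMeasurable) (T k : ℕ) :
    MemLp (fun ω => (state P T (ruleLaw θ) (ξ ω) k).x) 2 μ := by
  simp_rw [x_eq]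
  exact (hξ.memLp_est hθ T k 0).add (hξ.memLp_noiseErr k)

lemma IsNoise.measurable_decision (hξ : IsNoise μ P ξ) (hθ : θ.IsMeasurable) (T k : ℕ)
    (j : Fin L) : Measurable fun ω => decision P T (ruleLaw θ) (ξ ω) k j := by
  simp_rw [decision_ruleLaw]
  exact (measurable_modelDec hθ k j).comp hξ.measurable_noiseInnov_pi

lemma IsNoise.integrable_pathCost (hξ : IsNoise μ P ξ) (hθ : θ.IsMeasurable) (T : ℕ) :
    Integrable (fun ω => pathCost P T (ruleLaw θ) (ξ ω)) μ :=
  (integrable_dot (hξ.memLp_x hθ T T) (memLp_mulVec _ (hξ.memLp_x hθ T T))).add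
    (integrable_finsetSum _ fun k _ =>
      (integrable_dot (hξ.memLp_x hθ T k) (memLp_mulVec _ (hξ.memLp_x hθ T k))).add
        (integrable_dot (hξ.memLp_control hθ T k) (memLp_mulVec _ (hξ.memLp_control hθ T k))))

lemma measurable_ind : Measurable ind := measurable_from_top

lemma ind_abs_le (b : Bool) : |ind b| ≤ 1 := by cases b <;> simp [ind]

lemma IsNoise.integrable_ind_decision [IsFiniteMeasure μ] (hξ : IsNoise μ P ξ)
    (hθ : θ.IsMeasurable) (T k : ℕ) (j : Fin L) :
    Integrable (fun ω => ind (decision P T (ruleLaw θ) (ξ ω) k j)) μ :=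
  .of_bound (measurable_ind.comp (hξ.measurable_decision hθ T k j)).aestronglyMeasurable 1
    (.of_forall fun _ => ind_abs_le _)

lemma IsNoise.integrable_hopCost [IsFiniteMeasure μ] (hξ : IsNoise μ P ξ) (hθ : θ.IsMeasurable)
    (T : ℕ) (lam : Fin L → ℝ) (k : ℕ) (j : Fin L) :
    Integrable (fun ω => hopCost P T lam (ruleLaw θ) (ξ ω) k j) μ := by
  unfold hopCost
  simp_rw [errFirst_state]
  exact (integrable_finsetSum _ fun l _ =>
    ((integrable_dot (hξ.memLp_noiseErr _)
      (memLp_mulVec _ (hξ.memLp_mismatch hθ T _ l))).const_mul _).add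
    (integrable_dot (hξ.memLp_mismatch hθ T _ l) (memLp_mulVec _ (hξ.memLp_mismatch hθ T _ l)))).add
    ((hξ.integrable_ind_decision hθ T k j).const_mul _)

lemma IsNoise.integrable_costToGo [IsFiniteMeasure μ] (hξ : IsNoise μ P ξ) (hθ : θ.IsMeasurable)
    (T : ℕ) (lam : Fin L → ℝ) (k : ℕ) (j : Fin L) :
    Integrable (fun ω => costToGo P T lam (ruleLaw θ) (ξ ω) k j) μ :=
  integrable_finsetSum _ fun _ _ => hξ.integrable_hopCost hθ T lam _ _

end Law

/-! ### The Riccati recursion -/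

/-- The feedback gain for the cost-to-go matrix `S`. -/
def gainFor (P : Plant n p m) (S : Matrix (Fin n) (Fin n) ℝ) : Matrix (Fin p) (Fin n) ℝ :=
  (P.R + P.Bᵀ * S * P.B)⁻¹ * P.Bᵀ * S * P.A

/-- One step of the Riccati recursion. -/
def riccatiStep (P : Plant n p m) (S : Matrix (Fin n) (Fin n) ℝ) : Matrix (Fin n) (Fin n) ℝ :=
  P.Q + P.Aᵀ * (S - S * P.B * (P.R + P.Bᵀ * S * P.B)⁻¹ * P.Bᵀ * S) * P.A

section Riccati

variable (P : Plant n p m) {S : Matrix (Fin n) (Fin n) ℝ}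

lemma posDef_inputWeight (hS : S.PosSemidef) : (P.R + P.Bᵀ * S * P.B).PosDef := by
  have := posSemidef_congr hS P.Bᵀ
  rw [transpose_transpose] at this
  exact P.posDef_R.add_posSemidef this

lemma inputWeight_mul_gainFor (hS : S.PosSemidef) :
    (P.R + P.Bᵀ * S * P.B) * gainFor P S = P.Bᵀ * S * P.A := by
  have h := (posDef_inputWeight P hS).isUnit
  rw [isUnit_iff_isUnit_det] at h
  rw [gainFor, ← Matrix.mul_assoc, ← Matrix.mul_assoc, ← Matrix.mul_assoc, mul_nonsing_inv _ h,
    Matrix.one_mul]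

lemma riccatiStep_eq (hS : S.PosSemidef) : riccatiStep P S = P.Q + P.Aᵀ * S * P.A -
    (gainFor P S)ᵀ * (P.R + P.Bᵀ * S * P.B) * gainFor P S := by
  have hSt := transpose_eq_of_posSemidef hS
  have hMt := transpose_eq_of_posSemidef (posDef_inputWeight P hS).posSemidef
  have h1 : (gainFor P S)ᵀ = P.Aᵀ * S * P.B * (P.R + P.Bᵀ * S * P.B)⁻¹ := by
    rw [gainFor, transpose_mul, transpose_mul, transpose_mul, transpose_nonsing_inv, hMt, hSt,
      transpose_transpose]
    simp only [Matrix.mul_assoc]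
  rw [Matrix.mul_assoc (gainFor P S)ᵀ, inputWeight_mul_gainFor P hS, h1, riccatiStep, Matrix.mul_sub,
    Matrix.sub_mul, ← add_sub_assoc]
  simp only [Matrix.mul_assoc]

/-- Completion of squares for one step of the linear-quadratic problem. -/
lemma riccatiStep_quad (hS : S.PosSemidef) (x : Fin n → ℝ) (u : Fin p → ℝ) :
    (P.A *ᵥ x + P.B *ᵥ u) ⬝ᵥ (S *ᵥ (P.A *ᵥ x + P.B *ᵥ u)) + x ⬝ᵥ (P.Q *ᵥ x) +
      u ⬝ᵥ (P.R *ᵥ u) =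
    x ⬝ᵥ (riccatiStep P S *ᵥ x) + (u + gainFor P S *ᵥ x) ⬝ᵥ
      ((P.R + P.Bᵀ * S * P.B) *ᵥ (u + gainFor P S *ᵥ x)) := by
  have hSt := transpose_eq_of_posSemidef hS
  have hMt := transpose_eq_of_posSemidef (posDef_inputWeight P hS).posSemidef
  have hML := inputWeight_mul_gainFor P hS
  rw [riccatiStep_eq P hS]
  set K := gainFor P S
  set M := P.R + P.Bᵀ * S * P.B with hM
  have h1 : (P.A *ᵥ x + P.B *ᵥ u) ⬝ᵥ (S *ᵥ (P.A *ᵥ x + P.B *ᵥ u)) =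
      x ⬝ᵥ ((P.Aᵀ * S * P.A) *ᵥ x) + 2 * (u ⬝ᵥ ((P.Bᵀ * S * P.A) *ᵥ x)) +
        u ⬝ᵥ ((P.Bᵀ * S * P.B) *ᵥ u) := by
    rw [mulVec_add, add_dotProduct, dotProduct_add, dotProduct_add,
      dot_mulVec_comm hSt (P.A *ᵥ x) (P.B *ᵥ u), mulVec_dot, mulVec_dot, mulVec_dot]
    simp only [mulVec_mulVec, Matrix.mul_assoc]
    ring
  have h2 : (u + K *ᵥ x) ⬝ᵥ (M *ᵥ (u + K *ᵥ x)) =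
      u ⬝ᵥ (M *ᵥ u) + 2 * (u ⬝ᵥ ((P.Bᵀ * S * P.A) *ᵥ x)) + x ⬝ᵥ ((Kᵀ * M * K) *ᵥ x) := by
    rw [mulVec_add, add_dotProduct, dotProduct_add, dotProduct_add,
      dot_mulVec_comm hMt (K *ᵥ x) u, mulVec_dot K, mulVec_mulVec, mulVec_mulVec, hML,
      Matrix.mul_assoc Kᵀ, hML]
    ring
  have h3 : u ⬝ᵥ (M *ᵥ u) = u ⬝ᵥ (P.R *ᵥ u) + u ⬝ᵥ ((P.Bᵀ * S * P.B) *ᵥ u) := by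
    rw [hM, add_mulVec, dotProduct_add]
  rw [h1, h2, h3, sub_mulVec, add_mulVec, dotProduct_sub, dotProduct_add]
  ring

/-- With the minimizing control `u = -K x` the square in `riccatiStep_quad` disappears, and the form
of the new matrix equals a sum of nonnegative costs. -/
lemma posSemidef_riccatiStep (hS : S.PosSemidef) : (riccatiStep P S).PosSemidef := by
  have hSt := transpose_eq_of_posSemidef hS
  have hMt := transpose_eq_of_posSemidef (posDef_inputWeight P hS).posSemidef
  refine posSemidef_of_quad ?_ fun x => ?_
  · rw [riccatiStep_eq P hS, transpose_sub, transpose_add, transpose_mul, transpose_mul,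
      transpose_mul, transpose_mul, hSt, hMt, transpose_eq_of_posSemidef P.posSemidef_Q,
      transpose_transpose, transpose_transpose]
    simp only [Matrix.mul_assoc]
  · have h := riccatiStep_quad P hS x (-(gainFor P S *ᵥ x))
    rw [neg_add_cancel, zero_dotProduct, add_zero] at h
    rw [← h]
    exact add_nonneg (add_nonneg (quad_nonneg hS _) (quad_nonneg P.posSemidef_Q _))
      (quad_nonneg P.posDef_R.posSemidef _)

lemma posSemidef_riccatiToGo : ∀ s, (riccatiToGo P s).PosSemidef
  | 0 => P.posSemidef_Lam
  | s + 1 => posSemidef_riccatiStep P (posSemidef_riccatiToGo s)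

lemma posSemidef_riccati (T k : ℕ) : (riccati P T k).PosSemidef := by
  unfold riccati
  split_ifs
  exacts [posSemidef_riccatiToGo P _, .zero]

lemma riccati_eq_step {T k : ℕ} (h : k < T) :
    riccati P T k = riccatiStep P (riccati P T (k + 1)) := by
  obtain ⟨s, rfl⟩ := Nat.exists_eq_add_of_lt h
  rw [riccati, if_pos (by omega), riccati, if_pos (by omega),
    show k + s + 1 - k = s + 1 by omega, show k + s + 1 - (k + 1) = s by omega]
  rfl

lemma riccati_self (T : ℕ) : riccati P T T = P.Lam := by
  rw [riccati, if_pos le_rfl, Nat.sub_self, riccatiToGo]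

/-- The default `riccati = 0` beyond the horizon annihilates the gain already at `k = T`. -/
lemma Gam_eq_zero {T k : ℕ} (h : T ≤ k) : Gam P T k = 0 := by
  have : lqrGain P T k = 0 := by
    rw [lqrGain, riccati, if_neg (by omega), Matrix.mul_zero, Matrix.zero_mul]
  rw [Gam, this, Matrix.mul_zero]

/-- Completion of squares along the closed loop. -/
lemma riccati_quad_control {T k : ℕ} (h : k < T) (s : LoopState n L) :
    predict P T k s 0 ⬝ᵥ (riccati P T (k + 1) *ᵥ predict P T k s 0) +
        s.est 0 ⬝ᵥ (P.Q *ᵥ s.est 0) + control P T k s ⬝ᵥ (P.R *ᵥ control P T k s) =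
      s.est 0 ⬝ᵥ (riccati P T k *ᵥ s.est 0) +
        (s.est 0 - s.est (Fin.last L)) ⬝ᵥ (Gam P T k *ᵥ (s.est 0 - s.est (Fin.last L))) := by
  -- The completed square measures the deviation from the optimal feedback on the sensor's estimate,
  -- which is the gain applied to `s.est 0 - s.est (Fin.last L)`.
  rw [predict, riccatiStep_quad P (posSemidef_riccati P T (k + 1)), riccati_eq_step P h, control,
    gainFor, ← lqrGain, neg_add_eq_sub, ← mulVec_sub, mulVec_dot, mulVec_mulVec, mulVec_mulVec,
    Gam]

end Riccati

/-! ### Orthogonality -/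

section Orthogonality

variable {Ω : Type*} [mΩ : MeasurableSpace Ω] {μ : Measure Ω} {P : Plant n p m}
  {ξ : Ω → Noise n m} {A : Matrix (Fin n) (Fin n) ℝ} {θ : Rule n L}

lemma quad_add {a : ℕ} (G : Matrix (Fin a) (Fin a) ℝ) (x y : Fin a → ℝ) :
    (x + y) ⬝ᵥ (G *ᵥ (x + y)) = x ⬝ᵥ (G *ᵥ x) + y ⬝ᵥ (G *ᵥ y) + x ⬝ᵥ ((G + Gᵀ) *ᵥ y) := by
  rw [add_mulVec, dotProduct_add x, ← mulVec_dot, dotProduct_comm (G *ᵥ x), mulVec_add,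
    add_dotProduct, dotProduct_add, dotProduct_add]
  ring

lemma memLp_fun_sub {E : Type*} [NormedAddCommGroup E] {f g : Ω → E} {q : ENNReal}
    (hf : MemLp f q μ) (hg : MemLp g q μ) : MemLp (fun ω => f ω - g ω) q μ := hf.sub hg

/-- Orthogonality is assumed for every matrix because the cross term carries `G + Gᵀ`; the weight
itself need not be symmetric. -/
lemma integral_quad_add {a : ℕ} {f g : Ω → Fin a → ℝ} (hf : MemLp f 2 μ) (hg : MemLp g 2 μ)
    (h : ∀ G : Matrix (Fin a) (Fin a) ℝ, ∫ ω, f ω ⬝ᵥ (G *ᵥ g ω) ∂μ = 0)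
    (G : Matrix (Fin a) (Fin a) ℝ) :
    ∫ ω, (f ω + g ω) ⬝ᵥ (G *ᵥ (f ω + g ω)) ∂μ =
      ∫ ω, f ω ⬝ᵥ (G *ᵥ f ω) ∂μ + ∫ ω, g ω ⬝ᵥ (G *ᵥ g ω) ∂μ := by
  simp_rw [quad_add]
  rw [integral_add ((integrable_dot hf (memLp_mulVec _ hf)).fun_add
      (integrable_dot hg (memLp_mulVec _ hg))) (integrable_dot hf (memLp_mulVec _ hg)), h, add_zero,
    integral_add (integrable_dot hf (memLp_mulVec _ hf)) (integrable_dot hg (memLp_mulVec _ hg))]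

lemma innovErr_of_le (P : Plant n p m) {M t : ℕ} (h : t ≤ M) (z : Noise n m) :
    innovErr P M z t = noiseInnov P z t := if_pos h

lemma innovErr_last (P : Plant n p m) (M : ℕ) (z : Noise n m) :
    innovErr P M z (M + 1) = noiseErr P z M := by simp [innovErr]

lemma model_innovErr {k M : ℕ} (h : k ≤ M) (z : Noise n m) :
    model A θ (innovErr P M z) k = model A θ (noiseInnov P z) k :=
  model_congr A θ fun _ ht => innovErr_of_le P (ht.trans h) z

lemma modelDec_innovErr {k M : ℕ} (h : k ≤ M) (z : Noise n m) :
    modelDec A θ (innovErr P M z) k = modelDec A θ (noiseInnov P z) k :=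
  modelDec_congr A θ fun _ ht => innovErr_of_le P (ht.trans h) z

lemma ctrlPart_innovErr {k M T : ℕ} (h : k ≤ M + 1) (z : Noise n m) :
    ctrlPart P T (model A θ (innovErr P M z)) k = ctrlPart P T (model A θ (noiseInnov P z)) k :=
  ctrlPart_congr P T fun _ ht => model_innovErr (by omega) z

/-- The controller is the least informed decision maker, so everything it has used up to time `k` is
known to `j`. Consequently the controls are unaffected too. -/
lemma model_last_flipUnknown (he : θ.IsEven) {k τ : ℕ} (hτ : τ ≤ k) (j : Fin (L + 1))
    (y : ℕ → Fin n → ℝ) :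
    model A θ (flipUnknown A θ k j y) τ (Fin.last L) = model A θ y τ (Fin.last L) :=
  model_flipUnknown_of_le he y (by omega)
    ((fresh_mono _ hτ _).trans (fresh_antitone _ k (Fin.le_last j)))

lemma ctrlPart_flipUnknown (he : θ.IsEven) {k τ T : ℕ} (hτ : τ ≤ k + 1) (j : Fin (L + 1))
    (y : ℕ → Fin n → ℝ) : ctrlPart P T (model A θ (flipUnknown A θ k j y)) τ =
      ctrlPart P T (model A θ y) τ := by
  induction τ with
  | zero => rfl
  | succ τ ih =>
    rw [ctrlPart, ctrlPart, ih (by omega), model_last_flipUnknown he (by omega)]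

lemma predict_ruleLaw (P : Plant n p m) (T : ℕ) (θ : Rule n L) (z : Noise n m) (k : ℕ)
    (i : Fin (L + 1)) : predict P T k (state P T (ruleLaw θ) z k) i =
      P.A *ᵥ model P.A θ (noiseInnov P z) k i +
        ctrlPart P T (model P.A θ (noiseInnov P z)) (k + 1) := by
  rw [predict, control, est_ruleLaw, est_ruleLaw, ctrlPart, mulVec_add]
  abel

lemma est_zero_succ (P : Plant n p m) (T : ℕ) (π : Law n L) (z : Noise n m) (k : ℕ) :
    (state P T π z (k + 1)).est 0 =
      noiseInnov P z (k + 1) + predict P T k (state P T π z k) 0 := by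
  rw [← innov_eq P T π, add_comm (innov P T π z (k + 1))]
  rfl

variable [IsFiniteMeasure μ]

/-- With `M = k`, coordinate `k + 1` of `innovErr` is the filter error. The sensor's reversal starts
exactly there, so it negates the error and keeps the estimate. -/
lemma IsNoise.integral_err_est (hξ : IsNoise μ P ξ) (hθ : θ.IsMeasurable) (he : θ.IsEven)
    (T k : ℕ) (G : Matrix (Fin n) (Fin n) ℝ) :
    ∫ ω, noiseErr P (ξ ω) k ⬝ᵥ (G *ᵥ (state P T (ruleLaw θ) (ξ ω) k).est 0) ∂μ = 0 := by
  have h := hξ.integral_eq_zero_of_odd (A := P.A) hθ he k k 0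
    (g := fun y => y (k + 1) ⬝ᵥ (G *ᵥ (model P.A θ y k 0 + ctrlPart P T (model P.A θ y) k)))
    (measurable_dot (measurable_pi_apply _) (measurable_mulVec_const _
      ((measurable_model hθ _ _).add (measurable_ctrlPart P T hθ k))))
    (fun y => by
      rw [flipUnknown_of_gt y (by omega), model_flipUnknown_of_ge_index he y le_rfl,
        ctrlPart_flipUnknown he (by omega), neg_dotProduct])
  simp_rw [innovErr_last, model_innovErr le_rfl, ctrlPart_innovErr (Nat.le_succ k)] at h
  simpa only [est_ruleLaw] using h

/-- Here `M = k + 1` makes coordinate `k + 1` the next innovation, which is still unknown to the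
sensor at time `k`. -/
lemma IsNoise.integral_innov_predict (hξ : IsNoise μ P ξ) (hθ : θ.IsMeasurable) (he : θ.IsEven)
    (T k : ℕ) (G : Matrix (Fin n) (Fin n) ℝ) :
    ∫ ω, noiseInnov P (ξ ω) (k + 1) ⬝ᵥ
      (G *ᵥ predict P T k (state P T (ruleLaw θ) (ξ ω) k) 0) ∂μ = 0 := by
  have h := hξ.integral_eq_zero_of_odd (A := P.A) hθ he (k + 1) k 0
    (g := fun y => y (k + 1) ⬝ᵥ
      (G *ᵥ (P.A *ᵥ model P.A θ y k 0 + ctrlPart P T (model P.A θ y) (k + 1))))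
    (measurable_dot (measurable_pi_apply _) (measurable_mulVec_const _
      ((measurable_mulVec_const _ (measurable_model hθ _ _)).add (measurable_ctrlPart P T hθ _))))
    (fun y => by
      rw [flipUnknown_of_gt y (by omega), model_flipUnknown_of_ge_index he y le_rfl,
        ctrlPart_flipUnknown he le_rfl, neg_dotProduct])
  simp_rw [innovErr_of_le P (le_refl (k + 1)), model_innovErr (Nat.le_succ k),
    ctrlPart_innovErr (Nat.le_succ (k + 1))] at h
  simpa only [predict_ruleLaw] using h

lemma IsNoise.integral_model_sub_model (hξ : IsNoise μ P ξ) (hθ : θ.IsMeasurable)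
    (he : θ.IsEven) (k : ℕ) {i j : Fin (L + 1)} (hij : i ≤ j) (G : Matrix (Fin n) (Fin n) ℝ) :
    ∫ ω, (model A θ (noiseInnov P (ξ ω)) k i - model A θ (noiseInnov P (ξ ω)) k j) ⬝ᵥ
      (G *ᵥ model A θ (noiseInnov P (ξ ω)) k j) ∂μ = 0 := by
  have h := hξ.integral_eq_zero_of_odd (A := A) hθ he k k j
    (g := fun y => (model A θ y k i - model A θ y k j) ⬝ᵥ (G *ᵥ model A θ y k j))
    (measurable_dot ((measurable_model hθ _ _).sub (measurable_model hθ _ _))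
      (measurable_mulVec_const _ (measurable_model hθ _ _)))
    (fun y => by
      rw [model_sub_flipUnknown he y hij, model_flipUnknown_of_ge_index he y le_rfl,
        neg_dotProduct])
  simpa only [model_innovErr (le_refl k)] using h

/-- What a blocked transmission would have contributed is orthogonal to what the receiver knows. -/
lemma IsNoise.integral_blocked (hξ : IsNoise μ P ξ) (hθ : θ.IsMeasurable) (he : θ.IsEven)
    (k : ℕ) (j : Fin L) (G : Matrix (Fin n) (Fin n) ℝ) :
    ∫ ω, (if modelDec A θ (noiseInnov P (ξ ω)) k j then 0 else
        model A θ (noiseInnov P (ξ ω)) k j.castSucc - model A θ (noiseInnov P (ξ ω)) k j.succ) ⬝ᵥ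
      (G *ᵥ (if modelDec A θ (noiseInnov P (ξ ω)) k j then
        model A θ (noiseInnov P (ξ ω)) k j.castSucc else model A θ (noiseInnov P (ξ ω)) k j.succ))
        ∂μ = 0 := by
  have hd : MeasurableSet {y | modelDec A θ y k j = true} :=
    measurable_modelDec hθ k j (measurableSet_singleton true)
  have h := hξ.integral_eq_zero_of_odd (A := A) hθ he k k j.succ
    (g := fun y => (if modelDec A θ y k j then 0 else
        model A θ y k j.castSucc - model A θ y k j.succ) ⬝ᵥ
      (G *ᵥ (if modelDec A θ y k j then model A θ y k j.castSucc else model A θ y k j.succ)))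
    (measurable_dot (Measurable.ite hd measurable_const
        ((measurable_model hθ _ _).sub (measurable_model hθ _ _)))
      (measurable_mulVec_const _ (Measurable.ite hd (measurable_model hθ _ _)
        (measurable_model hθ _ _))))
    (fun y => by
      rw [modelDec_flipUnknown he y le_rfl]
      split_ifs
      · simp
      · rw [model_sub_flipUnknown he y (Fin.castSucc_lt_succ (i := j)).le,
          model_flipUnknown_of_ge_index he y le_rfl, neg_dotProduct])
  simpa only [model_innovErr (le_refl k), modelDec_innovErr (le_refl k)] using h

end Orthogonality

/-! ### The cost of a threshold policy -/

/-- The weight with which a lack of information at a scheduler `h` hops before the controller enters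
the control cost. -/
def hopWeight (P : Plant n p m) (T k h : ℕ) : Matrix (Fin n) (Fin n) ℝ :=
  (P.A ^ h)ᵀ * Gam P T (k + h) * P.A ^ h

lemma hopWeight_eq_zero (P : Plant n p m) {T k h : ℕ} (hT : T ≤ k + h) :
    hopWeight P T k h = 0 := by
  rw [hopWeight, Gam_eq_zero P hT, Matrix.mul_zero, Matrix.zero_mul]

/-- One step later and one hop closer, the arrival time `k + h` at the controller is the same. -/
lemma hopWeight_succ_quad (P : Plant n p m) (T k h : ℕ) (x : Fin n → ℝ) :
    (P.A *ᵥ x) ⬝ᵥ (hopWeight P T (k + 1) h *ᵥ (P.A *ᵥ x)) =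
      x ⬝ᵥ (hopWeight P T k (h + 1) *ᵥ x) := by
  rw [mulVec_dot, mulVec_mulVec, mulVec_mulVec, hopWeight, hopWeight, pow_succ, transpose_mul,
    show k + 1 + h = k + (h + 1) by omega]
  simp only [Matrix.mul_assoc]

section Cost

variable {Ω : Type*} [mΩ : MeasurableSpace Ω] {μ : Measure Ω} {P : Plant n p m}
  {ξ : Ω → Noise n m}

/-- The expected control cost which scheduler `j` incurs if it does not transmit at time `k`. -/
def blockCost (μ : Measure Ω) (P : Plant n p m) (T : ℕ) (θ : Rule n L) (ξ : Ω → Noise n m) (k : ℕ)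
    (j : Fin L) : ℝ :=
  ∫ ω, (if modelDec P.A θ (noiseInnov P (ξ ω)) k j then 0 else
      model P.A θ (noiseInnov P (ξ ω)) k j.castSucc - model P.A θ (noiseInnov P (ξ ω)) k j.succ) ⬝ᵥ
    (hopWeight P T k (L - (j : ℕ)) *ᵥ (if modelDec P.A θ (noiseInnov P (ξ ω)) k j then 0 else
      model P.A θ (noiseInnov P (ξ ω)) k j.castSucc -
        model P.A θ (noiseInnov P (ξ ω)) k j.succ)) ∂μ

/-- The expected quadratic form of the contribution of the innovations to an estimate, weighted
according to the distance to the controller. -/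
def knownGain (μ : Measure Ω) (P : Plant n p m) (T : ℕ) (θ : Rule n L) (ξ : Ω → Noise n m) (k : ℕ)
    (i : Fin (L + 1)) : ℝ :=
  ∫ ω, model P.A θ (noiseInnov P (ξ ω)) k i ⬝ᵥ
    (hopWeight P T k (L - (i : ℕ)) *ᵥ model P.A θ (noiseInnov P (ξ ω)) k i) ∂μ

lemma IsNoise.memLp_predict (hξ : IsNoise μ P ξ) {θ : Rule n L} (hθ : θ.IsMeasurable) (T k : ℕ)
    (i : Fin (L + 1)) : MemLp (fun ω => predict P T k (state P T (ruleLaw θ) (ξ ω) k) i) 2 μ :=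
  (memLp_mulVec _ (hξ.memLp_est hθ T k i)).add (memLp_mulVec _ (hξ.memLp_control hθ T k))

variable [IsFiniteMeasure μ]

/-- This is Pythagoras for the sender's estimate, split into a blocked part and the part available
to the receiver. After one prediction step the latter is the receiver's next estimate. -/
lemma IsNoise.knownGain_castSucc (hξ : IsNoise μ P ξ) {θ : Rule n L} (hθ : θ.IsMeasurable)
    (he : θ.IsEven) (T k : ℕ) (j : Fin L) : knownGain μ P T θ ξ k j.castSucc =
      blockCost μ P T θ ξ k j + knownGain μ P T θ ξ (k + 1) j.succ := by
  have hd := (measurable_modelDec (A := P.A) hθ k j).comp hξ.measurable_noiseInnov_pi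
  have h := integral_quad_add
    (memLp_ite hd MemLp.zero'
      (memLp_fun_sub (hξ.memLp_model hθ k j.castSucc) (hξ.memLp_model hθ k j.succ)))
    (memLp_ite hd (hξ.memLp_model hθ k j.castSucc) (hξ.memLp_model hθ k j.succ))
    (hξ.integral_blocked hθ he k j) (hopWeight P T k (L - (j : ℕ)))
  have hL : L - (j : ℕ) = L - ((j : ℕ) + 1) + 1 := by omega
  rw [knownGain, blockCost, knownGain]
  simp only [Fin.val_castSucc, Fin.val_succ, model_succ_succ, hopWeight_succ_quad, ← hL]
  refine Eq.trans (integral_congr_ae (.of_forall fun ω => ?_)) h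
  by_cases hb : modelDec P.A θ (noiseInnov P (ξ ω)) k j = true <;> simp [hb]

lemma knownGain_of_le (μ : Measure Ω) (P : Plant n p m) {T : ℕ} (θ : Rule n L)
    (ξ : Ω → Noise n m) {k : ℕ} (h : T ≤ k) (i : Fin (L + 1)) : knownGain μ P T θ ξ k i = 0 := by
  simp [knownGain, hopWeight_eq_zero P (show T ≤ k + (L - (i : ℕ)) by omega)]

/-- Summing the Pythagorean identity over the hops shifts the sum over decision makers from time `k`
to `k + 1`, except for the sensor's term. This telescopes in `k`, and at time `T` all weights
vanish. -/
lemma IsNoise.sum_knownGain_last (hξ : IsNoise μ P ξ) {θ : Rule n L} (hθ : θ.IsMeasurable)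
    (he : θ.IsEven) (T : ℕ) : ∑ k ∈ Finset.range T, knownGain μ P T θ ξ k (Fin.last L) =
      ∑ i, knownGain μ P T θ ξ 0 i + ∑ k ∈ Finset.range T, knownGain μ P T θ ξ (k + 1) 0 -
        ∑ k ∈ Finset.range T, ∑ j, blockCost μ P T θ ξ k j := by
  have step : ∀ k, knownGain μ P T θ ξ k (Fin.last L) =
      (∑ i, knownGain μ P T θ ξ k i - ∑ i, knownGain μ P T θ ξ (k + 1) i) +
        knownGain μ P T θ ξ (k + 1) 0 - ∑ j, blockCost μ P T θ ξ k j := by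
    intro k
    rw [Fin.sum_univ_castSucc, Fin.sum_univ_succ (fun i => knownGain μ P T θ ξ (k + 1) i)]
    simp_rw [hξ.knownGain_castSucc hθ he, Finset.sum_add_distrib]
    ring
  rw [Finset.sum_congr rfl fun k _ => step k, Finset.sum_sub_distrib, Finset.sum_add_distrib,
    Finset.sum_range_sub' (fun k => ∑ i, knownGain μ P T θ ξ k i)]
  simp [knownGain_of_le μ P θ ξ (le_refl T)]

/-- The controller's estimate is orthogonal to what it lacks, and the two add up to the open-loop
sum of all innovations, which no policy can influence. -/
lemma IsNoise.integral_est_sub_est_last (hξ : IsNoise μ P ξ) {θ : Rule n L} (hθ : θ.IsMeasurable)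
    (he : θ.IsEven) (T k : ℕ) :
    ∫ ω, ((state P T (ruleLaw θ) (ξ ω) k).est 0 -
        (state P T (ruleLaw θ) (ξ ω) k).est (Fin.last L)) ⬝ᵥ
      (Gam P T k *ᵥ ((state P T (ruleLaw θ) (ξ ω) k).est 0 -
        (state P T (ruleLaw θ) (ξ ω) k).est (Fin.last L))) ∂μ =
    ∫ ω, openLoop P.A (noiseInnov P (ξ ω)) k (k + 1) ⬝ᵥ
      (Gam P T k *ᵥ openLoop P.A (noiseInnov P (ξ ω)) k (k + 1)) ∂μ -
      knownGain μ P T θ ξ k (Fin.last L) := by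
  have h := integral_quad_add
    (memLp_fun_sub (hξ.memLp_model (A := P.A) hθ k 0) (hξ.memLp_model hθ k (Fin.last L)))
    (hξ.memLp_model hθ k (Fin.last L))
    (hξ.integral_model_sub_model hθ he k (Fin.zero_le _)) (Gam P T k)
  simp only [sub_add_cancel] at h
  simp only [est_ruleLaw, add_sub_add_right_eq_sub, knownGain, Fin.val_last, Nat.sub_self,
    hopWeight, pow_zero, Matrix.mul_one, transpose_one, Matrix.one_mul, add_zero]
  rw [eq_sub_iff_add_eq, ← h]
  simp only [model_eq_openLoop, fresh_zero_right]

lemma knownGain_congr (μ : Measure Ω) (P : Plant n p m) (T : ℕ) (θ : Rule n L)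
    (ξ : Ω → Noise n m) (k : ℕ) : knownGain μ P T θ ξ k 0 =
      ∫ ω, openLoop P.A (noiseInnov P (ξ ω)) k (k + 1) ⬝ᵥ
        (hopWeight P T k L *ᵥ openLoop P.A (noiseInnov P (ξ ω)) k (k + 1)) ∂μ := by
  simp only [knownGain, model_eq_openLoop, fresh_zero_right, Fin.val_zero, Nat.sub_zero]

lemma IsNoise.integral_quad_x (hξ : IsNoise μ P ξ) {θ : Rule n L} (hθ : θ.IsMeasurable)
    (he : θ.IsEven) (T k : ℕ) (G : Matrix (Fin n) (Fin n) ℝ) :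
    ∫ ω, (state P T (ruleLaw θ) (ξ ω) k).x ⬝ᵥ (G *ᵥ (state P T (ruleLaw θ) (ξ ω) k).x) ∂μ =
      ∫ ω, noiseErr P (ξ ω) k ⬝ᵥ (G *ᵥ noiseErr P (ξ ω) k) ∂μ +
      ∫ ω, (state P T (ruleLaw θ) (ξ ω) k).est 0 ⬝ᵥ
        (G *ᵥ (state P T (ruleLaw θ) (ξ ω) k).est 0) ∂μ := by
  rw [← integral_quad_add (hξ.memLp_noiseErr k) (hξ.memLp_est hθ T k 0)
    (hξ.integral_err_est hθ he T k) G]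
  simp only [x_eq, add_comm]

/-- This is the mean of `riccati_quad_control`, with the new innovation, orthogonal to the
prediction, accounting for the step from the prediction to the next estimate. The Riccati terms are
left as a difference so that they telescope. -/
lemma IsNoise.integral_stageCost (hξ : IsNoise μ P ξ) {θ : Rule n L} (hθ : θ.IsMeasurable)
    (he : θ.IsEven) {T k : ℕ} (hk : k < T) :
    ∫ ω, ((state P T (ruleLaw θ) (ξ ω) k).est 0 ⬝ᵥ
        (P.Q *ᵥ (state P T (ruleLaw θ) (ξ ω) k).est 0)) ∂μ +
      ∫ ω, control P T k (state P T (ruleLaw θ) (ξ ω) k) ⬝ᵥ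
        (P.R *ᵥ control P T k (state P T (ruleLaw θ) (ξ ω) k)) ∂μ =
    (∫ ω, ((state P T (ruleLaw θ) (ξ ω) k).est 0 ⬝ᵥ
        (riccati P T k *ᵥ (state P T (ruleLaw θ) (ξ ω) k).est 0)) ∂μ -
      ∫ ω, ((state P T (ruleLaw θ) (ξ ω) (k + 1)).est 0 ⬝ᵥ
        (riccati P T (k + 1) *ᵥ (state P T (ruleLaw θ) (ξ ω) (k + 1)).est 0)) ∂μ) +
      ∫ ω, noiseInnov P (ξ ω) (k + 1) ⬝ᵥ
        (riccati P T (k + 1) *ᵥ noiseInnov P (ξ ω) (k + 1)) ∂μ +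
      ∫ ω, ((state P T (ruleLaw θ) (ξ ω) k).est 0 -
        (state P T (ruleLaw θ) (ξ ω) k).est (Fin.last L)) ⬝ᵥ
      (Gam P T k *ᵥ ((state P T (ruleLaw θ) (ξ ω) k).est 0 -
        (state P T (ruleLaw θ) (ξ ω) k).est (Fin.last L))) ∂μ := by
  have hp := hξ.memLp_predict hθ T k 0
  have hx := hξ.memLp_est hθ T k 0
  have hu := hξ.memLp_control hθ T k
  have hd := memLp_fun_sub hx (hξ.memLp_est hθ T k (Fin.last L))
  have h1 := integral_quad_add (hξ.memLp_noiseInnov (k + 1)) hp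
    (hξ.integral_innov_predict hθ he T k) (riccati P T (k + 1))
  simp only [← est_zero_succ] at h1
  have h2 := integral_congr_ae (μ := μ) (.of_forall fun ω =>
    riccati_quad_control P hk (state P T (ruleLaw θ) (ξ ω) k))
  rw [integral_add ((integrable_dot hp (memLp_mulVec _ hp)).fun_add
      (integrable_dot hx (memLp_mulVec _ hx))) (integrable_dot hu (memLp_mulVec _ hu)),
    integral_add (integrable_dot hp (memLp_mulVec _ hp)) (integrable_dot hx (memLp_mulVec _ hx)),
    integral_add (integrable_dot hx (memLp_mulVec _ hx)) (integrable_dot hd (memLp_mulVec _ hd))]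
    at h2
  linarith

/-- Up to a constant that does not depend on the rule, the control cost is the sum of the costs of
the missing transmissions. -/
theorem IsNoise.exists_controlCost_eq (hξ : IsNoise μ P ξ) (T L : ℕ) :
    ∃ c : ℝ, ∀ θ : Rule n L, θ.IsMeasurable → θ.IsEven → controlCost μ P T (ruleLaw θ) ξ =
      c + ∑ k ∈ Finset.range T, ∑ j, blockCost μ P T θ ξ k j := by
  -- The terms `knownGain` at time `0` or at the sensor are the same for all rules; `θ₀` merely
  -- serves to name them in the constant.
  let θ₀ : Rule n L := fun _ _ _ => true
  refine ⟨∫ ω, noiseErr P (ξ ω) T ⬝ᵥ (P.Lam *ᵥ noiseErr P (ξ ω) T) ∂μ +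
    ∑ k ∈ Finset.range T, ∫ ω, noiseErr P (ξ ω) k ⬝ᵥ (P.Q *ᵥ noiseErr P (ξ ω) k) ∂μ +
    ∫ ω, noiseInnov P (ξ ω) 0 ⬝ᵥ (riccati P T 0 *ᵥ noiseInnov P (ξ ω) 0) ∂μ +
    ∑ k ∈ Finset.range T, ∫ ω, noiseInnov P (ξ ω) (k + 1) ⬝ᵥ
        (riccati P T (k + 1) *ᵥ noiseInnov P (ξ ω) (k + 1)) ∂μ +
    ∑ k ∈ Finset.range T, ∫ ω, openLoop P.A (noiseInnov P (ξ ω)) k (k + 1) ⬝ᵥ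
      (Gam P T k *ᵥ openLoop P.A (noiseInnov P (ξ ω)) k (k + 1)) ∂μ -
    ∑ i, knownGain μ P T θ₀ ξ 0 i - ∑ k ∈ Finset.range T, knownGain μ P T θ₀ ξ (k + 1) 0,
    fun θ hθ he => ?_⟩
  have hx := hξ.memLp_x (P := P) hθ T
  have hu := hξ.memLp_control (P := P) hθ T
  have hint : ∀ k, Integrable (fun ω =>
      (state P T (ruleLaw θ) (ξ ω) k).x ⬝ᵥ (P.Q *ᵥ (state P T (ruleLaw θ) (ξ ω) k).x)) μ :=
    fun k => integrable_dot (hx k) (memLp_mulVec _ (hx k))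
  have hintu : ∀ k, Integrable (fun ω => control P T k (state P T (ruleLaw θ) (ξ ω) k) ⬝ᵥ
        (P.R *ᵥ control P T k (state P T (ruleLaw θ) (ξ ω) k))) μ :=
    fun k => integrable_dot (hu k) (memLp_mulVec _ (hu k))
  rw [controlCost]
  unfold pathCost
  rw [integral_add (integrable_dot (hx T) (memLp_mulVec _ (hx T)))
    (integrable_finsetSum _ fun k _ => (hint k).fun_add (hintu k)),
    integral_finsetSum _ fun k _ => (hint k).fun_add (hintu k), hξ.integral_quad_x hθ he]
  have hstage : ∀ k ∈ Finset.range T, ∫ ω, ((state P T (ruleLaw θ) (ξ ω) k).x ⬝ᵥ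
        (P.Q *ᵥ (state P T (ruleLaw θ) (ξ ω) k).x) +
        control P T k (state P T (ruleLaw θ) (ξ ω) k) ⬝ᵥ
          (P.R *ᵥ control P T k (state P T (ruleLaw θ) (ξ ω) k))) ∂μ = _ := fun k hk => by
    rw [integral_add (hint k) (hintu k), hξ.integral_quad_x hθ he, add_assoc,
      hξ.integral_stageCost hθ he (Finset.mem_range.1 hk), hξ.integral_est_sub_est_last hθ he]
  rw [Finset.sum_congr rfl hstage]
  simp only [Finset.sum_add_distrib, Finset.sum_sub_distrib]
  have htel := Finset.sum_range_sub' (fun k => ∫ ω, ((state P T (ruleLaw θ) (ξ ω) k).est 0 ⬝ᵥ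
        (riccati P T k *ᵥ (state P T (ruleLaw θ) (ξ ω) k).est 0)) ∂μ) T
  rw [Finset.sum_sub_distrib] at htel
  rw [htel, hξ.sum_knownGain_last hθ he, riccati_self]
  have h0 : ∀ i, knownGain μ P T θ ξ 0 i = knownGain μ P T θ₀ ξ 0 i := fun _ => rfl
  have h1 : ∀ k, knownGain μ P T θ ξ k 0 = knownGain μ P T θ₀ ξ k 0 := fun k => by
    rw [knownGain_congr, knownGain_congr]
  have h2 : ∀ ω, (state P T (ruleLaw θ) (ξ ω) 0).est 0 = noiseInnov P (ξ ω) 0 := fun _ => rfl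
  simp only [h0, h1, h2]
  ring

end Cost

/-! ### The value-of-information rule -/

open Classical in
/-- The rule of the value-of-information policy. -/
def voiRule (P : Plant n p m) (T : ℕ) (lam : Fin L → ℝ) (D : Set (Fin L)) : Rule n L :=
  fun k j e =>
    if j ∈ D then decide (k + (L - (j : ℕ)) ≤ T ∧ dVoI P T lam k j e < 0) else true

lemma voiLaw_eq_ruleLaw (P : Plant n p m) (T : ℕ) (lam : Fin L → ℝ) (D : Set (Fin L)) :
    voiLaw P T lam D = ruleLaw (voiRule P T lam D) := rfl

lemma dVoI_eq (P : Plant n p m) (T : ℕ) (lam : Fin L → ℝ) (k : ℕ) (j : Fin L) (e : Fin n → ℝ) :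
    dVoI P T lam k j e = lam j - e ⬝ᵥ (hopWeight P T k (L - (j : ℕ)) *ᵥ e) := rfl

lemma isEven_voiRule (P : Plant n p m) (T : ℕ) (lam : Fin L → ℝ) (D : Set (Fin L)) :
    (voiRule P T lam D).IsEven := by
  intro k j e
  simp [voiRule, dVoI_eq, mulVec_neg]

lemma measurable_dVoI (P : Plant n p m) (T : ℕ) (lam : Fin L → ℝ) (k : ℕ) (j : Fin L) :
    Measurable (dVoI P T lam k j) :=
  measurable_const.sub (measurable_dot measurable_id (measurable_mulVec_const _ measurable_id))

lemma isMeasurable_voiRule (P : Plant n p m) (T : ℕ) (lam : Fin L → ℝ) (D : Set (Fin L)) :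
    (voiRule P T lam D).IsMeasurable := by
  intro k j
  unfold voiRule
  by_cases hj : j ∈ D
  · simp only [hj, if_true]
    refine measurable_to_bool ?_
    by_cases hk : k + (L - (j : ℕ)) ≤ T
    · convert (measurable_dVoI P T lam k j) (measurableSet_Iio (a := 0)) using 1
      ext e
      simp [hk]
    · convert MeasurableSet.empty (α := Fin n → ℝ) using 1
      ext e
      simp [hk]
  · simp only [hj, if_false]
    exact measurable_const

/-- A scheduler which does not transmit has a nonnegative value of information. -/
lemma quad_le_of_voiRule_eq_false (P : Plant n p m) (T : ℕ) {lam : Fin L → ℝ}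
    (hlam : ∀ j, 0 ≤ lam j) {D : Set (Fin L)} {k : ℕ} {j : Fin L} {e : Fin n → ℝ}
    (h : voiRule P T lam D k j e = false) :
    e ⬝ᵥ (hopWeight P T k (L - (j : ℕ)) *ᵥ e) ≤ lam j := by
  unfold voiRule at h
  split_ifs at h with hj
  rw [decide_eq_false_iff_not, not_and_or, not_le, not_lt, dVoI_eq] at h
  -- Past the deadline a transmission cannot reach the controller in time to matter, so its weight
  -- is zero and `0 ≤ lam j` suffices.
  rcases h with h | h
  · rw [hopWeight_eq_zero P h.le, zero_mulVec, dotProduct_zero]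
    exact hlam j
  · linarith

/-! ### Admissibility -/

/-- Information advances one hop per step, so an estimate that sits `i` hops from the sensor uses
data delayed by the number of hops they had to cover. -/
lemma ctrlFree_congr_of_delay (A : Matrix (Fin n) (Fin n) ℝ) {ζ ζ' : ℕ → Fin n → ℝ}
    {d d' : ℕ → Fin L → Bool} (k : ℕ) (i : Fin (L + 1))
    (hζ : ∀ t, t + (i : ℕ) ≤ k → ζ t = ζ' t)
    (hd : ∀ (l : Fin L) (t : ℕ), (l : ℕ) < i → t + ((i : ℕ) - (l : ℕ)) ≤ k → d t l = d' t l) :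
    ctrlFree A ζ d k i = ctrlFree A ζ' d' k i := by
  induction k generalizing i with
  | zero =>
    induction i using Fin.cases with
    | zero => exact hζ 0 (by simp)
    | succ j => rfl
  | succ k ih =>
    induction i using Fin.cases with
    | zero =>
      rw [ctrlFree_succ_zero, ctrlFree_succ_zero, hζ (k + 1) (by simp),
        ih 0 (fun t ht => hζ t (by simp at ht ⊢; omega)) (fun l t hl => by simp at hl)]
    | succ j =>
      simp only [Fin.val_succ] at hζ hd
      rw [ctrlFree_succ_succ, ctrlFree_succ_succ, hd j k (by omega) (by omega),
        ih j.castSucc (fun t ht => hζ t (by simp at ht; omega))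
          (fun l t hl ht => hd l t (by simp at hl; omega) (by simp at ht hl; omega)),
        ih j.succ (fun t ht => hζ t (by simp at ht; omega))
          (fun l t hl ht => hd l t (by simpa using hl) (by simp at ht hl; omega))]

lemma measurable_ctrlFree (A : Matrix (Fin n) (Fin n) ℝ) (k : ℕ) (i : Fin (L + 1)) :
    Measurable fun q : (ℕ → Fin n → ℝ) × (ℕ → Fin L → Bool) => ctrlFree A q.1 q.2 k i := by
  have hy : ∀ t, Measurable fun q : (ℕ → Fin n → ℝ) × (ℕ → Fin L → Bool) => q.1 t :=
    fun t => (measurable_pi_apply t).comp measurable_fst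
  induction k generalizing i with
  | zero =>
    induction i using Fin.cases with
    | zero => exact hy 0
    | succ j => exact measurable_const
  | succ k ih =>
    induction i using Fin.cases with
    | zero => exact (measurable_mulVec_const _ (ih 0)).add (hy (k + 1))
    | succ j =>
      refine measurable_mulVec_const A (Measurable.ite ?_ (ih _) (ih _))
      have hj : Measurable fun q : (ℕ → Fin n → ℝ) × (ℕ → Fin L → Bool) => q.2 k j :=
        (measurable_pi_apply j).comp ((measurable_pi_apply k).comp measurable_snd)
      exact hj (measurableSet_singleton true)

theorem admissible_ruleLaw (P : Plant n p m) (T : ℕ) {θ : Rule n L} (hθ : θ.IsMeasurable) :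
    Admissible P T (ruleLaw θ) := by
  -- The witness recomputes both estimates from innovations and decisions and then applies the
  -- threshold rule; the common control part is not needed.
  refine ⟨fun k j q => θ k j (ctrlFree P.A q.1 q.2 k j.castSucc - ctrlFree P.A q.1 q.2 k j.succ),
    fun k j => (hθ k j).comp ((measurable_ctrlFree _ _ _).sub (measurable_ctrlFree _ _ _)),
    fun k j ζ ζ' d d' hζ hd hown => ?_, fun z k j => ?_⟩
  · have h1 : ctrlFree P.A ζ d k j.castSucc = ctrlFree P.A ζ' d' k j.castSucc :=
      ctrlFree_congr_of_delay _ _ _ hζ hd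
    have h2 : ctrlFree P.A ζ d k j.succ = ctrlFree P.A ζ' d' k j.succ := by
      refine ctrlFree_congr_of_delay _ _ _ (fun t ht => hζ t (by simp at ht; omega))
        fun l t hl ht => ?_
      simp only [Fin.val_succ] at hl ht
      -- The receiver's estimate involves decisions of earlier schedulers, which arrive with delay,
      -- and the scheduler's own decisions strictly before `k`.
      rcases Nat.lt_succ_iff_lt_or_eq.1 hl with h | h
      · exact hd l t h (by omega)
      · obtain rfl : l = j := Fin.ext h
        exact hown t (by omega)
    simp only [h1, h2]
  · have h : innov P T (ruleLaw θ) z = noiseInnov P z := funext fun t => innov_eq P T _ z t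
    simp only [h]
    rw [← mismatch_eq]
    rfl

/-! ### Performance -/

section Performance

variable {Ω : Type*} [mΩ : MeasurableSpace Ω] {μ : Measure Ω} [IsProbabilityMeasure μ]
  {P : Plant n p m} {ξ : Ω → Noise n m}

lemma IsNoise.requestRate_eq (hξ : IsNoise μ P ξ) {θ : Rule n L} (hθ : θ.IsMeasurable) (T : ℕ)
    (j : Fin L) : requestRate μ P T (ruleLaw θ) ξ j =
      ∑ k ∈ Finset.range T, ∫ ω, ind (modelDec P.A θ (noiseInnov P (ξ ω)) k j) ∂μ := by
  rw [requestRate, integral_finsetSum _ fun k _ => hξ.integrable_ind_decision hθ T k j]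
  simp_rw [decision_ruleLaw]

/-- The bound holds pathwise: a transmission costs `lam j`, and a blocked one costs a quadratic form
that is at most `lam j` by `quad_le_of_voiRule_eq_false`. -/
lemma IsNoise.blockCost_add_le (hξ : IsNoise μ P ξ) (T : ℕ) {lam : Fin L → ℝ}
    (hlam : ∀ j, 0 ≤ lam j) (D : Set (Fin L)) (k : ℕ) (j : Fin L) :
    blockCost μ P T (voiRule P T lam D) ξ k j +
      lam j * ∫ ω, ind (modelDec P.A (voiRule P T lam D) (noiseInnov P (ξ ω)) k j) ∂μ ≤ lam j := by
  have hθ := isMeasurable_voiRule P T lam D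
  have hd : Measurable fun ω => modelDec P.A (voiRule P T lam D) (noiseInnov P (ξ ω)) k j :=
    (measurable_modelDec (A := P.A) hθ k j).comp hξ.measurable_noiseInnov_pi
  have hf : MemLp (fun ω => if modelDec P.A (voiRule P T lam D) (noiseInnov P (ξ ω)) k j then 0
      else model P.A (voiRule P T lam D) (noiseInnov P (ξ ω)) k j.castSucc -
        model P.A (voiRule P T lam D) (noiseInnov P (ξ ω)) k j.succ) 2 μ :=
    memLp_ite hd MemLp.zero'
      (memLp_fun_sub (hξ.memLp_model hθ k j.castSucc) (hξ.memLp_model hθ k j.succ))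
  have hi : Integrable (fun ω =>
      ind (modelDec P.A (voiRule P T lam D) (noiseInnov P (ξ ω)) k j)) μ := by
    simpa only [decision_ruleLaw] using hξ.integrable_ind_decision hθ T k j
  have hq := integrable_dot hf (memLp_mulVec (hopWeight P T k (L - (j : ℕ))) hf)
  have hle := integral_mono (hq.fun_add (hi.const_mul (lam j))) (integrable_const (lam j))
    fun ω => by
      simp only
      cases hb : modelDec P.A (voiRule P T lam D) (noiseInnov P (ξ ω)) k j
      · have h := quad_le_of_voiRule_eq_false P T hlam hb
        simpa only [hb, ind, Bool.false_eq_true, if_false, mul_zero, add_zero] using h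
      · simp [ind]
  rw [integral_add hq (hi.const_mul _), integral_const_mul] at hle
  rw [blockCost]
  refine hle.trans ?_
  simp

/-- The value-of-information policy outperforms the periodic one. -/
theorem IsNoise.lagrangian_voiLaw_le (hξ : IsNoise μ P ξ) (T : ℕ) {lam : Fin L → ℝ}
    (hlam : ∀ j, 0 ≤ lam j) (D : Set (Fin L)) :
    lagrangian μ P T lam (voiLaw P T lam D) ξ ≤
      lagrangian μ P T lam (periodic : Law n L) ξ := by
  obtain ⟨c, hc⟩ := hξ.exists_controlCost_eq T L
  let θ₀ : Rule n L := fun _ _ _ => true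
  have hθ₀ : θ₀.IsMeasurable := fun _ _ => measurable_const
  have hp : (periodic : Law n L) = ruleLaw θ₀ := rfl
  have hθ := isMeasurable_voiRule P T lam D
  rw [voiLaw_eq_ruleLaw, hp, lagrangian, lagrangian, hc _ hθ (isEven_voiRule P T lam D),
    hc θ₀ hθ₀ (fun _ _ _ => rfl)]
  simp_rw [hξ.requestRate_eq hθ, hξ.requestRate_eq hθ₀, Finset.mul_sum]
  rw [Finset.sum_comm (s := Finset.univ), Finset.sum_comm (s := Finset.univ),
    add_assoc, add_assoc, ← Finset.sum_add_distrib, ← Finset.sum_add_distrib]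
  refine add_le_add_right (Finset.sum_le_sum fun k _ => ?_) c
  rw [← Finset.sum_add_distrib, ← Finset.sum_add_distrib]
  -- For the periodic rule nothing is blocked, so its term is exactly `lam j`.
  refine Finset.sum_le_sum fun j _ => (hξ.blockCost_add_le T hlam D k j).trans ?_
  simp [blockCost, modelDec, θ₀, ind]

end Performance

/-! ### The information of the schedulers -/

/-- Events that depend on the innovations in such a way that changing the signs of those unknown to
decision maker `j` at time `k` does not matter if decision maker `i` at time `t` has no more
innovations at its disposal. -/
abbrev signInvariant (A : Matrix (Fin n) (Fin n) ℝ) (θ : Rule n L) (k : ℕ)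
    (j : Fin (L + 1)) (t : ℕ) (i : Fin (L + 1)) : MeasurableSpace (ℕ → Fin n → ℝ) where
  MeasurableSet' E := MeasurableSet E ∧
    ∀ y, fresh (modelDec A θ y) t i ≤ fresh (modelDec A θ y) k j →
      (flipUnknown A θ k j y ∈ E ↔ y ∈ E)
  measurableSet_empty := ⟨.empty, fun _ _ => by simp⟩
  measurableSet_compl E hE := ⟨hE.1.compl, fun y hy => by
    rw [Set.mem_compl_iff, Set.mem_compl_iff, hE.2 y hy]⟩
  measurableSet_iUnion E hE := ⟨.iUnion fun q => (hE q).1, fun y hy => by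
    simp only [Set.mem_iUnion, fun q => (hE q).2 y hy]⟩

lemma measurable_signInvariant {β : Type*} [MeasurableSpace β] {A : Matrix (Fin n) (Fin n) ℝ}
    {θ : Rule n L} {k : ℕ} {j : Fin (L + 1)} {t : ℕ} {i : Fin (L + 1)}
    {f : (ℕ → Fin n → ℝ) → β} (hf : Measurable f)
    (h : ∀ y, fresh (modelDec A θ y) t i ≤ fresh (modelDec A θ y) k j →
      f (flipUnknown A θ k j y) = f y) :
    Measurable[signInvariant A θ k j t i] f :=
  fun _ hE => ⟨hf hE, fun y hy => by rw [Set.mem_preimage, h y hy, Set.mem_preimage]⟩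

section Information

variable {Ω : Type*} {P : Plant n p m} {ξ : Ω → Noise n m}

lemma comap_le_comap_signInvariant {β : Type*} [MeasurableSpace β]
    {A : Matrix (Fin n) (Fin n) ℝ} {θ : Rule n L} {k : ℕ} {j : Fin (L + 1)} {t : ℕ}
    {i : Fin (L + 1)} {Y : Ω → ℕ → Fin n → ℝ} {F : Ω → β} {f : (ℕ → Fin n → ℝ) → β}
    (hF : ∀ ω, F ω = f (Y ω)) (hf : Measurable f)
    (h : ∀ y, fresh (modelDec A θ y) t i ≤ fresh (modelDec A θ y) k j →
      f (flipUnknown A θ k j y) = f y) :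
    MeasurableSpace.comap F inferInstance ≤
      MeasurableSpace.comap Y (signInvariant A θ k j t i) := by
  rw [show F = f ∘ Y from funext hF, ← MeasurableSpace.comap_comp]
  exact MeasurableSpace.comap_mono (measurable_signInvariant hf h).comap_le

lemma control_innovErr (P : Plant n p m) (T : ℕ) (θ : Rule n L) (z : Noise n m) {t M : ℕ}
    (h : t ≤ M) : control P T t (state P T (ruleLaw θ) z t) =
      -(lqrGain P T t *ᵥ (model P.A θ (innovErr P M z) t (Fin.last L) +
        ctrlPart P T (model P.A θ (innovErr P M z)) t)) := by
  rw [control, est_ruleLaw, model_innovErr h, ctrlPart_innovErr (h.trans (Nat.le_succ M))]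

lemma decision_innovErr (P : Plant n p m) (T : ℕ) (θ : Rule n L) (z : Noise n m) {t M : ℕ}
    (h : t ≤ M) (l : Fin L) :
    decision P T (ruleLaw θ) z t l = modelDec P.A θ (innovErr P M z) t l := by
  rw [decision_ruleLaw, modelDec_innovErr h]

/-- The information of a scheduler is insensitive to the signs of the innovations unknown to any
better informed decision maker. -/
theorem infoSet_le_comap (P : Plant n p m) (T : ℕ) (ξ : Ω → Noise n m) {θ : Rule n L}
    (hθ : θ.IsMeasurable) (he : θ.IsEven) {k M : ℕ} (hM : k ≤ M) (j : Fin (L + 1)) (l : ℕ)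
    (h : l < L) {t : ℕ} (ht : t ≤ k) :
    infoSet P T (ruleLaw θ) ξ l h t ≤ MeasurableSpace.comap (fun ω => innovErr P M (ξ ω))
      (signInvariant P.A θ k j t (⟨l, h⟩ : Fin L).castSucc) := by
  -- Controls and decisions are invariant under the reversal without any condition on the freshness
  -- of `i`.
  have hcontrol : ∀ {t : ℕ} (i : Fin (L + 1)), t ≤ k → (⨆ (τ : ℕ) (_ : τ < t),
      MeasurableSpace.comap (fun ω => control P T τ (state P T (ruleLaw θ) (ξ ω) τ))
        inferInstance) ≤ MeasurableSpace.comap (fun ω => innovErr P M (ξ ω))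
          (signInvariant P.A θ k j t i) := by
    intro t i ht
    refine iSup₂_le fun τ hτ => comap_le_comap_signInvariant
      (f := fun y => -(lqrGain P T τ *ᵥ (model P.A θ y τ (Fin.last L) +
        ctrlPart P T (model P.A θ y) τ)))
      (fun ω => control_innovErr P T θ (ξ ω) (M := M) (by omega)) ?_ fun y _ => ?_
    · exact (measurable_mulVec_const _ ((measurable_model hθ _ _).add
        (measurable_ctrlPart P T hθ _))).neg
    · rw [model_last_flipUnknown he (by omega), ctrlPart_flipUnknown he (by omega)]
  have hdecision : ∀ {t : ℕ} (q : Fin L) (i : Fin (L + 1)), t ≤ k → (⨆ (τ : ℕ) (_ : τ < t),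
      MeasurableSpace.comap (fun ω => decision P T (ruleLaw θ) (ξ ω) τ q) inferInstance) ≤
        MeasurableSpace.comap (fun ω => innovErr P M (ξ ω)) (signInvariant P.A θ k j t i) := by
    intro t q i ht
    exact iSup₂_le fun τ hτ => comap_le_comap_signInvariant
      (fun ω => decision_innovErr P T θ (ξ ω) (M := M) (by omega) q) (measurable_modelDec hθ _ _)
      fun y _ => congrFun (modelDec_flipUnknown he y (by omega)) q
  induction l generalizing t with
  | zero =>
    rw [infoSet]
    refine sup_le (sup_le (iSup₂_le fun τ hτ => ?_) (hcontrol _ ht)) (hdecision _ _ ht)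
    refine comap_le_comap_signInvariant (f := fun y => model P.A θ y τ 0 +
        ctrlPart P T (model P.A θ y) τ) (fun ω => ?_)
      ((measurable_model hθ _ _).add (measurable_ctrlPart P T hθ _)) fun y hy => ?_
    · rw [est_ruleLaw, model_innovErr (by omega), ctrlPart_innovErr (by omega)]
    · have hy' : t + 1 ≤ fresh (modelDec P.A θ y) k j := by
        refine le_trans ?_ hy
        exact (fresh_zero_right _ t).ge
      rw [ctrlPart_flipUnknown he (by omega), model_flipUnknown_of_le he y (by omega)]
      rw [fresh_zero_right]
      omega
  | succ l ih =>
    rw [infoSet]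
    refine sup_le (sup_le ?_ (hcontrol _ ht)) (hdecision _ _ ht)
    refine MeasurableSpace.generateFrom_le ?_
    rintro _ ⟨τ, hτ, E, hE, rfl⟩
    obtain ⟨E', hE', rfl⟩ := ih (Nat.lt_of_succ_lt h) (by omega : τ ≤ k) E hE
    refine ⟨E' ∩ {y | modelDec P.A θ y τ ⟨l, Nat.lt_of_succ_lt h⟩ = true}, ⟨hE'.1.inter
      (measurable_modelDec hθ _ _ (measurableSet_singleton true)), fun y hy => ?_⟩, ?_⟩
    · rw [Set.mem_inter_iff, Set.mem_inter_iff, Set.mem_ofPred_eq, Set.mem_ofPred_eq,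
        modelDec_flipUnknown he y (by omega)]
      refine and_congr_left fun hd => hE'.2 y ?_
      -- On a transmission the receiver at time `τ + 1` inherits the sender's freshness. The
      -- comparison with `j` thus passes from the receiver back to the sender, where the induction
      -- hypothesis applies.
      have h1 : fresh (modelDec P.A θ y) (τ + 1) (⟨l, Nat.lt_of_succ_lt h⟩ : Fin L).succ =
          fresh (modelDec P.A θ y) τ (⟨l, Nat.lt_of_succ_lt h⟩ : Fin L).castSucc := by
        rw [fresh_succ_succ, if_pos hd]
      rw [← h1]
      exact (fresh_mono _ (by omega) _).trans hy
    · ext ω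
      simp only [Set.preimage_inter, Set.mem_inter_iff, Set.mem_preimage, Set.mem_ofPred_eq]
      rw [decision_innovErr P T θ (ξ ω) (by omega : τ ≤ M)]

/-- In this form the sender's estimate occurs only on the event of a transmission, which is where
the receiver's information contains it. -/
lemma est_succ_succ (P : Plant n p m) (T : ℕ) (π : Law n L) (z : Noise n m) (k : ℕ) (j : Fin L) :
    (state P T π z (k + 1)).est j.succ =
      P.A *ᵥ (if decision P T π z k j then (state P T π z k).est j.castSucc else 0) +
        P.A *ᵥ (if decision P T π z k j then 0 else (state P T π z k).est j.succ) +
          P.B *ᵥ control P T k (state P T π z k) := by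
  change (if decision P T π z k j then predict P T k (state P T π z k) j.castSucc
        else predict P T k (state P T π z k) j.succ) = _
  split_ifs <;> simp [predict]

lemma measurable_est_succ [mΩ : MeasurableSpace Ω] (P : Plant n p m) (T : ℕ) (π : Law n L)
    (ξ : Ω → Noise n m) (k : ℕ) (j : Fin L)
    (hu : ∀ t < k, Measurable fun ω => control P T t (state P T π (ξ ω) t))
    (hd : ∀ t < k, Measurable fun ω => decision P T π (ξ ω) t j)
    (hs : ∀ t < k, Measurable fun ω =>
      if decision P T π (ξ ω) t j then (state P T π (ξ ω) t).est j.castSucc else 0) :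
    ∀ t ≤ k, Measurable fun ω => (state P T π (ξ ω) t).est j.succ := by
  intro t ht
  induction t with
  | zero => exact measurable_const
  | succ t ih =>
    simp_rw [est_succ_succ]
    exact ((measurable_mulVec_const _ (hs t ht)).add (measurable_mulVec_const _
      (Measurable.ite (hd t ht (measurableSet_singleton true)) measurable_const
        (ih (by omega))))).add (measurable_mulVec_const _ (hu t ht))

lemma measurable_control_infoSet (P : Plant n p m) (T : ℕ) (π : Law n L) (ξ : Ω → Noise n m)
    (l : ℕ) (h : l < L) {k t : ℕ} (ht : t < k) :
    Measurable[infoSet P T π ξ l h k] fun ω => control P T t (state P T π (ξ ω) t) := by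
  have h1 : MeasurableSpace.comap (fun ω => control P T t (state P T π (ξ ω) t)) inferInstance ≤
      ⨆ (t : ℕ) (_ : t < k), MeasurableSpace.comap
        (fun ω => control P T t (state P T π (ξ ω) t)) inferInstance :=
    le_iSup₂_of_le t ht le_rfl
  rw [measurable_iff_comap_le]
  cases l <;> rw [infoSet] <;> exact h1.trans (le_sup_right.trans le_sup_left)

lemma measurable_decision_infoSet (P : Plant n p m) (T : ℕ) (π : Law n L) (ξ : Ω → Noise n m)
    (l : ℕ) (h : l < L) {k t : ℕ} (ht : t < k) :
    Measurable[infoSet P T π ξ l h k] fun ω => decision P T π (ξ ω) t ⟨l, h⟩ := by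
  have h1 : MeasurableSpace.comap (fun ω => decision P T π (ξ ω) t ⟨l, h⟩) inferInstance ≤
      ⨆ (t : ℕ) (_ : t < k), MeasurableSpace.comap
        (fun ω => decision P T π (ξ ω) t ⟨l, h⟩) inferInstance :=
    le_iSup₂_of_le t ht le_rfl
  rw [measurable_iff_comap_le]
  cases l <;> rw [infoSet] <;> exact h1.trans le_sup_right

/-- By induction along the hops, the generating sets reveal the predecessor's decisions (take `E` to
be the whole space) and its estimates restricted to transmission times. With the controls, these
determine the receiver's estimate recursively. -/
lemma measurable_est_infoSet (P : Plant n p m) (T : ℕ) (π : Law n L) (ξ : Ω → Noise n m)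
    (l : ℕ) (h : l < L) (k : ℕ) : ∀ t ≤ k, Measurable[infoSet P T π ξ l h k]
      fun ω => (state P T π (ξ ω) t).est (⟨l, h⟩ : Fin L).castSucc := by
  induction l generalizing k with
  | zero =>
    intro t ht
    rw [measurable_iff_comap_le, infoSet]
    exact le_sup_of_le_left (le_sup_of_le_left (le_iSup₂_of_le t ht le_rfl))
  | succ l ih =>
    set l' : Fin L := ⟨l, Nat.lt_of_succ_lt h⟩ with hl'
    have hgen : ∀ t < k, ∀ E : Set Ω, MeasurableSet[infoSet P T π ξ l (Nat.lt_of_succ_lt h) t] E →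
        MeasurableSet[infoSet P T π ξ (l + 1) h k]
          {ω | ω ∈ E ∧ decision P T π (ξ ω) t l' = true} := by
      intro t ht E hE
      rw [infoSet]
      exact MeasurableSpace.le_def.1 (le_sup_left.trans le_sup_left) _
        (MeasurableSpace.measurableSet_generateFrom ⟨t, ht, E, hE, rfl⟩)
    let _ : MeasurableSpace Ω := infoSet P T π ξ (l + 1) h k
    have hd : ∀ t < k, MeasurableSet {ω | decision P T π (ξ ω) t l' = true} := by
      intro t ht
      simpa using hgen t ht Set.univ MeasurableSet.univ
    refine measurable_est_succ P T π ξ k l'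
      (fun t ht => measurable_control_infoSet P T π ξ (l + 1) h ht)
      (fun t ht => measurable_to_bool (hd t ht)) fun t ht S hS => ?_
    have h1 := hgen t ht _ (ih (Nat.lt_of_succ_lt h) t t le_rfl hS)
    have h2 : MeasurableSet {ω : Ω | (0 : Fin n → ℝ) ∈ S} := MeasurableSet.const _
    convert h1.union (h2.inter (hd t ht).compl) using 1
    ext ω
    by_cases hb : decision P T π (ξ ω) t ⟨l, Nat.lt_of_succ_lt h⟩ = true <;> simp [hb, hl']

/-- The mismatch error of a scheduler is part of its information. -/
lemma measurable_mismatch_infoSet (P : Plant n p m) (T : ℕ) (π : Law n L) (ξ : Ω → Noise n m)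
    (j : Fin L) (k : ℕ) : Measurable[infoSet P T π ξ (j : ℕ) j.isLt k]
      fun ω => mismatch (state P T π (ξ ω) k) j := by
  have hest := measurable_est_infoSet P T π ξ (j : ℕ) j.isLt k
  have hdec : ∀ t < k, _ := fun t ht => measurable_decision_infoSet P T π ξ (j : ℕ) j.isLt ht
  have hu : ∀ t < k, _ := fun t ht => measurable_control_infoSet P T π ξ (j : ℕ) j.isLt ht
  let _ : MeasurableSpace Ω := infoSet P T π ξ (j : ℕ) j.isLt k
  refine (hest k le_rfl).sub (measurable_est_succ P T π ξ k j hu hdec (fun t ht => ?_) k le_rfl)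
  exact Measurable.ite (hdec t ht (measurableSet_singleton true)) (hest t ht.le) measurable_const

end Information

/-! ### Rollouts -/

/-- The rule of the rollout of `θ` at scheduler `j` and time `k`. -/
def rolloutRule (θ : Rule n L) (k : ℕ) (j : Fin L) (a : Bool) : Rule n L := fun t l e =>
  if t < k then θ t l e
  else if t = k then (if l < j then θ k l e else if l = j then a else true)
  else true

lemma rollout_ruleLaw (θ : Rule n L) (k : ℕ) (j : Fin L) (a : Bool) :
    rollout (ruleLaw θ) k j a = ruleLaw (rolloutRule θ k j a) := rfl

lemma isMeasurable_rolloutRule {θ : Rule n L} (hθ : θ.IsMeasurable) (k : ℕ) (j : Fin L)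
    (a : Bool) : (rolloutRule θ k j a).IsMeasurable := by
  intro t l
  unfold rolloutRule
  split_ifs
  exacts [hθ t l, hθ k l, measurable_const, measurable_const, measurable_const]

section Rollout

variable (A : Matrix (Fin n) (Fin n) ℝ) (θ : Rule n L) (y : ℕ → Fin n → ℝ) (k : ℕ) (j : Fin L)
  (a : Bool)

lemma model_rolloutRule_of_le {t : ℕ} (ht : t ≤ k) :
    model A (rolloutRule θ k j a) y t = model A θ y t := by
  induction t with
  | zero => rfl
  | succ t ih =>
    rw [model, model, ih (by omega)]
    congr 1
    funext l
    have : ∀ e, rolloutRule θ k j a t l e = θ t l e := fun e => by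
      rw [rolloutRule, if_pos (by omega)]
    rw [this]

lemma modelDec_rolloutRule_self : modelDec A (rolloutRule θ k j a) y k j = a := by
  simp [modelDec, rolloutRule]

lemma modelDec_rolloutRule_of_lt {l : Fin L} (hl : l < j) :
    modelDec A (rolloutRule θ k j a) y k l = modelDec A θ y k l := by
  rw [modelDec, modelDec, model_rolloutRule_of_le A θ y k j a le_rfl, rolloutRule,
    if_neg (lt_irrefl k), if_pos rfl, if_pos hl]

lemma modelDec_rolloutRule_of_gt {l : Fin L} (hl : j < l) :
    modelDec A (rolloutRule θ k j a) y k l = true := by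
  simp [modelDec, rolloutRule, hl.not_gt, hl.ne']

lemma modelDec_rolloutRule_later {t : ℕ} (ht : k < t) (l : Fin L) :
    modelDec A (rolloutRule θ k j a) y t l = true := by
  simp [modelDec, rolloutRule, ht.not_gt, ht.ne']

/-- If all schedulers transmit, then the estimates travel through the loop. -/
lemma model_rolloutRule_shift (s : ℕ) (i i' : Fin (L + 1)) (h : (i' : ℕ) = i + s) :
    model A (rolloutRule θ k j a) y (k + 1 + s) i' =
      A ^ s *ᵥ model A (rolloutRule θ k j a) y (k + 1) i := by
  induction s generalizing i' with
  | zero =>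
    obtain rfl : i' = i := Fin.ext h
    simp
  | succ s ih =>
    obtain ⟨l, rfl⟩ : ∃ l : Fin L, i' = l.succ :=
      Fin.exists_succ_eq.2 (fun h0 => by simp [h0] at h) |>.imp fun _ => Eq.symm
    rw [← add_assoc, model_succ_succ, modelDec_rolloutRule_later A θ y k j a (by omega), if_pos rfl,
      ih l.castSucc (by simp at h ⊢; omega), mulVec_mulVec, ← pow_succ']

/-- The first step of a rollout. -/
lemma model_rolloutRule_castSucc :
    model A (rolloutRule θ k j a) y (k + 1) j.castSucc = model A θ y (k + 1) j.castSucc := by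
  obtain h | ⟨l, h⟩ := Fin.eq_zero_or_eq_succ j.castSucc
  · rw [h, model_succ_zero, model_succ_zero, model_rolloutRule_of_le A θ y k j a le_rfl]
  · have hl : l < j := by
      have := congrArg Fin.val h
      simp at this
      exact Fin.lt_def.2 (by omega)
    rw [h, model_succ_succ, model_succ_succ, modelDec_rolloutRule_of_lt A θ y k j a hl,
      model_rolloutRule_of_le A θ y k j a le_rfl]

lemma model_rolloutRule_succ : model A (rolloutRule θ k j a) y (k + 1) j.succ =
    A *ᵥ (if a then model A θ y k j.castSucc else model A θ y k j.succ) := by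
  rw [model_succ_succ, modelDec_rolloutRule_self, model_rolloutRule_of_le A θ y k j a le_rfl]

lemma model_rolloutRule_of_gt {l : Fin L} (hl : j < l) :
    model A (rolloutRule θ k j a) y (k + 1) l.succ = A *ᵥ model A θ y k l.castSucc := by
  rw [model_succ_succ, modelDec_rolloutRule_of_gt A θ y k j a hl, if_pos rfl,
    model_rolloutRule_of_le A θ y k j a le_rfl]

/-- The decision at scheduler `j` affects the estimate of only one decision maker at a time. -/
lemma model_rolloutRule_congr (s : ℕ) (i : Fin (L + 1)) (h : (i : ℕ) ≠ j + 1 + s) :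
    model A (rolloutRule θ k j true) y (k + 1 + s) i =
      model A (rolloutRule θ k j false) y (k + 1 + s) i := by
  induction s generalizing i with
  | zero =>
    induction i using Fin.cases with
    | zero =>
      rw [add_zero, model_succ_zero, model_succ_zero, model_rolloutRule_of_le A θ y k j _ le_rfl,
        model_rolloutRule_of_le A θ y k j _ le_rfl]
    | succ l =>
      have hl : l ≠ j := fun e => h (by simp [e])
      rw [add_zero, model_succ_succ, model_succ_succ, model_rolloutRule_of_le A θ y k j _ le_rfl,
        model_rolloutRule_of_le A θ y k j _ le_rfl]
      rcases lt_or_gt_of_ne hl with h' | h'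
      · rw [modelDec_rolloutRule_of_lt A θ y k j _ h', modelDec_rolloutRule_of_lt A θ y k j _ h']
      · rw [modelDec_rolloutRule_of_gt A θ y k j _ h', modelDec_rolloutRule_of_gt A θ y k j _ h']
  | succ s ih =>
    induction i using Fin.cases with
    | zero => rw [← add_assoc, model_succ_zero, model_succ_zero, ih 0 (by simp; omega)]
    | succ l =>
      rw [← add_assoc, model_succ_succ, model_succ_succ,
        modelDec_rolloutRule_later A θ y k j _ (by omega),
        modelDec_rolloutRule_later A θ y k j _ (by omega), if_pos rfl, if_pos rfl,
        ih l.castSucc (by simp at h ⊢; omega)]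

/-- What decision maker `j` learns between the times `k` and `k + 1`. -/
def update : Fin n → ℝ := model A θ y (k + 1) j.castSucc - A *ᵥ model A θ y k j.castSucc

/-- The mismatch error at scheduler `j`. -/
def modelMismatch : Fin n → ℝ := model A θ y k j.castSucc - model A θ y k j.succ

variable {l : Fin L} {s : ℕ}

lemma rollout_mismatch_true (hl : (l : ℕ) = j + s) :
    model A (rolloutRule θ k j true) y (k + 1 + s) l.castSucc -
      model A (rolloutRule θ k j true) y (k + 1 + s) l.succ = A ^ s *ᵥ update A θ y k j := by
  rw [model_rolloutRule_shift A θ y k j true s j.castSucc l.castSucc (by simpa using hl),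
    model_rolloutRule_shift A θ y k j true s j.succ l.succ (by simp [hl]; omega),
    model_rolloutRule_castSucc, model_rolloutRule_succ, if_pos rfl, ← mulVec_sub, update]

lemma rollout_mismatch_false (hl : (l : ℕ) = j + s) :
    model A (rolloutRule θ k j false) y (k + 1 + s) l.castSucc -
      model A (rolloutRule θ k j false) y (k + 1 + s) l.succ =
        A ^ s *ᵥ update A θ y k j + A ^ (s + 1) *ᵥ modelMismatch A θ y k j := by
  rw [model_rolloutRule_shift A θ y k j false s j.castSucc l.castSucc (by simpa using hl),
    model_rolloutRule_shift A θ y k j false s j.succ l.succ (by simp [hl]; omega),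
    model_rolloutRule_castSucc, model_rolloutRule_succ, update, modelMismatch, pow_succ,
    ← mulVec_mulVec]
  simp only [Bool.false_eq_true, if_false, mulVec_sub]
  abel

lemma rollout_mismatch_next (hl : (l : ℕ) = j + s) {q : Fin L} (hq : (q : ℕ) = l + 1) :
    model A (rolloutRule θ k j a) y (k + 1 + s) q.castSucc -
      model A (rolloutRule θ k j a) y (k + 1 + s) q.succ =
        if a then A ^ (s + 1) *ᵥ modelMismatch A θ y k j else 0 := by
  have hj : (j : ℕ) + 1 < L := by have := q.isLt; omega
  rw [model_rolloutRule_shift A θ y k j a s j.succ q.castSucc (by simp; omega),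
    model_rolloutRule_shift A θ y k j a s (⟨j + 1, hj⟩ : Fin L).succ q.succ (by simp; omega),
    model_rolloutRule_succ, model_rolloutRule_of_gt A θ y k j a (Fin.lt_def.2 (by simp)),
    ← mulVec_sub, ← mulVec_sub, show (⟨j + 1, hj⟩ : Fin L).castSucc = j.succ from rfl, mulVec_mulVec,
    ← pow_succ, modelMismatch]
  cases a <;> simp

end Rollout

/-- A single perturbed estimate occurs in just two neighbouring mismatches, so only the summands `l`
and `l + 1` of a hop cost can differ between the two rollouts. -/
lemma sum_ge_eq_of_support {l : Fin L} {g : Fin L → ℝ}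
    (hg : ∀ q : Fin L, (l : ℕ) + 1 < q → g q = 0) :
    ∑ q ∈ Finset.univ.filter (fun q : Fin L => l ≤ q), g q =
      g l + if h : (l : ℕ) + 1 < L then g ⟨l + 1, h⟩ else 0 := by
  split_ifs with h
  · have hne : l ≠ ⟨l + 1, h⟩ := fun e => by simpa using congrArg Fin.val e
    rw [← Finset.sum_pair hne]
    symm
    apply Finset.sum_subset
    · intro q hq
      simp only [Finset.mem_insert, Finset.mem_singleton] at hq
      refine Finset.mem_filter.2 ⟨Finset.mem_univ _, Fin.le_def.2 ?_⟩
      rcases hq with rfl | rfl <;> simp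
    · intro q hq hq'
      apply hg q
      simp only [Finset.mem_insert, Finset.mem_singleton, not_or, Fin.ext_iff] at hq'
      simp only [Finset.mem_filter, Finset.mem_univ, true_and, Fin.le_def] at hq
      omega
  · rw [add_zero]
    apply Finset.sum_eq_single_of_mem l (by simp)
    intro q hq hne
    simp only [Finset.mem_filter, Finset.mem_univ, true_and, Fin.le_def] at hq
    rw [Ne, Fin.ext_iff] at hne
    have := q.isLt
    omega

/-- The part of the difference of two rollouts which vanishes on average. -/
def rolloutCross (P : Plant n p m) (T : ℕ) (θ : Rule n L) (k : ℕ) (j : Fin L)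
    (y : ℕ → Fin n → ℝ) : ℝ :=
  2 * (y (k + (L - (j : ℕ)) + 1) ⬝ᵥ (Gam P T (k + (L - (j : ℕ))) *ᵥ
      (P.A ^ (L - (j : ℕ)) *ᵥ modelMismatch P.A θ y k j))) -
    ∑ l ∈ Finset.univ.filter (fun l : Fin L => j ≤ l),
      (P.A ^ ((l : ℕ) - j) *ᵥ update P.A θ y k j) ⬝ᵥ
        ((Gam P T (k + 1 + ((l : ℕ) - j)) + (Gam P T (k + 1 + ((l : ℕ) - j)))ᵀ) *ᵥ
          (P.A ^ ((l : ℕ) - j + 1) *ᵥ modelMismatch P.A θ y k j))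

/-- With a transmission the neighbouring mismatches are `α` and `β`; when blocked they are `α + β`
and `0`. The terms linear in the filter error agree and the quadratic ones differ by the cross term
alone. At the last hop there is no successor to carry `β`, so its terms survive. -/
lemma hopCost_rollout_sub (P : Plant n p m) (T : ℕ) (lam : Fin L → ℝ) (θ : Rule n L)
    (z : Noise n m) (k : ℕ) (j l : Fin L) {s : ℕ} (hl : (l : ℕ) = j + s) :
    hopCost P T lam (rollout (ruleLaw θ) k j true) z (k + s) l -
      hopCost P T lam (rollout (ruleLaw θ) k j false) z (k + s) l =
    (if l = j then lam l else 0) -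
      (P.A ^ s *ᵥ update P.A θ (noiseInnov P z) k j) ⬝ᵥ
        ((Gam P T (k + 1 + s) + (Gam P T (k + 1 + s))ᵀ) *ᵥ
          (P.A ^ (s + 1) *ᵥ modelMismatch P.A θ (noiseInnov P z) k j)) +
      if (l : ℕ) + 1 = L then 2 * (noiseErr P z (k + 1 + s) ⬝ᵥ (Gam P T (k + 1 + s) *ᵥ
          (P.A ^ (s + 1) *ᵥ modelMismatch P.A θ (noiseInnov P z) k j))) -
        (P.A ^ (s + 1) *ᵥ modelMismatch P.A θ (noiseInnov P z) k j) ⬝ᵥ (Gam P T (k + 1 + s) *ᵥ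
          (P.A ^ (s + 1) *ᵥ modelMismatch P.A θ (noiseInnov P z) k j)) else 0 := by
  have hdec : ∀ a, decision P T (ruleLaw (rolloutRule θ k j a)) z (k + s) l =
      if l = j then a else true := by
    intro a
    rw [decision_ruleLaw]
    split_ifs with h
    · obtain rfl : s = 0 := by rw [h] at hl; omega
      rw [h, add_zero, modelDec_rolloutRule_self]
    · have : (l : ℕ) ≠ j := fun e => h (Fin.ext e)
      exact modelDec_rolloutRule_later _ _ _ _ _ _ (by omega) _
  have hind : lam l * ind (if l = j then true else true) -
      lam l * ind (if l = j then false else true) = if l = j then lam l else 0 := by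
    split_ifs <;> simp [ind]
  rw [rollout_ruleLaw, rollout_ruleLaw, hopCost, hopCost, hdec, hdec, add_sub_add_comm, hind,
    ← Finset.sum_sub_distrib, show k + s + 1 = k + 1 + s by omega]
  simp only [errFirst_state, mismatch_ruleLaw]
  rw [sum_ge_eq_of_support (l := l) fun q hq => by
    rw [model_rolloutRule_congr P.A θ (noiseInnov P z) k j s q.castSucc (by simp; omega),
      model_rolloutRule_congr P.A θ (noiseInnov P z) k j s q.succ (by simp; omega), sub_self]]
  rw [rollout_mismatch_true P.A θ _ k j hl, rollout_mismatch_false P.A θ _ k j hl]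
  set α := P.A ^ s *ᵥ update P.A θ (noiseInnov P z) k j
  set β := P.A ^ (s + 1) *ᵥ modelMismatch P.A θ (noiseInnov P z) k j with hβ
  set G := Gam P T (k + 1 + s)
  set e := noiseErr P z (k + 1 + s)
  have hαβ := quad_add G α β
  have hlin : e ⬝ᵥ (G *ᵥ (α + β)) = e ⬝ᵥ (G *ᵥ α) + e ⬝ᵥ (G *ᵥ β) := by
    rw [mulVec_add, dotProduct_add]
  by_cases h : (l : ℕ) + 1 < L
  · rw [dif_pos h, if_neg h.ne, rollout_mismatch_next P.A θ _ k j true hl (by simp),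
      rollout_mismatch_next P.A θ _ k j false hl (by simp), if_pos rfl, ← hβ]
    simp only [Bool.false_eq_true, if_false, mulVec_zero, dotProduct_zero, mul_zero, add_zero]
    linarith
  · rw [dif_neg h, if_pos (show (l : ℕ) + 1 = L by have := l.isLt; omega)]
    linarith

theorem costToGo_rollout_sub (P : Plant n p m) (T : ℕ) (lam : Fin L → ℝ) (θ : Rule n L)
    (z : Noise n m) {k : ℕ} {j : Fin L} (hk : k + (L - (j : ℕ)) ≤ T) :
    costToGo P T lam (rollout (ruleLaw θ) k j true) z k j -
      costToGo P T lam (rollout (ruleLaw θ) k j false) z k j =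
    dVoI P T lam k j (mismatch (state P T (ruleLaw θ) z k) j) +
      rolloutCross P T θ k j (innovErr P (k + (L - (j : ℕ))) z) := by
  have hj := j.isLt
  -- Before the deadline all hops up to the controller fit into the horizon, the last of them at
  -- time `k + (L - 1 - j) < T`.
  have hfilter : Finset.univ.filter (fun l : Fin L => j ≤ l ∧ k + ((l : ℕ) - (j : ℕ)) < T) =
      Finset.univ.filter (fun l : Fin L => j ≤ l) := by
    ext l
    have := l.isLt
    simp only [Finset.mem_filter, Finset.mem_univ, true_and, Fin.le_def]
    omega
  have hmod : modelMismatch P.A θ (innovErr P (k + (L - (j : ℕ))) z) k j =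
      modelMismatch P.A θ (noiseInnov P z) k j := by
    rw [modelMismatch, model_innovErr (by omega), modelMismatch]
  have hupd : update P.A θ (innovErr P (k + (L - (j : ℕ))) z) k j =
      update P.A θ (noiseInnov P z) k j := by
    rw [update, model_innovErr (by omega), model_innovErr (by omega), update]
  rw [costToGo, costToGo, hfilter, ← Finset.sum_sub_distrib]
  rw [Finset.sum_congr rfl fun l hl => hopCost_rollout_sub P T lam θ z k j l (s := (l : ℕ) - j)
      (by have := Fin.le_def.1 (Finset.mem_filter.1 hl).2; omega),
    Finset.sum_add_distrib, Finset.sum_sub_distrib]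
  have hlam : ∑ l ∈ Finset.univ.filter (fun l : Fin L => j ≤ l), (if l = j then lam l else 0) =
      lam j := by
    rw [Finset.sum_ite_eq' _ j]
    simp
  -- Only the last scheduler contributes to the final sum; its cost is weighted by `Gam` at the
  -- arrival time `k + (L - j)`.
  have hL : L - 1 < L := by omega
  rw [hlam, Finset.sum_eq_single_of_mem (⟨L - 1, hL⟩ : Fin L)
    (Finset.mem_filter.2 ⟨Finset.mem_univ _, Fin.le_def.2 (Nat.le_sub_one_of_lt hj)⟩)
    fun l _ hne => if_neg fun h => hne (Fin.ext (by simp; omega)),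
    if_pos (by simp; omega), rolloutCross, hmod, hupd, innovErr_last, mismatch_ruleLaw, dVoI_eq,
    ← modelMismatch, hopWeight]
  simp only
  rw [show k + 1 + (L - 1 - (j : ℕ)) = k + (L - (j : ℕ)) by omega,
    show L - 1 - (j : ℕ) + 1 = L - (j : ℕ) by omega]
  have hq : modelMismatch P.A θ (noiseInnov P z) k j ⬝ᵥ
      (((P.A ^ (L - (j : ℕ)))ᵀ * Gam P T (k + (L - (j : ℕ))) * P.A ^ (L - (j : ℕ))) *ᵥ
        modelMismatch P.A θ (noiseInnov P z) k j) =
      (P.A ^ (L - (j : ℕ)) *ᵥ modelMismatch P.A θ (noiseInnov P z) k j) ⬝ᵥ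
        (Gam P T (k + (L - (j : ℕ))) *ᵥ
          (P.A ^ (L - (j : ℕ)) *ᵥ modelMismatch P.A θ (noiseInnov P z) k j)) := by
    rw [mulVec_dot, mulVec_mulVec, mulVec_mulVec, Matrix.mul_assoc]
  rw [hq]
  ring

lemma measurable_rolloutCross (P : Plant n p m) (T : ℕ) {θ : Rule n L} (hθ : θ.IsMeasurable)
    (k : ℕ) (j : Fin L) : Measurable (rolloutCross P T θ k j) := by
  have h1 : Measurable fun y => modelMismatch P.A θ y k j :=
    (measurable_model hθ _ _).sub (measurable_model hθ _ _)
  have h2 : Measurable fun y => update P.A θ y k j :=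
    (measurable_model hθ _ _).sub (measurable_mulVec_const _ (measurable_model hθ _ _))
  exact ((measurable_dot (measurable_pi_apply _) (measurable_mulVec_const _
      (measurable_mulVec_const _ h1))).const_mul 2).sub
    (Finset.measurable_sum _ fun l _ => measurable_dot (measurable_mulVec_const _ h2)
      (measurable_mulVec_const _ (measurable_mulVec_const _ h1)))

/-- The mismatch is known to the sender and stays. Every summand pairs it with either the filter
error at arrival or the sender's next update, both of which are negated. -/
lemma rolloutCross_flipUnknown (P : Plant n p m) (T : ℕ) {θ : Rule n L} (he : θ.IsEven)
    (k : ℕ) (j : Fin L) (y : ℕ → Fin n → ℝ) :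
    rolloutCross P T θ k j (flipUnknown P.A θ k j.castSucc y) = -rolloutCross P T θ k j y := by
  have h1 : modelMismatch P.A θ (flipUnknown P.A θ k j.castSucc y) k j =
      modelMismatch P.A θ y k j := by
    rw [modelMismatch, model_flipUnknown_of_ge_index he y le_rfl,
      model_flipUnknown_of_ge_index he y (Fin.castSucc_lt_succ (i := j)).le, modelMismatch]
  have h2 : update P.A θ (flipUnknown P.A θ k j.castSucc y) k j = -update P.A θ y k j := by
    rw [update, model_succ_sub_flipUnknown he y, update]
  rw [rolloutCross, h1, h2, flipUnknown_of_gt y (by omega), rolloutCross]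
  simp only [neg_dotProduct, mulVec_neg, Finset.sum_neg_distrib]
  ring

/-- If `f - g` is the sum of a `J`-measurable function and a function whose integrals over `J`-sets
vanish, then the former is the difference of the conditional expectations of `f` and `g`. -/
lemma condExp_sub_ae_eq {Ω : Type*} {J mΩ : MeasurableSpace Ω} {μ : Measure Ω} [IsFiniteMeasure μ]
    {f g d c : Ω → ℝ} (hJ : J ≤ mΩ) (hf : Integrable f μ) (hg : Integrable g μ)
    (hd : Integrable d μ) (hdm : Measurable[J] d) (hsub : f - g = d + c)
    (hc : ∀ E, MeasurableSet[J] E → ∫ ω in E, c ω ∂μ = 0) : μ[f | J] - μ[g | J] =ᵐ[μ] d := by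
  have hci : Integrable c μ := by
    have := (hf.sub hg).sub hd
    rwa [hsub, add_sub_cancel_left] at this
  have hzero : (0 : Ω → ℝ) =ᵐ[μ] μ[c | J] := by
    refine ae_eq_condExp_of_forall_setIntegral_eq hJ hci
      (fun _ _ _ => integrableOn_zero) (fun E hE _ => ?_) aestronglyMeasurable_zero
    rw [hc E hE]
    exact integral_zero _ _
  calc _ =ᵐ[μ] μ[f - g | J] := (condExp_sub hf hg J).symm
    _ =ᵐ[μ] μ[d | J] + μ[c | J] := by
        rw [hsub]
        exact condExp_add hd hci J
    _ =ᵐ[μ] _ := by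
        rw [condExp_of_stronglyMeasurable hJ hdm.stronglyMeasurable hd]
        filter_upwards [hzero] with ω hω
        rw [Pi.add_apply, ← hω, Pi.zero_apply, add_zero]

/-! ### Conditional expectation of the rollout difference -/

section Rollout

variable {Ω : Type*} [mΩ : MeasurableSpace Ω] {μ : Measure Ω} {P : Plant n p m}
  {ξ : Ω → Noise n m}

lemma IsNoise.infoSet_le (hξ : IsNoise μ P ξ) {θ : Rule n L} (hθ : θ.IsMeasurable)
    (he : θ.IsEven) (T : ℕ) (j : Fin L) (k : ℕ) :
    infoSet P T (ruleLaw θ) ξ (j : ℕ) j.isLt k ≤ mΩ := by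
  intro E hE
  obtain ⟨E', hE', rfl⟩ :=
    infoSet_le_comap P T ξ hθ he (le_refl k) j.castSucc (j : ℕ) j.isLt le_rfl E hE
  exact hξ.measurable_innovErr k hE'.1

/-- The difference between transmission and no transmission is, on average given the information of
the scheduler, the closed form of the value of information. -/
theorem IsNoise.condExp_rollout_sub [IsFiniteMeasure μ] (hξ : IsNoise μ P ξ) {θ : Rule n L}
    (hθ : θ.IsMeasurable) (he : θ.IsEven) (T : ℕ) (lam : Fin L → ℝ) (j : Fin L) {k : ℕ}
    (hk : k + (L - (j : ℕ)) ≤ T) :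
    μ[fun ω => costToGo P T lam (rollout (ruleLaw θ) k j true) (ξ ω) k j |
        infoSet P T (ruleLaw θ) ξ (j : ℕ) j.isLt k] -
      μ[fun ω => costToGo P T lam (rollout (ruleLaw θ) k j false) (ξ ω) k j |
        infoSet P T (ruleLaw θ) ξ (j : ℕ) j.isLt k]
      =ᵐ[μ] fun ω => dVoI P T lam k j (mismatch (state P T (ruleLaw θ) (ξ ω) k) j) := by
  have hmis := hξ.memLp_mismatch hθ T k j
  have hint : ∀ a, Integrable
      (fun ω => costToGo P T lam (rollout (ruleLaw θ) k j a) (ξ ω) k j) μ := fun a => by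
    simpa only [rollout_ruleLaw] using
      hξ.integrable_costToGo (isMeasurable_rolloutRule hθ k j a) T lam k j
  have hdV : Integrable
      (fun ω => dVoI P T lam k j (mismatch (state P T (ruleLaw θ) (ξ ω) k) j)) μ :=
    (integrable_const _).sub (integrable_dot hmis (memLp_mulVec _ hmis))
  refine condExp_sub_ae_eq (c := fun ω => rolloutCross P T θ k j
    (innovErr P (k + (L - (j : ℕ))) (ξ ω))) (hξ.infoSet_le hθ he T j k) (hint true) (hint false) hdV
    ((measurable_dVoI P T lam k j).comp (measurable_mismatch_infoSet P T (ruleLaw θ) ξ j k))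
    (funext fun ω => costToGo_rollout_sub P T lam θ (ξ ω) hk) fun E hE => ?_
  rw [← integral_indicator (hξ.infoSet_le hθ he T j k _ hE)]
  obtain ⟨E', hE', rfl⟩ := infoSet_le_comap P T ξ hθ he
    (show k ≤ k + (L - (j : ℕ)) by omega) j.castSucc (j : ℕ) j.isLt le_rfl E hE
  -- `M = k + (L - j)` makes the last coordinate the filter error at the arrival time. Multiplying
  -- the odd remainder by the indicator of an invariant event leaves it odd.
  exact hξ.integral_eq_zero_of_odd (A := P.A) hθ he (k + (L - (j : ℕ))) k j.castSucc
    (g := E'.indicator (rolloutCross P T θ k j))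
    ((measurable_rolloutCross P T hθ k j).indicator hE'.1) (fun y => by
      by_cases hy : y ∈ E'
      · rw [Set.indicator_of_mem hy, Set.indicator_of_mem ((hE'.2 y le_rfl).2 hy),
          rolloutCross_flipUnknown P T he]
      · rw [Set.indicator_of_notMem hy,
          Set.indicator_of_notMem (fun h => hy ((hE'.2 y le_rfl).1 h)), neg_zero])

end Rollout

end VoI

end

/-! ### The main theorem -/

open VoI in
theorem theorem3 {Ω : Type*} [mΩ : MeasurableSpace Ω] (μ : Measure Ω) [IsProbabilityMeasure μ]
    {N L T : ℕ} {n p m : Fin N → ℕ} (P : ∀ i, Plant (n i) (p i) (m i))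
    (lam : Fin L → ℝ) (hlam : ∀ j, 0 ≤ lam j)
    (ξ : ∀ i, Ω → Noise (n i) (m i)) (hξ : ∀ i, IsNoise μ (P i) (ξ i))
    (D : Fin N → Set (Fin L)) :
    -- the value-of-information policies belong to the admissible class
    (∀ i, Admissible (P i) T (voiLaw (P i) T lam (D i))) ∧
    -- the policy of a scheduler is a threshold rule in its own mismatch error
    (∀ i, ∀ j ∈ D i, ∀ (k : ℕ) (ω : Ω),
      decision (P i) T (voiLaw (P i) T lam (D i)) (ξ i ω) k j = true ↔
        k + (L - (j : ℕ)) ≤ T ∧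
        dVoI (P i) T lam k j
          (mismatch (state (P i) T (voiLaw (P i) T lam (D i)) (ξ i ω) k) j) < 0) ∧
    -- it uses only the information of that scheduler, and the closed form is the gain in the
    -- cost-to-go, given this information, of a transmission as opposed to no transmission
    (∀ (i : Fin N) (j : Fin L) (k : ℕ), k + (L - (j : ℕ)) ≤ T →
      let π := voiLaw (P i) T lam (D i)
      let J := infoSet (P i) T π (ξ i) (j : ℕ) j.isLt k
      J ≤ mΩ ∧
      Measurable[J] (fun ω => mismatch (state (P i) T π (ξ i ω) k) j) ∧
      Measurable[J] (fun ω => decision (P i) T π (ξ i ω) k j) ∧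
      (∀ a, Integrable (fun ω => costToGo (P i) T lam (rollout π k j a) (ξ i ω) k j) μ) ∧
      (μ[fun ω => costToGo (P i) T lam (rollout π k j true) (ξ i ω) k j | J] -
          μ[fun ω => costToGo (P i) T lam (rollout π k j false) (ξ i ω) k j | J]
        =ᵐ[μ] fun ω => dVoI (P i) T lam k j (mismatch (state (P i) T π (ξ i ω) k) j))) ∧
    -- the periodic policy is outperformed, in each loop and in total
    (∀ i, Integrable (fun ω => pathCost (P i) T (voiLaw (P i) T lam (D i)) (ξ i ω)) μ ∧
      Integrable (fun ω => pathCost (P i) T (periodic : Law (n i) L) (ξ i ω)) μ ∧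
      lagrangian μ (P i) T lam (voiLaw (P i) T lam (D i)) (ξ i) ≤
        lagrangian μ (P i) T lam periodic (ξ i)) ∧
    (∑ i, controlCost μ (P i) T (voiLaw (P i) T lam (D i)) (ξ i) +
        ∑ j, lam j * ∑ i, requestRate μ (P i) T (voiLaw (P i) T lam (D i)) (ξ i) j ≤
      ∑ i, controlCost μ (P i) T (periodic : Law (n i) L) (ξ i) +
        ∑ j, lam j * ∑ i, requestRate μ (P i) T (periodic : Law (n i) L) (ξ i) j) := by
  have hm := fun i => isMeasurable_voiRule (P i) T lam (D i)
  have he := fun i => isEven_voiRule (P i) T lam (D i)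
  have hle := fun i => (hξ i).lagrangian_voiLaw_le T hlam (D i)
  refine ⟨fun i => admissible_ruleLaw (P i) T (hm i), ?_, ?_, fun i => ⟨?_, ?_, hle i⟩, ?_⟩
  · intro i j hj k ω
    rw [decision, voiLaw, if_pos hj, decide_eq_true_iff]
  · intro i j k hk
    have hmis := measurable_mismatch_infoSet (P i) T (voiLaw (P i) T lam (D i)) (ξ i) j k
    refine ⟨(hξ i).infoSet_le (hm i) (he i) T j k, hmis, (hm i k j).comp hmis, fun a => ?_,
      (hξ i).condExp_rollout_sub (hm i) (he i) T lam j hk⟩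
    rw [voiLaw_eq_ruleLaw, rollout_ruleLaw]
    exact (hξ i).integrable_costToGo (isMeasurable_rolloutRule (hm i) k j a) T lam k j
  · exact (hξ i).integrable_pathCost (hm i) T
  · exact (hξ i).integrable_pathCost (θ := fun _ _ _ => true) (fun _ _ => measurable_const) T
  · have h := Finset.sum_le_sum fun i (_ : i ∈ Finset.univ) => hle i
    simp only [lagrangian, Finset.sum_add_distrib] at h
    rw [Finset.sum_comm, Finset.sum_comm (f := fun i j => lam j * requestRate μ (P i) T periodic
      (ξ i) j)] at h
    simpa only [Finset.mul_sum] using h
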